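/- Notation. Let $d,s\ge 1$, $\langle z\rangle=\sqrt{1+|z|^2}$, let $\mathbb B^n\subset\mathbb R^n$ be the closed unit ball, $(\mathbb B^n)^o$ its interior and $\mathbb S^{n-1}=\partial\mathbb B^n$. A smooth $a:\mathbb R^d\times\mathbb R^s\to\mathbb R$ is in $\mathrm{SG}^{m_e,m_\psi}$ if $|\partial_x^\beta\partial_\theta^\alpha a|\le C_{\alpha\beta}\langle x\rangle^{m_e-|\beta|}\langle\theta\rangle^{m_\psi-|\alpha|}$ for all $\alpha,\beta$. A $0$-excision function is a smooth function that is $0$ near the origin and $1$ outside a bounded set. We write $a\in\mathrm{SG}^{m_e,m_\psi}_{\mathrm{cl}(x)}$ if $a\in\mathrm{SG}^{m_e,m_\psi}$ and, for some $0$-excision function $\chi$, there are smooth $a_j$ on $(\mathbb R^d\setminus0)\times\mathbb R^s$, homogeneous of degree $m_e-j$ in $x$, with $a-\sum_{j<N}\chi(x)a_j\in\mathrm{SG}^{m_e-N,m_\psi}$ for all $N$; $\mathrm{SG}^{m_e,m_\psi}_{\mathrm{cl}(\theta)}$ is defined in the same way with respect to $\theta$. $a$ is SG-classical, $a\in\mathrm{SG}_{\mathrm{cl}}^{m_e,m_\psi}$,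 if it has an expansion in $x$ as above with all $\chi(x)a_j\in\mathrm{SG}^{m_e-j,m_\psi}_{\mathrm{cl}(\theta)}$, and an expansion in $\theta$ with all $\chi(\theta)a_k\in\mathrm{SG}^{m_e,m_\psi-k}_{\mathrm{cl}(x)}$. Fix for each dimension $n\in\{d,s\}$ a diffeomorphism $\iota:\mathbb R^n\to(\mathbb B^n)^o$ with $\iota(x)=\frac{x}{|x|}\bigl(1-\frac1{|x|}\bigr)$ for $|x|>3$, and a smooth $h:\mathbb B^n\to[0,\infty)$ with $h(y)=|y|$ for $|y|>2/3$ and $1-h\ne0$ on $(\mathbb B^n)^o$; put $\tilde y=1-h(y)$, $\tilde\gamma=1-h(\gamma)$. For $a\in\mathrm{SG}^{m_e,m_\psi}_{\mathrm{cl}}$ let $\iota_{\mathrm{SG}}^{m_e,m_\psi}(a)$ be the continuous (in fact smooth) extension to $\mathbb B^d\times\mathbb B^s$ of $\tilde y^{m_e}\tilde\gamma^{m_\psi}a(\iota^{-1}(y),\iota^{-1}(\gamma))$; $a$ is elliptic at a boundary point if this function is non-zero there. The boundary of $\mathbb B^d\times\mathbb B^s$ is the disjoint union of the open faces $\tilde{\mathcal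 B}^e=\mathbb S^{d-1}\times(\mathbb B^s)^o$, $\tilde{\mathcal B}^\psi=(\mathbb B^d)^o\times\mathbb S^{s-1}$ and the corner $\tilde{\mathcal B}^{\psi e}=\mathbb S^{d-1}\times\mathbb S^{s-1}$; the boundary $\tilde{\mathcal W}$ of $\mathbb B^d\times\mathbb B^d$ is decomposed in the same way into $\tilde{\mathcal W}^e,\tilde{\mathcal W}^\psi,\tilde{\mathcal W}^{\psi e}$. Write $\overline{\mathcal B}^\bullet$, $\overline{\mathcal W}^\bullet$ for the closures, $\bullet\in\{e,\psi,\psi e\}$. Let $\varphi\in\mathrm{SG}^{1,1}_{\mathrm{cl}}(\mathbb R^d\times\mathbb R^s)$ be a real-valued phase function, that is, for some $R,c>0$, $\langle x\rangle^2|\nabla_x\varphi|^2+\langle\theta\rangle^2|\nabla_\theta\varphi|^2\ge c\langle x\rangle^2\langle\theta\rangle^2$ whenever $|x|+|\theta|\ge R$. Let - $\tilde{\mathcal C}_\varphi$ be the set of boundary points of $\mathbb B^d\times\mathbb B^s$ at which $\langle\theta\rangle^2|\nabla_\theta\varphi|^2\in\mathrm{SG}^{2,2}_{\mathrm{cl}}$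 is not elliptic, and $\tilde{\mathcal C}_\varphi^\bullet=\tilde{\mathcal C}_\varphi\cap\overline{\mathcal B}^\bullet$; - $\tilde\Lambda_\varphi\subset\tilde{\mathcal W}$ be the set of stationary points: $(y_0,\eta_0)\in\tilde{\mathcal W}$ is *not* in $\tilde\Lambda_\varphi$ iff there are an open neighbourhood $U$ of it in $\mathbb B^d\times\mathbb B^d$, an open neighbourhood $V$ of $\{(y,\gamma,\eta):(y,\gamma)\in\tilde{\mathcal C}_\varphi,\ (y,\eta)\in U\}$ in $\mathbb B^d\times\mathbb B^s\times\mathbb B^d$ and $c>0$ with $|\nabla_x\varphi(x,\theta)-\xi|\ge c(\langle\theta\rangle+|\xi|)$ whenever $(\iota(x),\iota(\theta),\iota(\xi))\in V$; and $\tilde\Lambda_\varphi^\bullet=\tilde\Lambda_\varphi\cap\overline{\mathcal W}^\bullet$; - $\tilde\lambda_\varphi$ be the extension by continuity of $(\iota\times\iota)\circ\lambda_\varphi\circ(\iota^{-1}\times\iota^{-1})$, $\lambda_\varphi(x,\theta)=(x,\nabla_x\varphi(x,\theta))$, to the boundary points where it exists (it is smooth near $\tilde{\mathcal C}_\varphi$).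 Assume that $\varphi$ is non-degenerate: at each point of $\tilde{\mathcal C}_\varphi$, lying in the open face (or corner) $X\in\{\tilde{\mathcal B}^e,\tilde{\mathcal B}^\psi,\tilde{\mathcal B}^{\psi e}\}$, the $s$ differentials $d\bigl(\iota^{1,0}_{\mathrm{SG}}(\partial_{\theta_j}\varphi)|_X\bigr)$ are linearly independent. A subset $Y$ of a manifold with corners $X$ is a totally neat submanifold if near each of its points $Y$ is, in a chart of $X$ centred there with values in a quadrant, a relatively open piece of a quadrant of a linear subspace, cut out by as many linearly independent inequalities as the quadrant of $X$ (so the boundary depth of the point in $Y$ and in $X$ is the same). **Proposition.** 1. $\tilde\Lambda_\varphi=\tilde\Lambda_\varphi^e\cup\tilde\Lambda_\varphi^\psi$, $\ \tilde\Lambda_\varphi^e\cap\tilde\Lambda_\varphi^\psi=\tilde\Lambda_\varphi^{\psi e}\subset\tilde{\mathcal W}^{\psi e}$, and $\tilde\lambda_\varphi(\tilde{\mathcal C}_\varphi^\bullet)=\tilde\Lambda_\varphi^\bullet$. For each $\bullet$ and $p\in\tilde{\mathcal C}^\bullet_\varphi$ the differential $d\tilde\lambda_\varphi(p)$ is injective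 on $T_p\tilde{\mathcal C}_\varphi^\bullet$, and every point of $\tilde{\mathcal C}_\varphi$ has an open neighbourhood $O$ such that $\tilde\lambda_\varphi$ is injective on $\tilde{\mathcal C}_\varphi\cap\overline O$. 2. Let $O$ be any open set such that $\tilde\lambda_\varphi$ is injective on $\tilde{\mathcal C}_\varphi\cap\overline O$, and put $L^\bullet=\tilde\lambda_\varphi(\tilde{\mathcal C}_\varphi^\bullet\cap O)$. (If $\tilde\lambda_\varphi$ is injective on $\tilde{\mathcal C}_\varphi$, one may take $O$ to be the whole space, and then $L^\bullet=\tilde\Lambda_\varphi^\bullet$.) Then: - $L^\bullet$ is a totally neat submanifold of the face $\overline{\mathcal W}^\bullet$, of codimension $d$; its dimension is $d-1$ for $\bullet=e,\psi$ and $d-2$ for $\bullet=\psi e$ (so $L^{\psi e}=\emptyset$ if $d=1$); - $T_{\tilde\lambda_\varphi(p)}L^\bullet=d\tilde\lambda_\varphi(p)\bigl(T_p\tilde{\mathcal C}_\varphi^\bullet\bigr)$ for all $p\in\tilde{\mathcal C}_\varphi^\bullet\cap O$; - $L^e\cap L^\psi=L^{\psi e}$, and the intersection is clean: $T_qL^{\psi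 e}=T_qL^e\cap T_qL^\psi$ for all $q\in L^{\psi e}$. In other words, the components of $\tilde\Lambda_\varphi$ are immersed totally neat submanifolds, parametrized by $\tilde\lambda_\varphi$, which intersect cleanly in the corner; they are embedded if $\tilde\lambda_\varphi$ is injective on $\tilde{\mathcal C}_\varphi$. -/

import Mathlib

open Set Filter Topology Metric
open scoped ContDiff

noncomputable section

namespace SG

/-- Euclidean space `ℝⁿ`. -/
abbrev Euc (n : ℕ) : Type := EuclideanSpace ℝ (Fin n)

/-- The Japanese bracket `⟨x⟩ = √(1 + |x|²)`. -/
def jap {n : ℕ} (x : Euc n) : ℝ := Real.sqrt (1 + ‖x‖ ^ 2)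

/-! ### Classical SG symbols -/

/-- Real-valued SG symbols of order `(me, mψ)` on `ℝᵈ × ℝˢ`: smooth functions with
`|∂_x^β ∂_θ^α a(x, θ)| ≤ C ⟨x⟩^(me - |β|) ⟨θ⟩^(mψ - |α|)`.
The partial derivatives of orders `k` in `x` and `l` in `θ` are collected in one tensor. -/
structure IsSymbol {d s : ℕ} (me mψ : ℝ) (a : Euc d × Euc s → ℝ) : Prop where
  smooth : ContDiff ℝ ∞ a
  bound : ∀ k l : ℕ, ∃ C : ℝ, ∀ (x : Euc d) (θ : Euc s),
    ‖iteratedFDeriv ℝ k (fun u : Euc d => iteratedFDeriv ℝ l (fun w : Euc s => a (u, w)) θ) x‖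
      ≤ C * jap x ^ (me - (k : ℝ)) * jap θ ^ (mψ - (l : ℝ))

/-- `0`-excision functions: smooth, zero near the origin, one outside a bounded set. -/
structure IsExcision {n : ℕ} (χ : Euc n → ℝ) : Prop where
  smooth : ContDiff ℝ ∞ χ
  zero_near : ∀ᶠ x in 𝓝 (0 : Euc n), χ x = 0
  one_far : ∃ R : ℝ, ∀ x, R ≤ ‖x‖ → χ x = 1

/-- Smooth functions on `(ℝᵈ ∖ 0) × ℝˢ`, homogeneous of degree `m` in the first variable.
(The values at `x = 0` are irrelevant.) -/
def IsHomX {d s : ℕ} (m : ℝ) (a : Euc d × Euc s → ℝ) : Prop :=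
  ContDiffOn ℝ ∞ a {p | p.1 ≠ 0} ∧
    ∀ t : ℝ, 0 < t → ∀ (x : Euc d) (θ : Euc s), x ≠ 0 → a (t • x, θ) = t ^ m * a (x, θ)

/-- Smooth functions on `ℝᵈ × (ℝˢ ∖ 0)`, homogeneous of degree `m` in the second variable. -/
def IsHomTheta {d s : ℕ} (m : ℝ) (a : Euc d × Euc s → ℝ) : Prop :=
  ContDiffOn ℝ ∞ a {p | p.2 ≠ 0} ∧
    ∀ t : ℝ, 0 < t → ∀ (x : Euc d) (θ : Euc s), θ ≠ 0 → a (x, t • θ) = t ^ m * a (x, θ)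

/-- Symbols that are polyhomogeneous with respect to `x`. -/
def IsClassicalX {d s : ℕ} (me mψ : ℝ) (a : Euc d × Euc s → ℝ) : Prop :=
  IsSymbol me mψ a ∧ ∃ (χ : Euc d → ℝ) (b : ℕ → Euc d × Euc s → ℝ), IsExcision χ ∧
    (∀ j : ℕ, IsHomX (me - (j : ℝ)) (b j)) ∧
    ∀ N : ℕ, IsSymbol (me - (N : ℝ)) mψ
      (fun p => a p - ∑ j ∈ Finset.range N, χ p.1 * b j p)

/-- Symbols that are polyhomogeneous with respect to `θ`. -/
def IsClassicalTheta {d s : ℕ} (me mψ : ℝ) (a : Euc d × Euc s → ℝ) : Prop :=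
  IsSymbol me mψ a ∧ ∃ (χ : Euc s → ℝ) (b : ℕ → Euc d × Euc s → ℝ), IsExcision χ ∧
    (∀ k : ℕ, IsHomTheta (mψ - (k : ℝ)) (b k)) ∧
    ∀ N : ℕ, IsSymbol me (mψ - (N : ℝ))
      (fun p => a p - ∑ k ∈ Finset.range N, χ p.2 * b k p)

/-- SG-classical symbols of order `(me, mψ)`. -/
structure IsClassical {d s : ℕ} (me mψ : ℝ) (a : Euc d × Euc s → ℝ) : Prop where
  symbol : IsSymbol me mψ a
  expansion_x : ∃ (χ : Euc d → ℝ) (b : ℕ → Euc d × Euc s → ℝ), IsExcision χ ∧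
    (∀ j : ℕ, IsHomX (me - (j : ℝ)) (b j)) ∧
    (∀ j : ℕ, IsClassicalTheta (me - (j : ℝ)) mψ (fun p => χ p.1 * b j p)) ∧
    ∀ N : ℕ, IsSymbol (me - (N : ℝ)) mψ
      (fun p => a p - ∑ j ∈ Finset.range N, χ p.1 * b j p)
  expansion_theta : ∃ (χ : Euc s → ℝ) (b : ℕ → Euc d × Euc s → ℝ), IsExcision χ ∧
    (∀ k : ℕ, IsHomTheta (mψ - (k : ℝ)) (b k)) ∧
    (∀ k : ℕ, IsClassicalX me (mψ - (k : ℝ)) (fun p => χ p.2 * b k p)) ∧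
    ∀ N : ℕ, IsSymbol me (mψ - (N : ℝ))
      (fun p => a p - ∑ k ∈ Finset.range N, χ p.2 * b k p)

/-! ### SG phase functions of order `(1, 1)` -/

/-- `∇_x φ` at `(x, θ)`. -/
def gradX {d s : ℕ} (φ : Euc d × Euc s → ℝ) (p : Euc d × Euc s) : Euc d :=
  gradient (fun u : Euc d => φ (u, p.2)) p.1

/-- `∇_θ φ` at `(x, θ)`. -/
def gradTheta {d s : ℕ} (φ : Euc d × Euc s → ℝ) (p : Euc d × Euc s) : Euc s :=
  gradient (fun w : Euc s => φ (p.1, w)) p.2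

/-- Ellipticity of order `(2, 2)` of `⟨x⟩² |∇_x φ|² + ⟨θ⟩² |∇_θ φ|²`. -/
def PhaseElliptic {d s : ℕ} (φ : Euc d × Euc s → ℝ) : Prop :=
  ∃ R : ℝ, 0 < R ∧ ∃ c : ℝ, 0 < c ∧ ∀ (x : Euc d) (θ : Euc s), R ≤ ‖x‖ + ‖θ‖ →
    c * (jap x ^ 2 * jap θ ^ 2) ≤
      jap x ^ 2 * ‖gradX φ (x, θ)‖ ^ 2 + jap θ ^ 2 * ‖gradTheta φ (x, θ)‖ ^ 2

/-- Classical SG phase functions of order `(1, 1)`. -/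
structure IsClassicalPhase {d s : ℕ} (φ : Euc d × Euc s → ℝ) : Prop where
  classical : IsClassical 1 1 φ
  elliptic : PhaseElliptic φ

/-! ### Radial compactification -/

/-- A radial compactification of `ℝⁿ`: a diffeomorphism `ι` from `ℝⁿ` onto the open unit ball
with `ι(x) = (x / |x|) (1 - 1 / |x|)` for `|x| > 3`, together with a smooth `h : 𝔹ⁿ → [0, ∞)`,
`h(y) = |y|` for `|y| > 2/3`, such that `1 - h` vanishes at most on the boundary. -/
structure Compactification (n : ℕ) where
  toFun : Euc n → Euc n
  invFun : Euc n → Euc n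
  h : Euc n → ℝ
  contDiff_toFun : ContDiff ℝ ∞ toFun
  toFun_mem : ∀ x, toFun x ∈ ball (0 : Euc n) 1
  contDiffOn_invFun : ContDiffOn ℝ ∞ invFun (ball (0 : Euc n) 1)
  left_inv : ∀ x, invFun (toFun x) = x
  right_inv : ∀ y ∈ ball (0 : Euc n) 1, toFun (invFun y) = y
  toFun_eq : ∀ x, 3 < ‖x‖ → toFun x = (1 - 1 / ‖x‖) • (‖x‖⁻¹ • x)
  contDiffOn_h : ContDiffOn ℝ ∞ h (closedBall (0 : Euc n) 1)
  h_nonneg : ∀ y ∈ closedBall (0 : Euc n) 1, 0 ≤ h y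
  h_eq : ∀ y, 2 / 3 < ‖y‖ → ‖y‖ ≤ 1 → h y = ‖y‖
  h_ne : ∀ y, ‖y‖ < 2 / 3 → 1 - h y ≠ 0

/-- `𝔹ᵐ × 𝔹ⁿ`, a product of closed unit balls. -/
def cball2 (m n : ℕ) : Set (Euc m × Euc n) := closedBall 0 1 ×ˢ closedBall 0 1

/-- The interior of `𝔹ᵐ × 𝔹ⁿ`. -/
def oball2 (m n : ℕ) : Set (Euc m × Euc n) := ball 0 1 ×ˢ ball 0 1

/-- Labels of the three boundary faces: `e` (first factor at infinity), `ψ` (second factor at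
infinity) and the corner `ψe` (both). -/
inductive Face
  | e
  | ψ
  | ψe

/-- The open boundary faces of `𝔹ᵐ × 𝔹ⁿ`; their disjoint union is the boundary. -/
def openFace (m n : ℕ) : Face → Set (Euc m × Euc n)
  | .e => sphere 0 1 ×ˢ ball 0 1
  | .ψ => ball 0 1 ×ˢ sphere 0 1
  | .ψe => sphere 0 1 ×ˢ sphere 0 1

/-- The closed boundary faces of `𝔹ᵐ × 𝔹ⁿ`. -/
def closedFace (m n : ℕ) : Face → Set (Euc m × Euc n)
  | .e => sphere 0 1 ×ˢ closedBall 0 1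
  | .ψ => closedBall 0 1 ×ˢ sphere 0 1
  | .ψe => sphere 0 1 ×ˢ sphere 0 1

/-- The boundary of `𝔹ᵐ × 𝔹ⁿ`. -/
def bdry (m n : ℕ) : Set (Euc m × Euc n) := {p | ∃ f : Face, p ∈ openFace m n f}

/-- The function on `𝔹ᵈ × 𝔹ˢ` attached to a symbol `a` of order `(me, mψ)`: the continuous
extension to the boundary of `(1 - h(y))^me (1 - h(γ))^mψ a(ι⁻¹(y), ι⁻¹(γ))`. -/
def iotaSG {d s : ℕ} (κd : Compactification d) (κs : Compactification s) (me mψ : ℝ)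
    (a : Euc d × Euc s → ℝ) : Euc d × Euc s → ℝ :=
  extendFrom (oball2 d s) fun p =>
    (1 - κd.h p.1) ^ me * (1 - κs.h p.2) ^ mψ * a (κd.invFun p.1, κs.invFun p.2)

/-- Ellipticity of a classical symbol of order `(me, mψ)` at a boundary point. -/
def EllipticAt {d s : ℕ} (κd : Compactification d) (κs : Compactification s) (me mψ : ℝ)
    (a : Euc d × Euc s → ℝ) (p : Euc d × Euc s) : Prop :=
  iotaSG κd κs me mψ a p ≠ 0

/-! ### The sets `C̃_φ` and `Λ̃_φ` and the map `λ̃_φ` -/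

/-- `C̃_φ`: the boundary points of `𝔹ᵈ × 𝔹ˢ` where `⟨θ⟩² |∇_θ φ|²` is not elliptic. -/
def critSet {d s : ℕ} (κd : Compactification d) (κs : Compactification s)
    (φ : Euc d × Euc s → ℝ) : Set (Euc d × Euc s) :=
  {p | p ∈ bdry d s ∧
    ¬ EllipticAt κd κs 2 2 (fun q => ‖jap q.2 • gradTheta φ q‖ ^ 2) p}

/-- The parts `C̃_φ^e`, `C̃_φ^ψ`, `C̃_φ^ψe` of `C̃_φ` in the closed faces. -/
def critPart {d s : ℕ} (κd : Compactification d) (κs : Compactification s)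
    (φ : Euc d × Euc s → ℝ) (f : Face) : Set (Euc d × Euc s) :=
  critSet κd κs φ ∩ closedFace d s f

/-- `Λ̃_φ`: a boundary point `(y₀, η₀)` of `𝔹ᵈ × 𝔹ᵈ` is *not* in this set if there are a
neighbourhood `U` of it and a neighbourhood `V` of `{(y, γ, η) | (y, γ) ∈ C̃_φ, (y, η) ∈ U}`
such that `|∇_x φ(x, θ) - ξ| ≥ c (⟨θ⟩ + |ξ|)` for all `(x, θ, ξ)` in the preimage of `V`. -/
def statSet {d s : ℕ} (κd : Compactification d) (κs : Compactification s)
    (φ : Euc d × Euc s → ℝ) : Set (Euc d × Euc d) :=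
  {q | q ∈ bdry d d ∧ ¬ ∃ U : Set (Euc d × Euc d), IsOpen U ∧ q ∈ U ∧
    ∃ V : Set (Euc d × Euc s × Euc d), IsOpen V ∧
      (∀ (y : Euc d) (γ : Euc s) (η : Euc d), (y, γ) ∈ critSet κd κs φ →
        η ∈ closedBall (0 : Euc d) 1 → (y, η) ∈ U → (y, γ, η) ∈ V) ∧
      ∃ c : ℝ, 0 < c ∧ ∀ (x : Euc d) (θ : Euc s) (ξ : Euc d),
        (κd.toFun x, κs.toFun θ, κd.toFun ξ) ∈ V →
          c * (jap θ + ‖ξ‖) ≤ ‖gradX φ (x, θ) - ξ‖}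

/-- The parts `Λ̃_φ^e`, `Λ̃_φ^ψ`, `Λ̃_φ^ψe` of `Λ̃_φ` in the closed faces. -/
def statPart {d s : ℕ} (κd : Compactification d) (κs : Compactification s)
    (φ : Euc d × Euc s → ℝ) (f : Face) : Set (Euc d × Euc d) :=
  statSet κd κs φ ∩ closedFace d d f

/-- `λ̃_φ`: the extension by continuity to the boundary of
`(ι × ι) ∘ λ_φ ∘ (ι⁻¹ × ι⁻¹)`, where `λ_φ(x, θ) = (x, ∇_x φ(x, θ))`. -/
def lambdaTilde {d s : ℕ} (κd : Compactification d) (κs : Compactification s)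
    (φ : Euc d × Euc s → ℝ) : Euc d × Euc s → Euc d × Euc d :=
  extendFrom (oball2 d s) fun p =>
    (κd.toFun (κd.invFun p.1), κd.toFun (gradX φ (κd.invFun p.1, κs.invFun p.2)))

/-- The differential of `λ̃_φ` at a point of `𝔹ᵈ × 𝔹ˢ` (one-sided at the boundary). -/
def dLambdaTilde {d s : ℕ} (κd : Compactification d) (κs : Compactification s)
    (φ : Euc d × Euc s → ℝ) (p : Euc d × Euc s) : Euc d × Euc s →L[ℝ] Euc d × Euc d :=
  fderivWithin ℝ (lambdaTilde κd κs φ) (cball2 d s) p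

/-! ### Submanifolds with corners -/

section Manifold

variable {V : Type*} [NormedAddCommGroup V] [NormedSpace ℝ V]

/-- The tangent space at `p` of a submanifold with corners `S` of a normed space: the linear
span of the tangent directions of `S` at `p`. -/
def tangentSpan (S : Set V) (p : V) : Submodule ℝ V :=
  Submodule.span ℝ (tangentConeAt ℝ S p)

/-- The quadrant of a linear subspace `F` cut out by linear functionals on `F`. -/
def quadrant {n k : ℕ} (F : Submodule ℝ (Euc n)) (Λ : Fin k → (F →L[ℝ] ℝ)) : Set (Euc n) :=
  {v | ∃ hv : v ∈ F, ∀ i, 0 ≤ Λ i ⟨v, hv⟩}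

/-- A smooth chart on an (open subset `dom ∩ X` of an) embedded manifold with corners `X ⊆ V`,
with values in a quadrant `{Λ₁ ≥ 0, …, Λ_k ≥ 0}` of `ℝⁿ`, the `Λᵢ` linearly independent. -/
structure CornerChart (X : Set V) (n k : ℕ) where
  dom : Set V
  isOpen_dom : IsOpen dom
  toFun : V → Euc n
  invFun : Euc n → V
  Λ : Fin k → (Euc n →L[ℝ] ℝ)
  linearIndependent : LinearIndependent ℝ Λ
  contDiffOn_toFun : ContDiffOn ℝ ∞ toFun dom
  image_eq : ∃ O : Set (Euc n), IsOpen O ∧ toFun '' (dom ∩ X) = O ∩ {v | ∀ i, 0 ≤ Λ i v}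
  contDiffOn_invFun : ContDiffOn ℝ ∞ invFun (toFun '' (dom ∩ X))
  left_inv : ∀ x ∈ dom ∩ X, invFun (toFun x) = x

/-- `Y` is a totally neat submanifold of `X`, of dimension `m` and codimension `c`: at every
`y ∈ Y` there is a chart of `X` centred at `y` in which `Y` becomes a relatively open subset
of a quadrant of a linear subspace `F`. The number `k` of inequalities is the same for `X` and
for `Y`, that is, `y` has the same index (boundary depth) in `Y` as in `X`. -/
def IsTotallyNeat (X Y : Set V) (m c : ℤ) : Prop :=
  Y ⊆ X ∧ ∀ y ∈ Y, ∃ (n k : ℕ) (ν : CornerChart X n k) (F : Submodule ℝ (Euc n))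
    (Λ' : Fin k → (F →L[ℝ] ℝ)),
    y ∈ ν.dom ∧ ν.toFun y = 0 ∧ LinearIndependent ℝ Λ' ∧
    ν.toFun '' (ν.dom ∩ Y) = ν.toFun '' (ν.dom ∩ X) ∩ quadrant F Λ' ∧
    (∃ O : Set (Euc n), IsOpen O ∧
      ν.toFun '' (ν.dom ∩ X) ∩ quadrant F Λ' = O ∩ quadrant F Λ') ∧
    (Module.finrank ℝ F : ℤ) = m ∧ (n : ℤ) - (Module.finrank ℝ F : ℤ) = c

end Manifold

/-! ### Non-degeneracy -/

/-- The smooth function on `𝔹ᵈ × 𝔹ˢ` attached to the symbol `∂φ/∂θ_j` of order `(1, 0)`. -/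
def thetaDeriv {d s : ℕ} (κd : Compactification d) (κs : Compactification s)
    (φ : Euc d × Euc s → ℝ) (j : Fin s) : Euc d × Euc s → ℝ :=
  iotaSG κd κs 1 0 (fun q => gradTheta φ q j)

/-- Non-degeneracy: at each point of `C̃_φ`, the differentials of the `s` functions
`thetaDeriv j`, restricted to the boundary face containing the point, are linearly independent
linear forms on the tangent space of that face. -/
def NonDegenerate {d s : ℕ} (κd : Compactification d) (κs : Compactification s)
    (φ : Euc d × Euc s → ℝ) : Prop :=
  ∀ f : Face, ∀ p ∈ critSet κd κs φ ∩ openFace d s f,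
    LinearIndependent ℝ fun j : Fin s =>
      (fderivWithin ℝ (thetaDeriv κd κs φ j) (cball2 d s) p).toLinearMap.domRestrict
        (tangentSpan (openFace d s f) p)

/-- The dimensions `d - 1`, `d - 1`, `d - 2` of the three parts of `Λ̃_φ` (negative: empty). -/
def lagDim (d : ℕ) : Face → ℤ
  | .e => (d : ℤ) - 1
  | .ψ => (d : ℤ) - 1
  | .ψe => (d : ℤ) - 2

end SG

end

/-!
The proof works in homogeneous coordinates `((ω, ρ), (σ, r))`, `x = ω / ρ`, `θ = σ / r`, in which
the boundary faces are `ρ = 0` and `r = 0`. The basic object is the rescaled differential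
`E = (r ∂ₓφ, ρ ∂_θφ)` (`covec`). It is the part of the differential of `ρ r φ(ω/ρ, σ/r)` in the
directions `(ω, σ)`, its `θ`-part is the extension of `∂_θφ` whose zeros are `C̃_φ`
(`mem_critSet_iff`), and
`(r ∂ₓφ, r)` are homogeneous coordinates of `∇ₓφ`, so that `λ̃_φ` is the composition of `E` with a
smooth projection (`lambdaTilde_eq`). The phase condition says that `E` does not vanish on the
boundary; hence that projection is defined on `C̃_φ`.

The regularity needed at a face is less than smoothness of `E`. The first two terms of the
expansion of `φ` at a face are homogeneous there and polyhomogeneous in the other variable; by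
Borel summation (`PolyTheta.exists_extension`) they become functions `Φ₀`, `Φ₁` smooth across the
boundary, and `E = (DΦ₀ + ε DΦ₁) ∘ J + O(ε²)`, where `ε` is the defining function of the face and
`J` the inclusion of the directions `(ω, σ)` (`IsClassical.exists_isExpansionAt`). So on the face
`C̃_φ` and `λ̃_φ` are given by the smooth function `Φ₀`, and `λ̃_φ` is differentiable up to the
boundary. At the corner the expansion in `θ` serves.

The heart of the matter is that `λ̃_φ` is an immersion on `C̃_φ`
(`IsExpansionAt.eq_zero_of_fderiv_eq_zero`). A tangent vector in the kernel of `dλ̃_φ` has no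
`x`-part, and it changes the coordinates of `∇ₓφ` only by a multiple of themselves. After
subtracting the radial vector, Euler's identities for the homogeneous leading term give a vector
`w` in the `σ`-directions such that the Hessian of `Φ₀` vanishes on the pairs of `w` with the
directions `(ω, σ)` and with the radial ones. By the symmetry of the Hessian the combination of
the equations of `C̃_φ` with coefficients `w` has zero differential along the open face;
non-degeneracy gives `w = 0`.

Since `λ̃_φ` maps the boundary hypersurfaces to the corresponding ones, with positive factors
between the defining functions, the rest of the local statement is the inverse function theorem
for manifolds with corners (`local_structure`): near a point the image is cut out of its face by
equations that are independent on the stratum of the point, hence totally neat. Compactness of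
`C̃_φ` turns injectivity into a topological embedding (`eventually_mem_image_lambdaTilde`) and
reduces the equality `Λ̃_φ = λ̃_φ(C̃_φ)` to the local estimate `eventually_le_norm_gradX_sub`. The
intersection in the corner is clean because `λ̃_φ` does not change the `y`-coordinate
(`tangentSpan_image_corner`).
-/

noncomputable section

namespace SG

/-! ### Local inverses of smooth maps -/

section Smooth

variable {E F G : Type*} [NormedAddCommGroup E] [NormedSpace ℝ E]
  [NormedAddCommGroup F] [NormedSpace ℝ F] [NormedAddCommGroup G] [NormedSpace ℝ G]

/-- `f` is smooth on a neighbourhood of `x`. (`ContDiffAt ℝ ∞ f x` says less: there the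
neighbourhood may depend on the order of differentiability.) -/
def SmoothNear (f : E → F) (x : E) : Prop := ∀ᶠ y in 𝓝 x, ContDiffAt ℝ ∞ f y

theorem SmoothNear.contDiffAt {f : E → F} {x : E} (h : SmoothNear f x) : ContDiffAt ℝ ∞ f x :=
  h.self_of_nhds

theorem SmoothNear.continuousAt {f : E → F} {x : E} (h : SmoothNear f x) : ContinuousAt f x :=
  h.contDiffAt.continuousAt

theorem SmoothNear.differentiableAt {f : E → F} {x : E} (h : SmoothNear f x) :
    DifferentiableAt ℝ f x :=
  h.contDiffAt.differentiableAt (by simp)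

theorem SmoothNear.hasFDerivAt {f : E → F} {x : E} (h : SmoothNear f x) :
    HasFDerivAt f (fderiv ℝ f x) x :=
  h.differentiableAt.hasFDerivAt

theorem SmoothNear.eventually {f : E → F} {x : E} (h : SmoothNear f x) :
    ∀ᶠ y in 𝓝 x, SmoothNear f y :=
  eventually_eventually_nhds.2 h

theorem _root_.ContDiff.smoothNear {f : E → F} (h : ContDiff ℝ ∞ f) (x : E) : SmoothNear f x :=
  Eventually.of_forall fun _ => h.contDiffAt

theorem SmoothNear.comp {g : F → G} {f : E → F} {x : E} (hg : SmoothNear g (f x))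
    (hf : SmoothNear f x) : SmoothNear (fun y => g (f y)) x := by
  filter_upwards [hf, hf.continuousAt.eventually hg] with y h1 h2
  exact h2.comp y h1

theorem SmoothNear.prodMk {f : E → F} {g : E → G} {x : E} (hf : SmoothNear f x)
    (hg : SmoothNear g x) : SmoothNear (fun y => (f y, g y)) x := by
  filter_upwards [hf, hg] with y h1 h2
  exact h1.prodMk h2

theorem SmoothNear.sub {f g : E → F} {x : E} (hf : SmoothNear f x)
    (hg : SmoothNear g x) : SmoothNear (fun y => f y - g y) x := by
  filter_upwards [hf, hg] with y h1 h2
  exact h1.sub h2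

theorem SmoothNear.add {f g : E → F} {x : E} (hf : SmoothNear f x)
    (hg : SmoothNear g x) : SmoothNear (fun y => f y + g y) x := by
  filter_upwards [hf, hg] with y h1 h2
  exact h1.add h2

theorem SmoothNear.smul {c : E → ℝ} {g : E → F} {x : E} (hc : SmoothNear c x)
    (hg : SmoothNear g x) : SmoothNear (fun y => c y • g y) x := by
  filter_upwards [hc, hg] with y h1 h2
  exact h1.smul h2

theorem SmoothNear.clm (L : E →L[ℝ] F) (x : E) : SmoothNear (fun y => L y) x :=
  L.contDiff.smoothNear x

theorem SmoothNear.congr {f g : E → F} {x : E} (hf : SmoothNear f x) (h : g =ᶠ[𝓝 x] f) :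
    SmoothNear g x := by
  filter_upwards [hf, eventually_eventually_nhds.2 h] with y h1 h2
  exact h1.congr_of_eventuallyEq h2

theorem SmoothNear.smoothNear_fderiv {f : E → F} {x : E} (hf : SmoothNear f x) :
    SmoothNear (fun y => fderiv ℝ f y) x := by
  filter_upwards [hf] with y h
  exact h.fderiv_right (m := ∞) (by simp)

theorem SmoothNear.pi {ι : Type*} [Fintype ι] {f : E → ι → ℝ} {x : E}
    (h : ∀ i, SmoothNear (fun y => f y i) x) : SmoothNear f x := by
  filter_upwards [eventually_all.2 h] with y hy
  exact contDiffAt_pi.2 hy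

variable [CompleteSpace E]

/-- The inverse function theorem, with an inverse that is smooth on a whole neighbourhood. -/
theorem SmoothNear.exists_openPartialHomeomorph [FiniteDimensional ℝ E] {f : E → F} {x : E}
    (hf : SmoothNear f x) (hb : Function.Bijective (fderiv ℝ f x)) :
    ∃ e : OpenPartialHomeomorph E F, x ∈ e.source ∧ (∀ y, e y = f y) ∧
      (∀ y ∈ e.source, ContDiffAt ℝ ∞ f y) ∧ ∀ z ∈ e.target, ContDiffAt ℝ ∞ e.symm z := by
  have : FiniteDimensional ℝ F :=
    Module.Finite.of_surjective (fderiv ℝ f x).toLinearMap hb.2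
  have : CompleteSpace F := FiniteDimensional.complete ℝ F
  obtain ⟨L, hL⟩ : ∃ L : E ≃L[ℝ] F, (L : E →L[ℝ] F) = fderiv ℝ f x :=
    ⟨ContinuousLinearEquiv.ofBijective (fderiv ℝ f x) (LinearMap.ker_eq_bot.2 hb.1)
      (LinearMap.range_eq_top.2 hb.2), by ext; rfl⟩
  have hd : HasFDerivAt f (L : E →L[ℝ] F) x := hL ▸ hf.hasFDerivAt
  let e₀ := hf.contDiffAt.toOpenPartialHomeomorph f hd (by simp)
  have hx₀ : x ∈ e₀.source := hf.contDiffAt.mem_toOpenPartialHomeomorph_source hd (by simp)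
  have he₀ : ∀ y, e₀ y = f y := fun y => rfl
  have hgood : ∀ᶠ y in 𝓝 x, ContDiffAt ℝ ∞ f y ∧
      fderiv ℝ f y ∈ range ((↑) : (E ≃L[ℝ] F) → E →L[ℝ] F) := by
    refine hf.and ?_
    have hc : ContinuousAt (fderiv ℝ f) x := hf.smoothNear_fderiv.continuousAt
    refine hc.eventually (ContinuousLinearEquiv.isOpen.mem_nhds ?_)
    exact ⟨L, hL⟩
  obtain ⟨W, hW, hWo, hxW⟩ := _root_.eventually_nhds_iff.1 hgood
  refine ⟨e₀.restrOpen W hWo, ⟨hx₀, hxW⟩, fun y => rfl, fun y hy => (hW y hy.2).1, ?_⟩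
  intro z hz
  have hs : (e₀.restrOpen W hWo).symm z ∈ (e₀.restrOpen W hWo).source :=
    (e₀.restrOpen W hWo).map_target hz
  obtain ⟨L', hL'⟩ := (hW _ hs.2).2
  refine (e₀.restrOpen W hWo).contDiffAt_symm hz (f₀' := L') ?_ (hW _ hs.2).1
  rw [hL']
  exact ((hW _ hs.2).1.differentiableAt (by simp)).hasFDerivAt

/-- The inverse function theorem, in terms of germs. -/
theorem SmoothNear.exists_localInverse [FiniteDimensional ℝ E] {f : E → F} {x : E}
    (hf : SmoothNear f x) (hb : Function.Bijective (fderiv ℝ f x)) :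
    ∃ g : F → E, SmoothNear g (f x) ∧ g (f x) = x ∧ (∀ᶠ y in 𝓝 x, g (f y) = y) ∧
      ∀ᶠ z in 𝓝 (f x), f (g z) = z := by
  obtain ⟨e, hx, he, -, hs⟩ := hf.exists_openPartialHomeomorph hb
  have hfx : f x ∈ e.target := he x ▸ e.map_source hx
  refine ⟨e.symm, ?_, ?_, ?_, ?_⟩
  · filter_upwards [e.open_target.mem_nhds hfx] with z hz using hs z hz
  · rw [← he x]; exact e.left_inv hx
  · filter_upwards [e.open_source.mem_nhds hx] with y hy
    rw [← he y]; exact e.left_inv hy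
  · filter_upwards [e.open_target.mem_nhds hfx] with z hz
    rw [← he]; exact e.right_inv hz

end Smooth

section Linear

variable {V W : Type*} [NormedAddCommGroup V] [NormedSpace ℝ V]
  [NormedAddCommGroup W] [NormedSpace ℝ W]

theorem exists_clm_projection [FiniteDimensional ℝ V] (K : Submodule ℝ V) :
    ∃ π : V →L[ℝ] K, ∀ x : K, π x = x := by
  obtain ⟨p, hp⟩ := LinearMap.exists_leftInverse_of_injective K.subtype (by simp)
  exact ⟨LinearMap.toContinuousLinearMap p, fun x => LinearMap.congr_fun hp x⟩

theorem exists_clm_leftInverse [FiniteDimensional ℝ W] {f : V →L[ℝ] W}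
    (hf : Function.Injective f) : ∃ l : W →L[ℝ] V, ∀ x, l (f x) = x := by
  obtain ⟨p, hp⟩ := LinearMap.exists_leftInverse_of_injective f.toLinearMap
    (LinearMap.ker_eq_bot.2 hf)
  exact ⟨LinearMap.toContinuousLinearMap p, fun x => LinearMap.congr_fun hp x⟩

theorem linearIndependent_proj_of_surjective {ι : Type*} [Finite ι] {L : V →L[ℝ] (ι → ℝ)}
    (hL : Function.Surjective L) :
    LinearIndependent ℝ fun i => (ContinuousLinearMap.proj i : (ι → ℝ) →L[ℝ] ℝ).comp L := by
  cases nonempty_fintype ι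
  rw [Fintype.linearIndependent_iff]
  intro g hg i
  classical
  obtain ⟨v, hv⟩ := hL (Pi.single i 1)
  have := congrArg (fun T : V →L[ℝ] ℝ => T v) hg
  simpa [sum_apply, hv, Pi.single_apply] using this

/-- A level set of a submersion is parametrized by the kernel of the differential. -/
theorem exists_parametrization [FiniteDimensional ℝ V] [FiniteDimensional ℝ W] {Φ : V → W} {p : V}
    (hΦ : SmoothNear Φ p) (h0 : Φ p = 0) (hs : Function.Surjective (fderiv ℝ Φ p)) :
    ∃ g : (fderiv ℝ Φ p).ker → V, SmoothNear g 0 ∧ g 0 = p ∧ (∀ᶠ z in 𝓝 0, Φ (g z) = 0) ∧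
      HasFDerivAt g (fderiv ℝ Φ p).ker.subtypeL 0 ∧
      ∃ π : V →L[ℝ] (fderiv ℝ Φ p).ker,
        (∀ᶠ v in 𝓝 p, Φ v = 0 → g (π (v - p)) = v) := by
  obtain ⟨π, hπ⟩ := exists_clm_projection (fderiv ℝ Φ p).ker
  set Ψ : V → W × (fderiv ℝ Φ p).ker := fun v => (Φ v, π (v - p)) with hΨ
  have hΨs : SmoothNear Ψ p := hΦ.prodMk
    ((π.contDiff.comp (contDiff_id.sub contDiff_const)).smoothNear p)
  have hder : HasFDerivAt Ψ ((fderiv ℝ Φ p).prod π) p :=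
    hΦ.hasFDerivAt.prodMk (π.hasFDerivAt.comp p ((hasFDerivAt_id p).sub_const p))
  have hinj : Function.Injective ((fderiv ℝ Φ p).prod π) := by
    rw [injective_iff_map_eq_zero]
    intro v hv
    simp only [ContinuousLinearMap.prod_apply, Prod.mk_eq_zero] at hv
    have h2 := hπ ⟨v, hv.1⟩
    exact congrArg Subtype.val (h2.symm.trans hv.2)
  have hb : Function.Bijective (fderiv ℝ Ψ p) := by
    rw [hder.fderiv]
    refine ⟨hinj, ?_⟩
    rintro ⟨a, b⟩
    obtain ⟨v, hv⟩ := hs a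
    refine ⟨v - (π v : V) + (b : V), ?_⟩
    have h1 : fderiv ℝ Φ p (π v : V) = 0 := (π v).2
    have h2 : fderiv ℝ Φ p (b : V) = 0 := b.2
    simp [hv, hπ, h1, h2]
  have hΨp : Ψ p = 0 := by simp [hΨ, h0]
  obtain ⟨G, hG, hGp, hl, hr⟩ := hΨs.exists_localInverse hb
  rw [hΨp] at hG hGp hr
  have hc : Tendsto (fun z : (fderiv ℝ Φ p).ker => ((0 : W), z)) (𝓝 0) (𝓝 0) :=
    (Continuous.prodMk_right (0 : W)).tendsto' _ _ rfl
  have hgs : SmoothNear (fun z : (fderiv ℝ Φ p).ker => G (0, z)) 0 :=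
    SmoothNear.comp (f := fun z : (fderiv ℝ Φ p).ker => ((0 : W), z)) hG
      ((contDiff_const.prodMk contDiff_id).smoothNear 0)
  refine ⟨fun z => G (0, z), hgs, hGp, ?_, ?_, π, ?_⟩
  · filter_upwards [hc.eventually hr] with z hz
    exact congrArg Prod.fst hz
  · have h1 := hgs.hasFDerivAt
    have h2 : HasFDerivAt (fun z : (fderiv ℝ Φ p).ker => Ψ (G (0, z)))
        (((fderiv ℝ Φ p).prod π).comp (fderiv ℝ (fun z => G (0, z)) 0)) 0 := by
      refine HasFDerivAt.comp (g := Ψ) (f := fun z : (fderiv ℝ Φ p).ker => G (0, z)) 0 ?_ h1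
      have : G (0, 0) = p := hGp
      simpa only [this] using hder
    have h3 : HasFDerivAt (fun z : (fderiv ℝ Φ p).ker => Ψ (G (0, z)))
        (ContinuousLinearMap.inr ℝ W _) 0 := by
      refine (ContinuousLinearMap.inr ℝ W (fderiv ℝ Φ p).ker).hasFDerivAt.congr_of_eventuallyEq
        ?_
      filter_upwards [hc.eventually hr] with z hz
      simp [hz]
    have h4 := h2.unique h3
    have h5 : fderiv ℝ (fun z : (fderiv ℝ Φ p).ker => G (0, z)) 0
        = (fderiv ℝ Φ p).ker.subtypeL := by
      ext z
      refine hinj ?_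
      have h6 := congrArg (fun T : _ →L[ℝ] _ => T z) h4
      simp only [ContinuousLinearMap.comp_apply, ContinuousLinearMap.inr_apply] at h6
      rw [h6]
      have : fderiv ℝ Φ p (z : V) = 0 := z.2
      simp [hπ, this]
    rw [← h5]
    exact h1
  · filter_upwards [hl] with v hv hv0
    have : Ψ v = (0, π (v - p)) := by simp [hΨ, hv0]
    rw [← this]; exact hv

end Linear

/-! ### Tangent spaces and charts of parametrized sets -/

section Geometry

variable {V S : Type*} [NormedAddCommGroup V] [NormedSpace ℝ V]
  [NormedAddCommGroup S] [NormedSpace ℝ S]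

/-- The open quadrant of independent inequalities spans. -/
theorem span_setOf_forall_pos_eq_top {ι : Type*} [Finite ι] {L : S →L[ℝ] (ι → ℝ)}
    (hL : Function.Surjective L) : Submodule.span ℝ {z : S | ∀ i, 0 < L z i} = ⊤ := by
  rw [eq_top_iff]
  intro z _
  obtain ⟨z₀, hz₀⟩ := hL fun _ => 1
  have hev : ∀ᶠ e : ℝ in 𝓝 0, ∀ i, 0 < L (z₀ + e • z) i := by
    rw [eventually_all]
    intro i
    have hc : Continuous fun e : ℝ => L (z₀ + e • z) i := by fun_prop
    have : 0 < L (z₀ + (0 : ℝ) • z) i := by simp [hz₀]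
    exact hc.continuousAt.eventually (lt_mem_nhds this)
  obtain ⟨e, he, he0⟩ := ((hev.filter_mono nhdsWithin_le_nhds).and
    (self_mem_nhdsWithin : Ioi (0 : ℝ) ∈ 𝓝[>] 0)).exists
  have h1 : z₀ + e • z ∈ Submodule.span ℝ {z : S | ∀ i, 0 < L z i} := Submodule.subset_span he
  have h2 : z₀ ∈ Submodule.span ℝ {z : S | ∀ i, 0 < L z i} :=
    Submodule.subset_span fun i => by simp [hz₀]
  have h3 := Submodule.smul_mem _ e⁻¹ (Submodule.sub_mem _ h1 h2)
  have he0' : e ≠ 0 := ne_of_gt he0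
  simpa [smul_smul, he0'] using h3

/-- The tangent space of a set that is the image under `μ` of a curved quadrant `{τ ≥ 0}`, where
`μ` has the local retraction `A`. -/
theorem tangentSpan_eq_range {ι : Type*} [Finite ι] {Y : Set V} {y : V} {μ : S → V}
    {μ' : S →L[ℝ] V} (hμ : HasFDerivAt μ μ' 0) (hμ0 : μ 0 = y) {A : V → S}
    (hA : DifferentiableAt ℝ A y) (hA0 : A y = 0)
    (hret : ∀ᶠ v in 𝓝 y, v ∈ Y → μ (A v) = v) (hy : y ∈ Y) {τ : S → ι → ℝ}
    {τ' : S →L[ℝ] (ι → ℝ)} (hτ : HasFDerivAt τ τ' 0) (hτ0 : τ 0 = 0)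
    (hτs : Function.Surjective τ') (hpar : ∀ᶠ z in 𝓝 0, (∀ i, 0 ≤ τ z i) → μ z ∈ Y) :
    tangentSpan Y y = LinearMap.range μ'.toLinearMap := by
  cases nonempty_fintype ι
  apply le_antisymm
  · refine Submodule.span_le.2 fun v hv => ?_
    have h1 : HasFDerivWithinAt (fun v => μ (A v)) (μ'.comp (fderiv ℝ A y)) Y y := by
      refine HasFDerivAt.hasFDerivWithinAt (HasFDerivAt.comp (g := μ) y ?_ hA.hasFDerivAt)
      rwa [hA0]
    have h2 : HasFDerivWithinAt (fun v => μ (A v)) (ContinuousLinearMap.id ℝ V) Y y := by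
      refine (hasFDerivWithinAt_id y Y).congr_of_eventuallyEq ?_ (hret.self_of_nhds hy)
      exact eventually_nhdsWithin_iff.2 hret
    -- the differentials of `μ ∘ A` and of the identity agree on the tangent cone
    have h3 := h1.unique_on h2 hv
    exact ⟨fderiv ℝ A y v, by simpa using h3⟩
  · rw [← Submodule.map_top, ← span_setOf_forall_pos_eq_top hτs, Submodule.map_span,
      Submodule.span_le]
    rintro _ ⟨z, hz, rfl⟩
    -- for `τ' z > 0` the curve `e ↦ μ (e z)` starts in `Y`
    refine Submodule.subset_span ?_
    have hzt : Tendsto (fun e : ℝ => e • z) (𝓝[>] 0) (𝓝 0) := by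
      have : Tendsto (fun e : ℝ => e • z) (𝓝 0) (𝓝 0) :=
        (by fun_prop : Continuous fun e : ℝ => e • z).tendsto' _ _ (by simp)
      exact this.mono_left nhdsWithin_le_nhds
    have hμc : Tendsto (fun e : ℝ => μ (e • z)) (𝓝[>] 0) (𝓝 y) :=
      hμ0 ▸ hμ.continuousAt.tendsto.comp hzt
    have hline : HasDerivAt (fun e : ℝ => e • z) z 0 := by
      simpa using (hasDerivAt_id (0 : ℝ)).smul_const z
    have hdμ : HasDerivAt (fun e : ℝ => μ (e • z)) (μ' z) 0 := by
      refine HasFDerivAt.comp_hasDerivAt (l := μ) (0 : ℝ) ?_ hline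
      simpa using hμ
    have hdτ : HasDerivAt (fun e : ℝ => τ (e • z)) (τ' z) 0 := by
      refine HasFDerivAt.comp_hasDerivAt (l := τ) (0 : ℝ) ?_ hline
      simpa using hτ
    have hs : Tendsto (fun e : ℝ => e⁻¹ • (μ (e • z) - y)) (𝓝[>] 0) (𝓝 (μ' z)) := by
      have := hdμ.tendsto_slope_zero_right
      simpa [hμ0] using this
    have hsτ : ∀ᶠ e : ℝ in 𝓝[>] 0, ∀ i, 0 ≤ τ (e • z) i := by
      have h1 := hdτ.tendsto_slope_zero_right
      simp only [zero_add, zero_smul, hτ0, sub_zero] at h1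
      have h2 : ∀ᶠ e : ℝ in 𝓝[>] 0, ∀ i, 0 < (e⁻¹ • τ (e • z)) i :=
        eventually_all.2 fun i => ((tendsto_pi_nhds.1 h1) i).eventually (lt_mem_nhds (hz i))
      filter_upwards [h2, self_mem_nhdsWithin] with e he he0 i
      have h3 : 0 < e⁻¹ * τ (e • z) i := by simpa using he i
      exact (pos_of_mul_pos_right h3 (inv_pos.2 he0).le).le
    refine mem_tangentConeAt_of_seq (𝓝[>] (0 : ℝ)) (fun e => e⁻¹) (fun e => μ (e • z) - y)
      ?_ ?_ hs
    · simpa using hμc.sub_const y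
    · filter_upwards [hsτ, hzt.eventually hpar] with e h1 h2
      simpa using h2 h1

variable [FiniteDimensional ℝ V] [FiniteDimensional ℝ S]

/-- Straightening. Let `μ` be an immersion with values in `{ζ = 0}`, transversal to the boundary
`{t = 0}` of `{t ≥ 0}`. Then `μ` has a smooth local left inverse `A` with `t ∘ μ ∘ A = t`, and near
`q` the set `X = {ζ = 0, t ≥ 0}` has a corner chart in which `{v ∈ X | μ (A v) = v}` is a quadrant
of a linear subspace. -/
theorem exists_retraction_chart {ι κ : Type*} [Fintype ι] [Fintype κ] {ζ : V → κ → ℝ}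
    {t : V → ι → ℝ} {q : V} (hζ : SmoothNear ζ q) (ht : SmoothNear t q) (ht0 : t q = 0)
    (hsurj : Function.Surjective ((fderiv ℝ ζ q).prod (fderiv ℝ t q)))
    {μ : S → V} (hμ : SmoothNear μ 0) (hμ0 : μ 0 = q) (hζμ : ∀ᶠ z in 𝓝 0, ζ (μ z) = 0)
    (hinj : Function.Injective (fderiv ℝ μ 0))
    (htμ : Function.Surjective ((fderiv ℝ t q).comp (fderiv ℝ μ 0))) :
    ∃ A : V → S, SmoothNear A q ∧ A q = 0 ∧ (∀ᶠ z in 𝓝 0, A (μ z) = z) ∧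
      (∀ᶠ v in 𝓝 q, t (μ (A v)) = t v) ∧
      ∀ X L : Set V, (∀ᶠ v in 𝓝 q, v ∈ X ↔ ζ v = 0 ∧ ∀ i, 0 ≤ t v i) →
        (∀ᶠ v in 𝓝 q, v ∈ L ↔ v ∈ X ∧ μ (A v) = v) →
        ∃ (n k : ℕ) (ν : CornerChart X n k) (F : Submodule ℝ (Euc n))
          (Λ' : Fin k → (F →L[ℝ] ℝ)),
          q ∈ ν.dom ∧ ν.toFun q = 0 ∧ LinearIndependent ℝ Λ' ∧
          ν.toFun '' (ν.dom ∩ L) = ν.toFun '' (ν.dom ∩ X) ∩ quadrant F Λ' ∧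
          (∃ O : Set (Euc n), IsOpen O ∧
            ν.toFun '' (ν.dom ∩ X) ∩ quadrant F Λ' = O ∩ quadrant F Λ') ∧
          Module.finrank ℝ F = Module.finrank ℝ S ∧
          n + Fintype.card κ = Module.finrank ℝ V := by
  classical
  set Z := fderiv ℝ ζ q with hZ
  set T := fderiv ℝ t q with hT
  set μ' := fderiv ℝ μ 0 with hμ'
  have hμd : HasFDerivAt μ μ' 0 := hμ.hasFDerivAt
  have hZμ : ∀ z, Z (μ' z) = 0 := by
    have h1 : HasFDerivAt (fun z => ζ (μ z)) (Z.comp μ') 0 := by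
      refine HasFDerivAt.comp (g := ζ) (0 : S) ?_ hμd
      rw [hμ0]; exact hζ.hasFDerivAt
    have h2 : HasFDerivAt (fun z => ζ (μ z)) (0 : S →L[ℝ] (κ → ℝ)) 0 :=
      (hasFDerivAt_const (0 : κ → ℝ) (0 : S)).congr_of_eventuallyEq hζμ
    intro z
    exact congrArg (fun L : S →L[ℝ] (κ → ℝ) => L z) (h1.unique h2)
  -- `S₀` is the tangent space of the boundary of the parameter domain
  let S₀ : Submodule ℝ S := (T.comp μ').ker
  obtain ⟨pr, hpr⟩ := exists_clm_projection S₀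
  obtain ⟨l, hl⟩ := exists_clm_leftInverse hinj
  let w : V →L[ℝ] S₀ := pr.comp l
  have hwμ : ∀ z, w (μ' z) = pr z := fun z => by simp [w, hl]
  let ρ : S → (ι → ℝ) × S₀ := fun z => (t (μ z), w (μ z - q))
  have htμs : SmoothNear (fun z => t (μ z)) 0 := SmoothNear.comp (by rwa [hμ0]) hμ
  have hws : ContDiff ℝ ∞ fun v : V => w (v - q) :=
    w.contDiff.comp (contDiff_id.sub contDiff_const)
  have hρs : SmoothNear ρ 0 := htμs.prodMk (SmoothNear.comp (g := fun v => w (v - q))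
    (hws.smoothNear _) hμ)
  have hwd : ∀ v, HasFDerivAt (fun v : V => w (v - q)) w v := fun v =>
    w.hasFDerivAt.comp v ((hasFDerivAt_id v).sub_const q)
  have hρd : HasFDerivAt ρ ((T.comp μ').prod (w.comp μ')) 0 := by
    refine HasFDerivAt.prodMk (HasFDerivAt.comp (g := t) (0 : S) ?_ hμd)
      (HasFDerivAt.comp (g := fun v => w (v - q)) (0 : S) (hwd _) hμd)
    rw [hμ0]; exact ht.hasFDerivAt
  have hρ0 : ρ 0 = 0 := by simp [ρ, hμ0, ht0]
  have hρb : Function.Bijective (fderiv ℝ ρ 0) := by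
    rw [hρd.fderiv]
    constructor
    · rw [injective_iff_map_eq_zero]
      intro z hz
      have h1 : T (μ' z) = 0 := congrArg Prod.fst hz
      have h2 : pr z = 0 := by rw [← hwμ]; exact congrArg Prod.snd hz
      have h3 := hpr ⟨z, h1⟩
      exact congrArg Subtype.val (h3.symm.trans h2)
    · rintro ⟨a, b⟩
      obtain ⟨z, hz⟩ := htμ a
      refine ⟨z - (pr z : S) + (b : S), ?_⟩
      have h1 : T (μ' (pr z : S)) = 0 := (pr z).2
      have h2 : T (μ' (b : S)) = 0 := b.2
      have h3 : T (μ' z) = a := hz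
      simp [hwμ, h1, h2, h3, hpr]
  obtain ⟨g, hg, hg0, hgl, hgr⟩ := hρs.exists_localInverse hρb
  rw [hρ0] at hg hg0 hgr
  let c : V → (ι → ℝ) × S₀ := fun v => (t v, w (v - q))
  have hcs : SmoothNear c q := ht.prodMk (hws.smoothNear q)
  have hcd : HasFDerivAt c (T.prod w) q := ht.hasFDerivAt.prodMk (hwd q)
  have hc0 : c q = 0 := by simp [c, ht0]
  let A : V → S := fun v => g (c v)
  have hAs : SmoothNear A q := SmoothNear.comp (by rwa [hc0]) hcs
  have hA0 : A q = 0 := by simp [A, hc0, hg0]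
  have hct : Tendsto c (𝓝 q) (𝓝 0) := hc0 ▸ hcs.continuousAt.tendsto
  have hρA : ∀ᶠ v in 𝓝 q, ρ (A v) = c v := hct.eventually hgr
  refine ⟨A, hAs, hA0, hgl, ?_, ?_⟩
  · filter_upwards [hρA] with v hv
    exact congrArg Prod.fst hv
  intro X L hX hL
  let K : Submodule ℝ V := (Z.prod (T.prod w)).ker
  obtain ⟨κ', hκ'⟩ := exists_clm_projection K
  let Ψ : V → (κ → ℝ) × (((ι → ℝ) × S₀) × K) := fun v => (ζ v, (c v, κ' (v - μ (A v))))
  have hμA : SmoothNear (fun v => μ (A v)) q := SmoothNear.comp (by rwa [hA0]) hAs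
  have hΨs : SmoothNear Ψ q := hζ.prodMk (hcs.prodMk
    (SmoothNear.comp (κ'.contDiff.smoothNear _) ((contDiff_id.smoothNear q).sub hμA)))
  have hAd : HasFDerivAt A ((fderiv ℝ g 0).comp (T.prod w)) q := by
    refine HasFDerivAt.comp (g := g) q ?_ hcd
    rw [hc0]; exact hg.hasFDerivAt
  let M : V →L[ℝ] V := ContinuousLinearMap.id ℝ V - μ'.comp ((fderiv ℝ g 0).comp (T.prod w))
  have hΨd : HasFDerivAt Ψ (Z.prod ((T.prod w).prod (κ'.comp M))) q := by
    refine hζ.hasFDerivAt.prodMk (hcd.prodMk (κ'.hasFDerivAt.comp q ?_))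
    refine (hasFDerivAt_id q).sub (HasFDerivAt.comp (g := μ) q ?_ hAd)
    rwa [hA0]
  have hMK : ∀ v : K, M v = v := by
    rintro ⟨v, hv⟩
    have h1 : (T.prod w) v = 0 := congrArg Prod.snd hv
    simp [M, h1]
  have hΨb : Function.Bijective (fderiv ℝ Ψ q) := by
    rw [hΨd.fderiv]
    constructor
    · rw [injective_iff_map_eq_zero]
      intro v hv
      have h1 : Z v = 0 := congrArg Prod.fst hv
      have h2 : (T.prod w) v = 0 := congrArg (fun x => x.2.1) hv
      have h3 : κ' (M v) = 0 := congrArg (fun x => x.2.2) hv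
      have hvK : v ∈ K := by
        change (Z v, (T.prod w) v) = 0
        rw [h1, h2]; rfl
      have h4 := hMK ⟨v, hvK⟩
      simp only at h4
      rw [h4] at h3
      exact congrArg Subtype.val ((hκ' ⟨v, hvK⟩).symm.trans h3)
    · rintro ⟨a, ⟨b, s⟩, k⟩
      obtain ⟨v₀, hv₀⟩ := hsurj (a, b)
      have hZv₀ : Z v₀ = a := congrArg Prod.fst hv₀
      have hTv₀ : T v₀ = b := congrArg Prod.snd hv₀
      set v₁ := v₀ + μ' ((s - w v₀ : S₀) : S) with hv₁
      have hTμ : T (μ' ((s - w v₀ : S₀) : S)) = 0 := (s - w v₀).2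
      have hw1 : w (μ' ((s - w v₀ : S₀) : S)) = s - w v₀ := by rw [hwμ, hpr]
      have h1 : Z v₁ = a := by rw [hv₁, map_add, hZμ, hZv₀, add_zero]
      have h2 : T v₁ = b := by rw [hv₁, map_add, hTμ, hTv₀, add_zero]
      have h3 : w v₁ = s := by rw [hv₁, map_add, hw1]; abel
      let k' : K := k - κ' (M v₁)
      have hk' : (Z (k' : V), (T.prod w) (k' : V)) = 0 := k'.2
      have h4 : Z (k' : V) = 0 := congrArg Prod.fst hk'
      have h5 : T (k' : V) = 0 := congrArg (fun x => x.2.1) hk'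
      have h6 : w (k' : V) = 0 := congrArg (fun x => x.2.2) hk'
      refine ⟨v₁ + k', ?_⟩
      have h7 : κ' (M (v₁ + k')) = k := by rw [map_add, map_add, hMK, hκ']; simp [k']
      simp only [ContinuousLinearMap.prod_apply, ContinuousLinearMap.comp_apply, h7]
      simp [h1, h2, h3, h4, h5, h6]
  obtain ⟨e₀, hqe, hee, hes, hesym⟩ := hΨs.exists_openPartialHomeomorph hΨb
  -- the points near `q` on the graph of the parametrization are those with vanishing last
  -- coordinate
  have hmem : ∀ᶠ v in 𝓝 q, (v ∈ X ↔ ζ v = 0 ∧ ∀ i, 0 ≤ t v i) ∧ (v ∈ L ↔ v ∈ X ∧ μ (A v) = v) ∧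
      (ζ v = 0 → κ' (v - μ (A v)) = 0 → μ (A v) = v) := by
    have hμAt : Tendsto (fun v => μ (A v)) (𝓝 q) (𝓝 q) := by
      have := hμA.continuousAt.tendsto
      rwa [hA0, hμ0] at this
    have hA00 : Tendsto A (𝓝 q) (𝓝 0) := hA0 ▸ hAs.continuousAt.tendsto
    filter_upwards [hX, hL, hρA, e₀.open_source.mem_nhds hqe,
      hμAt.eventually (e₀.open_source.mem_nhds hqe), hA00.eventually hζμ] with v h1 h2 h3 h4 h5 h6
    refine ⟨h1, h2, fun h7 h8 => ?_⟩
    have h9 : c (μ (A v)) = c v := h3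
    have h10 : A (μ (A v)) = A v := congrArg g h9
    refine e₀.injOn h5 h4 ?_
    simp only [hee, Ψ, h6, h7, h9, h10, h8, sub_self, map_zero]
  obtain ⟨N, hN, hNo, hqN⟩ := _root_.eventually_nhds_iff.1 hmem
  let e := e₀.restrOpen N hNo
  have heq : q ∈ e.source := ⟨hqe, hqN⟩
  have hee' : ∀ y, e y = Ψ y := hee
  have hetgt : ∀ z ∈ e.target, ContDiffAt ℝ ∞ e.symm z := by
    intro z hz
    exact hesym z hz.1
  -- the chart is `Ψ` without its first component, in linear coordinates `χ`
  let B := ((ι → ℝ) × S₀) × K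
  let n := Module.finrank ℝ B
  let χ : B ≃L[ℝ] Euc n := ContinuousLinearEquiv.ofFinrankEq (by simp [n])
  let σ : ι ≃ Fin (Fintype.card ι) := Fintype.equivFin ι
  let T₁ : Euc n →L[ℝ] (Fin (Fintype.card ι) → ℝ) :=
    (ContinuousLinearMap.pi fun i => ContinuousLinearMap.proj (σ.symm i)).comp
      (((ContinuousLinearMap.fst ℝ (ι → ℝ) S₀).comp
        (ContinuousLinearMap.fst ℝ ((ι → ℝ) × S₀) K)).comp (χ.symm : Euc n →L[ℝ] B))
  have hT₁ : ∀ u i, T₁ u i = (χ.symm u).1.1 (σ.symm i) := fun u i => rfl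
  let F : Submodule ℝ (Euc n) :=
    ((ContinuousLinearMap.snd ℝ ((ι → ℝ) × S₀) K).comp (χ.symm : Euc n →L[ℝ] B)).ker
  have hF : ∀ u, u ∈ F ↔ (χ.symm u).2 = 0 := fun u => Iff.rfl
  have hT₁s : Function.Surjective (T₁.comp F.subtypeL) := by
    intro a
    refine ⟨⟨χ ((fun i => a (σ i), 0), 0), ?_⟩, ?_⟩
    · rw [hF]; simp
    · ext i; simp [hT₁]
  have hT₁s' : Function.Surjective T₁ := fun a => by
    obtain ⟨u, hu⟩ := hT₁s a
    exact ⟨u, hu⟩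
  let f : V → Euc n := fun v => χ (Ψ v).2
  have hχf : ∀ v, χ.symm (f v) = (Ψ v).2 := fun v => by simp [f]
  have hXe : ∀ v ∈ e.source, v ∈ X ↔ ζ v = 0 ∧ ∀ i, 0 ≤ t v i := fun v hv => (hN v hv.2).1
  have hLe : ∀ v ∈ e.source, v ∈ L ↔ v ∈ X ∧ μ (A v) = v := fun v hv => (hN v hv.2).2.1
  have hΨe : ∀ v ∈ e.source ∩ X, Ψ v = (0, χ.symm (f v)) := by
    intro v hv
    rw [hχf]
    have := ((hXe v hv.1).1 hv.2).1
    exact Prod.ext this rfl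
  have hinv : ∀ v ∈ e.source ∩ X, e.symm (0, χ.symm (f v)) = v := by
    intro v hv
    rw [← hΨe v hv, ← hee']
    exact e.left_inv hv.1
  have himg : f '' (e.source ∩ X) =
      {u | (0, χ.symm u) ∈ e.target} ∩ {u | ∀ i, 0 ≤ T₁ u i} := by
    ext u
    constructor
    · rintro ⟨v, hv, rfl⟩
      refine ⟨?_, fun i => ?_⟩
      · change (0, χ.symm (f v)) ∈ e.target
        rw [← hΨe v hv, ← hee']
        exact e.map_source hv.1
      · rw [hT₁, hχf]
        exact ((hXe v hv.1).1 hv.2).2 _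
    · rintro ⟨hu1, hu2⟩
      have hs := e.map_target hu1
      have hΨu : Ψ (e.symm (0, χ.symm u)) = (0, χ.symm u) := by
        rw [← hee']; exact e.right_inv hu1
      refine ⟨e.symm (0, χ.symm u), ⟨hs, (hXe _ hs).2 ⟨congrArg Prod.fst hΨu, fun i => ?_⟩⟩, ?_⟩
      · have h1 : t (e.symm (0, χ.symm u)) = (χ.symm u).1.1 := congrArg (fun x => x.2.1.1) hΨu
        rw [h1]
        have := hu2 (σ i)
        rw [hT₁] at this
        simpa using this
      · simp [f, hΨu]
  let ν : CornerChart X n (Fintype.card ι) :=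
    { dom := e.source
      isOpen_dom := e.open_source
      toFun := f
      invFun := fun u => e.symm (0, χ.symm u)
      Λ := fun i => (ContinuousLinearMap.proj i).comp T₁
      linearIndependent := linearIndependent_proj_of_surjective hT₁s'
      contDiffOn_toFun := fun v hv => by
        refine ContDiffAt.contDiffWithinAt ?_
        exact χ.contDiff.contDiffAt.comp v (contDiffAt_snd.comp v (hes v hv.1))
      image_eq := by
        refine ⟨{u | (0, χ.symm u) ∈ e.target}, ?_, himg⟩
        exact e.open_target.preimage (continuous_const.prodMk χ.symm.continuous)
      contDiffOn_invFun := fun u hu => by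
        rw [himg] at hu
        refine ContDiffAt.contDiffWithinAt ?_
        refine (hetgt _ hu.1).comp u ?_
        exact contDiffAt_const.prodMk χ.symm.contDiff.contDiffAt
      left_inv := hinv }
  refine ⟨n, Fintype.card ι, ν, F, fun i => (ContinuousLinearMap.proj i).comp (T₁.comp F.subtypeL),
    heq, ?_, linearIndependent_proj_of_surjective hT₁s, ?_, ?_, ?_, ?_⟩
  · change χ (c q, κ' (q - μ (A q))) = 0
    rw [hc0, hA0, hμ0, sub_self, map_zero]
    exact map_zero χ
  · change f '' (e.source ∩ L) = f '' (e.source ∩ X) ∩ _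
    ext u
    constructor
    · rintro ⟨v, ⟨hv1, hv2⟩, rfl⟩
      obtain ⟨hvX, hvA⟩ := (hLe v hv1).1 hv2
      refine ⟨⟨v, ⟨hv1, hvX⟩, rfl⟩, ?_, fun i => ?_⟩
      · rw [hF, hχf]; simp [Ψ, hvA]
      · have : (0 : ℝ) ≤ T₁ (f v) i := by
          rw [hT₁, hχf]; exact ((hXe v hv1).1 hvX).2 _
        exact this
    · rintro ⟨⟨v, ⟨hv1, hvX⟩, rfl⟩, hF', -⟩
      refine ⟨v, ⟨hv1, (hLe v hv1).2 ⟨hvX, ?_⟩⟩, rfl⟩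
      rw [hF, hχf] at hF'
      exact (hN v hv1.2).2.2 ((hXe v hv1).1 hvX).1 hF'
  · refine ⟨{u | (0, χ.symm u) ∈ e.target}, ?_, ?_⟩
    · exact e.open_target.preimage (continuous_const.prodMk χ.symm.continuous)
    · change f '' (e.source ∩ X) ∩ _ = _
      rw [himg, inter_assoc]
      congr 1
      refine inter_eq_right.2 ?_
      rintro u ⟨hu, hu'⟩ i
      exact hu' i
  · have h1 := LinearMap.finrank_range_add_finrank_ker
      ((ContinuousLinearMap.snd ℝ ((ι → ℝ) × S₀) K).comp (χ.symm : Euc n →L[ℝ] B)).toLinearMap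
    rw [LinearMap.range_eq_top.2 (by
      intro k; exact ⟨χ (0, k), by simp⟩), finrank_top] at h1
    have h2 := LinearMap.finrank_range_add_finrank_ker (T.comp μ').toLinearMap
    rw [LinearMap.range_eq_top.2 htμ, finrank_top] at h2
    have h3 : Module.finrank ℝ (Euc n) =
        (Module.finrank ℝ (ι → ℝ) + Module.finrank ℝ S₀) + Module.finrank ℝ K := by
      simp [n, B]
    change _ + Module.finrank ℝ F = _ at h1
    change _ + Module.finrank ℝ S₀ = _ at h2
    omega
  · have h1 := (LinearEquiv.ofBijective (fderiv ℝ Ψ q).toLinearMap hΨb).finrank_eq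
    rw [h1]
    simp [n, B]; ring

end Geometry

/-! ### Submanifolds with corners given by equations -/

section LocalStructure

variable {V₁ V₂ Q : Type*} [NormedAddCommGroup V₁] [NormedSpace ℝ V₁] [FiniteDimensional ℝ V₁]
  [NormedAddCommGroup V₂] [NormedSpace ℝ V₂] [FiniteDimensional ℝ V₂]
  [NormedAddCommGroup Q] [NormedSpace ℝ Q] [FiniteDimensional ℝ Q]

/-- The local picture: `C = {F = 0}` inside a face `{ρ i = 0 for i ∈ E}` of a manifold with corners
`{ρ i ≥ 0}`, near a point where exactly the `ρ i` with `i ∈ A` vanish, and a map `H` that takes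
boundary hypersurfaces to boundary hypersurfaces. If `F` is a submersion along the stratum of `p`
and `(F, H)` is an immersion, then `H` is locally injective on `C` and its image is a totally neat
submanifold. -/
theorem local_structure {I : Type*} [Fintype I] [DecidableEq I] {E A : Finset I} (hEA : E ⊆ A)
    {p : V₁} {q : V₂} {F : V₁ → Q} {H : V₁ → V₂} {ρ : I → V₁ → ℝ} {ρ' : I → V₂ → ℝ}
    (hF : SmoothNear F p) (hH : SmoothNear H p) (hρ : ∀ i, SmoothNear (ρ i) p)
    (hρ' : ∀ i, SmoothNear (ρ' i) q) (hq : H p = q) (hF0 : F p = 0)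
    (hA : ∀ i ∈ A, ρ i p = 0) (hA' : ∀ i ∉ A, 0 < ρ i p)
    (hqA : ∀ i ∈ A, ρ' i q = 0) (hqA' : ∀ i ∉ A, 0 < ρ' i q)
    (hsurj : ∀ (b : Q) (a : I → ℝ), ∃ v, fderiv ℝ F p v = b ∧ ∀ i ∈ A, fderiv ℝ (ρ i) p v = a i)
    (hsurj' : ∀ a : I → ℝ, ∃ v, ∀ i ∈ A, fderiv ℝ (ρ' i) q v = a i)
    (hm : ∀ i ∈ A, ∃ m : V₁ → ℝ, ContinuousAt m p ∧ 0 < m p ∧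
      ∀ᶠ v in 𝓝 p, ρ' i (H v) = m v * ρ i v)
    (hker : ∀ v, fderiv ℝ F p v = 0 → fderiv ℝ H p v = 0 → v = 0)
    {C : Set V₁}
    (hC : ∀ᶠ v in 𝓝 p, v ∈ C ↔ F v = 0 ∧ (∀ i ∈ E, ρ i v = 0) ∧ ∀ i, 0 ≤ ρ i v)
    {lam : V₁ → V₂} (hlam : ∀ᶠ v in 𝓝 p, v ∈ C → lam v = H v) :
    (∀ v, v ∈ tangentSpan C p ↔ fderiv ℝ F p v = 0 ∧ ∀ i ∈ E, fderiv ℝ (ρ i) p v = 0) ∧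
    (∃ N ∈ 𝓝 p, InjOn lam (C ∩ N)) ∧
    ∀ X L : Set V₂, (∀ᶠ v in 𝓝 q, v ∈ X ↔ (∀ i ∈ E, ρ' i v = 0) ∧ ∀ i, 0 ≤ ρ' i v) →
      L ⊆ X → (∀ N ∈ 𝓝 p, ∀ᶠ v in 𝓝 q, v ∈ L → v ∈ lam '' (C ∩ N)) →
      (∃ N ∈ 𝓝 p, lam '' (C ∩ N) ⊆ L) →
      tangentSpan L q = (tangentSpan C p).map (fderiv ℝ H p).toLinearMap ∧
      ∃ (n k : ℕ) (ν : CornerChart X n k) (F : Submodule ℝ (Euc n))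
        (Λ' : Fin k → (F →L[ℝ] ℝ)),
        q ∈ ν.dom ∧ ν.toFun q = 0 ∧ LinearIndependent ℝ Λ' ∧
        ν.toFun '' (ν.dom ∩ L) = ν.toFun '' (ν.dom ∩ X) ∩ quadrant F Λ' ∧
        (∃ O : Set (Euc n), IsOpen O ∧
          ν.toFun '' (ν.dom ∩ X) ∩ quadrant F Λ' = O ∩ quadrant F Λ') ∧
        Module.finrank ℝ F + E.card + Module.finrank ℝ Q = Module.finrank ℝ V₁ ∧
        n + E.card = Module.finrank ℝ V₂ := by
  have hpC : p ∈ C := hC.self_of_nhds.2 ⟨hF0, fun i hi => hA i (hEA hi), fun i => by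
    by_cases hi : i ∈ A
    · exact (hA i hi).ge
    · exact (hA' i hi).le⟩
  have hlp : lam p = q := (hlam.self_of_nhds hpC).trans hq
  -- the equations of `C`
  let Φ : V₁ → (E → ℝ) × Q := fun v => (fun i => ρ i v, F v)
  have hΦ : SmoothNear Φ p := (SmoothNear.pi fun i : E => hρ i.1).prodMk hF
  have hΦ0 : Φ p = 0 := Prod.ext (funext fun i => hA i (hEA i.2)) hF0
  have hΦd : HasFDerivAt Φ
      ((ContinuousLinearMap.pi fun i : E => fderiv ℝ (ρ i) p).prod (fderiv ℝ F p)) p :=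
    (hasFDerivAt_pi.2 fun i : E => (hρ i.1).hasFDerivAt).prodMk hF.hasFDerivAt
  have hΦs : Function.Surjective (fderiv ℝ Φ p) := by
    rw [hΦd.fderiv]
    rintro ⟨a, b⟩
    obtain ⟨v, hv1, hv2⟩ := hsurj b fun i => if h : i ∈ E then a ⟨i, h⟩ else 0
    refine ⟨v, Prod.ext (funext fun i => ?_) hv1⟩
    have := hv2 i (hEA i.2)
    simpa using this
  have hkerΦ : ∀ v, v ∈ (fderiv ℝ Φ p).ker ↔
      fderiv ℝ F p v = 0 ∧ ∀ i ∈ E, fderiv ℝ (ρ i) p v = 0 := by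
    intro v
    rw [LinearMap.mem_ker, ContinuousLinearMap.coe_coe, hΦd.fderiv]
    simp only [ContinuousLinearMap.prod_apply, Prod.mk_eq_zero, funext_iff]
    simp [and_comm]
  have hpar := exists_parametrization hΦ hΦ0 hΦs
  obtain ⟨Z, hZ⟩ : ∃ Z, Z = (fderiv ℝ Φ p).ker := ⟨_, rfl⟩
  rw [← hZ] at hkerΦ hpar
  obtain ⟨g, hg, hg0, hΦg, hgd, π, hπ⟩ := hpar
  have hgt : Tendsto g (𝓝 0) (𝓝 p) := hg0 ▸ hg.continuousAt.tendsto
  have hΦ_iff : ∀ v, Φ v = 0 ↔ F v = 0 ∧ ∀ i ∈ E, ρ i v = 0 := by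
    intro v
    simp only [Φ, Prod.mk_eq_zero, funext_iff]
    simp [and_comm]
  let ι := {i : I // i ∈ A ∧ i ∉ E}
  -- the active inequalities on `C` and on the target face
  let τ : Z → ι → ℝ := fun z i => ρ i (g z)
  let t : V₂ → ι → ℝ := fun v i => ρ' i v
  let ζ : V₂ → E → ℝ := fun v i => ρ' i v
  have hτd : HasFDerivAt τ
      (ContinuousLinearMap.pi fun i : ι => (fderiv ℝ (ρ i) p).comp Z.subtypeL) 0 := by
    refine hasFDerivAt_pi.2 fun i => HasFDerivAt.comp (g := ρ i) (0 : Z) ?_ hgd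
    rw [hg0]; exact (hρ i).hasFDerivAt
  have hτ0 : τ 0 = 0 := funext fun i => by simp [τ, hg0, hA i i.2.1]
  have hZsurj : ∀ a : I → ℝ, ∃ z : Z, ∀ i ∈ A, i ∉ E → fderiv ℝ (ρ i) p z = a i := by
    intro a
    obtain ⟨v, hv1, hv2⟩ := hsurj 0 fun i => if i ∈ E then 0 else a i
    refine ⟨⟨v, (hkerΦ v).2 ⟨hv1, fun i hi => ?_⟩⟩, fun i hi hiE => ?_⟩
    · simpa [hi] using hv2 i (hEA hi)
    · simpa [hiE] using hv2 i hi
  have hτs : Function.Surjective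
      (ContinuousLinearMap.pi fun i : ι => (fderiv ℝ (ρ i) p).comp Z.subtypeL) := by
    intro a
    obtain ⟨z, hz⟩ := hZsurj fun i => if h : i ∈ A ∧ i ∉ E then a ⟨i, h⟩ else 0
    refine ⟨z, funext fun i => ?_⟩
    simpa [i.2.1, i.2.2] using hz i i.2.1 i.2.2
  have hnn : ∀ᶠ v in 𝓝 p, (∀ i : ι, 0 ≤ ρ i v) → (∀ i ∈ E, ρ i v = 0) → ∀ i, 0 ≤ ρ i v := by
    have : ∀ᶠ v in 𝓝 p, ∀ i, i ∉ A → 0 < ρ i v := by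
      rw [eventually_all]
      intro i
      by_cases hi : i ∈ A
      · exact Eventually.of_forall fun v h => absurd hi h
      · filter_upwards [(hρ i).continuousAt.eventually (lt_mem_nhds (hA' i hi))] with v hv _
        exact hv
    filter_upwards [this] with v h1 h2 h3 i
    by_cases hi : i ∈ A
    · by_cases hiE : i ∈ E
      · exact (h3 i hiE).ge
      · exact h2 ⟨i, hi, hiE⟩
    · exact (h1 i hi).le
  have hCτ : ∀ᶠ z in 𝓝 (0 : Z), (∀ i, 0 ≤ τ z i) → g z ∈ C := by
    filter_upwards [hΦg, hgt.eventually hC, hgt.eventually hnn] with z h1 h2 h3 h4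
    have h5 := (hΦ_iff _).1 h1
    exact h2.2 ⟨h5.1, h5.2, h3 h4 h5.2⟩
  have hπd : DifferentiableAt ℝ (fun v => π (v - p)) p :=
    (π.hasFDerivAt.comp p ((hasFDerivAt_id p).sub_const p)).differentiableAt
  have hCret : ∀ᶠ v in 𝓝 p, v ∈ C → g (π (v - p)) = v := by
    filter_upwards [hπ, hC] with v h1 h2 h3
    exact h1 ((hΦ_iff v).2 ⟨(h2.1 h3).1, (h2.1 h3).2.1⟩)
  have htan : tangentSpan C p = Z := by
    rw [tangentSpan_eq_range hgd hg0 hπd (by simp) hCret hpC hτd hτ0 hτs hCτ]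
    simp
  -- the parametrization of the image
  have hHd := hH.hasFDerivAt
  have hμs : SmoothNear (fun z => H (g z)) 0 := SmoothNear.comp (by rwa [hg0]) hg
  have hμd : HasFDerivAt (fun z => H (g z)) ((fderiv ℝ H p).comp Z.subtypeL) 0 := by
    refine HasFDerivAt.comp (g := H) (0 : Z) ?_ hgd
    rw [hg0]; exact hHd
  have hμ0 : H (g 0) = q := by rw [hg0, hq]
  have hrel : ∀ i ∈ A, ∃ m : V₁ → ℝ, ContinuousAt m p ∧ 0 < m p ∧
      (∀ᶠ v in 𝓝 p, ρ' i (H v) = m v * ρ i v) ∧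
      ∀ v, fderiv ℝ (ρ' i) q (fderiv ℝ H p v) = m p * fderiv ℝ (ρ i) p v := by
    intro i hi
    obtain ⟨m, hmc, hmp, hme⟩ := hm i hi
    refine ⟨m, hmc, hmp, hme, fun v => ?_⟩
    have h1 : HasFDerivAt (fun v => ρ' i (H v)) ((fderiv ℝ (ρ' i) q).comp (fderiv ℝ H p)) p := by
      refine HasFDerivAt.comp (g := ρ' i) p ?_ hHd
      rw [hq]; exact (hρ' i).hasFDerivAt
    have h2 : HasFDerivAt (fun v => ρ' i (H v)) (m p • fderiv ℝ (ρ i) p) p := by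
      have h3 : HasFDerivAt (fun v => m v * ρ i v) (m p • fderiv ℝ (ρ i) p) p := by
        have h4 := (hρ i).hasFDerivAt
        rw [hasFDerivAt_iff_isLittleO] at h4 ⊢
        have h5 : (fun v => m v * ρ i v - m p * ρ i p - (m p • fderiv ℝ (ρ i) p) (v - p)) =
            fun v => m p * (ρ i v - ρ i p - fderiv ℝ (ρ i) p (v - p)) +
              (m v - m p) * (ρ i v - ρ i p) := by
          funext v
          rw [hA i hi]
          simp only [smul_apply, smul_eq_mul]
          ring
        rw [h5]
        refine (h4.const_mul_left _).add ?_
        have h6 : (fun v => m v - m p) =o[𝓝 p] fun _ => (1 : ℝ) :=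
          (Asymptotics.isLittleO_one_iff ℝ).2 (by simpa using hmc.tendsto.sub_const (m p))
        refine Asymptotics.isLittleO_norm_right.1 ?_
        simpa using h6.mul_isBigO (hρ i).differentiableAt.isBigO_sub.norm_right
      exact h3.congr_of_eventuallyEq hme
    have := congrArg (fun L : V₁ →L[ℝ] ℝ => L v) (h1.unique h2)
    simpa using this
  have hinj : Function.Injective (fderiv ℝ (fun z => H (g z)) 0) := by
    rw [hμd.fderiv, injective_iff_map_eq_zero]
    intro z hz
    exact Subtype.ext (hker z ((hkerΦ z).1 z.2).1 hz)
  have hζ : SmoothNear ζ q := SmoothNear.pi fun i => hρ' i.1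
  have ht : SmoothNear t q := SmoothNear.pi fun i => hρ' i.1
  have hζd : HasFDerivAt ζ (ContinuousLinearMap.pi fun i : E => fderiv ℝ (ρ' i) q) q :=
    hasFDerivAt_pi.2 fun i => (hρ' i.1).hasFDerivAt
  have htd : HasFDerivAt t (ContinuousLinearMap.pi fun i : ι => fderiv ℝ (ρ' i) q) q :=
    hasFDerivAt_pi.2 fun i => (hρ' i.1).hasFDerivAt
  have hζts : Function.Surjective ((fderiv ℝ ζ q).prod (fderiv ℝ t q)) := by
    rw [hζd.fderiv, htd.fderiv]
    rintro ⟨a, b⟩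
    obtain ⟨v, hv⟩ := hsurj' fun i => if h : i ∈ E then a ⟨i, h⟩ else
      if h' : i ∈ A ∧ i ∉ E then b ⟨i, h'⟩ else 0
    refine ⟨v, Prod.ext (funext fun i => ?_) (funext fun i => ?_)⟩
    · simpa using hv i (hEA i.2)
    · simpa [i.2.1, i.2.2] using hv i i.2.1
  have hζμ : ∀ᶠ z in 𝓝 (0 : Z), ζ (H (g z)) = 0 := by
    have h1 : ∀ᶠ v in 𝓝 p, ∀ i : E, ρ i v = 0 → ρ' i (H v) = 0 := by
      rw [eventually_all]
      intro i
      obtain ⟨m, -, -, hme, -⟩ := hrel i (hEA i.2)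
      filter_upwards [hme] with v hv h0
      rw [hv, h0, mul_zero]
    filter_upwards [hΦg, hgt.eventually h1] with z h2 h3
    exact funext fun i => h3 i (((hΦ_iff _).1 h2).2 i i.2)
  have htμ : Function.Surjective ((fderiv ℝ t q).comp (fderiv ℝ (fun z => H (g z)) 0)) := by
    rw [htd.fderiv, hμd.fderiv]
    intro a
    choose! m hmc hmp hme hmd using hrel
    obtain ⟨z, hz⟩ := hZsurj fun i => if h : i ∈ A ∧ i ∉ E then (m i p)⁻¹ * a ⟨i, h⟩ else 0
    refine ⟨z, funext fun i => ?_⟩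
    have h1 := hz i i.2.1 i.2.2
    have h2 := hmd i i.2.1 z
    have h3 := (hmp i i.2.1).ne'
    rw [h1] at h2
    simp only [i.2.1, i.2.2, not_false_eq_true, and_self, dite_true] at h2
    rw [mul_inv_cancel_left₀ h3] at h2
    exact h2
  obtain ⟨B, hB, hB0, hBμ, htB, hchart⟩ := exists_retraction_chart hζ ht
    (funext fun i => hqA i i.2.1) hζts hμs hμ0 hζμ hinj htμ
  refine ⟨fun v => by rw [htan]; exact hkerΦ v, ?_, ?_⟩
  · -- a left inverse of `H` on `C`
    have hπt : Tendsto (fun v => π (v - p)) (𝓝 p) (𝓝 0) := by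
      have := hπd.continuousAt.tendsto
      simpa using this
    have hev : ∀ᶠ v in 𝓝 p, v ∈ C → g (B (lam v)) = v := by
      filter_upwards [hlam, hCret, hπt.eventually hBμ] with v h1 h2 h3 h4
      rw [h2 h4] at h3
      rw [h1 h4, h3, h2 h4]
    refine ⟨_, hev, fun v hv w hw hvw => ?_⟩
    rw [← hv.2 hv.1, hvw, hw.2 hw.1]
  intro X L hX hLX hL1 hL2
  obtain ⟨N₂, hN₂, hL2⟩ := hL2
  have hqL : q ∈ L := hL2 ⟨p, ⟨hpC, mem_of_mem_nhds hN₂⟩, hlp⟩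
  have hπt : Tendsto (fun v => π (v - p)) (𝓝 p) (𝓝 0) := by
    have := hπd.continuousAt.tendsto
    simpa using this
  have hLret : ∀ᶠ v in 𝓝 q, v ∈ L → H (g (B v)) = v := by
    have h1 : ∀ᶠ v in 𝓝 p, v ∈ C → H (g (B (lam v))) = lam v := by
      filter_upwards [hlam, hCret, hπt.eventually hBμ] with v h1 h2 h3 h4
      rw [h2 h4] at h3
      rw [h1 h4, h3, h2 h4]
    filter_upwards [hL1 _ h1] with v hv hvL
    obtain ⟨w, ⟨hwC, hw⟩, rfl⟩ := hv hvL
    exact hw hwC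
  have hBt : Tendsto B (𝓝 q) (𝓝 0) := hB0 ▸ hB.continuousAt.tendsto
  have hLpar : ∀ᶠ z in 𝓝 (0 : Z), (∀ i, 0 ≤ τ z i) → H (g z) ∈ L := by
    filter_upwards [hCτ, hgt.eventually hlam, hgt.eventually hN₂] with z h1 h2 h3 h4
    exact hL2 ⟨g z, ⟨h1 h4, h3⟩, h2 (h1 h4)⟩
  constructor
  · rw [tangentSpan_eq_range hμd hμ0 hB.differentiableAt hB0 hLret hqL hτd hτ0 hτs hLpar, htan]
    ext v
    simp
  · have hτt : ∀ᶠ z in 𝓝 (0 : Z), (∀ i, 0 ≤ t (H (g z)) i) → ∀ i, 0 ≤ τ z i := by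
      have h1 : ∀ᶠ v in 𝓝 p, ∀ i : ι, 0 ≤ ρ' i (H v) → 0 ≤ ρ i v := by
        rw [eventually_all]
        intro i
        obtain ⟨m, hmc, hmp, hme, -⟩ := hrel i i.2.1
        filter_upwards [hme, hmc.eventually (lt_mem_nhds hmp)] with v hv hv' h0
        rw [hv] at h0
        exact nonneg_of_mul_nonneg_right h0 hv'
      filter_upwards [hgt.eventually h1] with z hz h i
      exact hz i (h i)
    obtain ⟨n, k, ν, G, Λ', h1, h2, h3, h4, h5, h6, h7⟩ := hchart X L (by
      have h0 : ∀ᶠ v in 𝓝 q, ∀ i, i ∉ A → 0 < ρ' i v := by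
        rw [eventually_all]
        intro i
        by_cases hi : i ∈ A
        · exact Eventually.of_forall fun v h => absurd hi h
        · filter_upwards [(hρ' i).continuousAt.eventually (lt_mem_nhds (hqA' i hi))] with v hv _
          exact hv
      filter_upwards [hX, h0] with v hv hv0
      rw [hv]
      constructor
      · rintro ⟨ha, hb⟩
        exact ⟨funext fun i => ha i i.2, fun i => hb i⟩
      · rintro ⟨ha, hb⟩
        have ha' : ∀ i ∈ E, ρ' i v = 0 := fun i hi => congrFun ha ⟨i, hi⟩
        refine ⟨ha', fun i => ?_⟩
        by_cases hi : i ∈ A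
        · by_cases hiE : i ∈ E
          · exact (ha' i hiE).ge
          · exact hb ⟨i, hi, hiE⟩
        · exact (hv0 i hi).le) (by
      filter_upwards [hLret, hX, hBt.eventually hLpar, hBt.eventually hτt] with v h1 h2 h3 h4
      refine ⟨fun h => ⟨hLX h, h1 h⟩, fun ⟨ha, hb⟩ => ?_⟩
      rw [← hb]
      refine h3 (h4 fun i => ?_)
      rw [hb]
      exact (h2.1 ha).2 i)
    refine ⟨n, k, ν, G, Λ', h1, h2, h3, h4, h5, ?_, ?_⟩
    · rw [h6]
      have h8 := LinearMap.finrank_range_add_finrank_ker (fderiv ℝ Φ p).toLinearMap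
      rw [LinearMap.range_eq_top.2 hΦs, ← hZ, finrank_top, Module.finrank_prod,
        Module.finrank_fintype_fun_eq_card, Fintype.card_coe] at h8
      omega
    · simpa using h7

end LocalStructure

/-! ### Joint derivatives of symbols -/

section IteratedDirectional

variable {V : Type*} [NormedAddCommGroup V] [NormedSpace ℝ V]

/-- The iterated directional derivative of `f` along a list of vectors. -/
def iterDir (l : List V) (f : V → ℝ) : V → ℝ := l.foldr (fun v g x => fderiv ℝ g x v) f

@[simp] theorem iterDir_nil (f : V → ℝ) : iterDir [] f = f := rfl

@[simp] theorem iterDir_cons (v : V) (l : List V) (f : V → ℝ) :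
    iterDir (v :: l) f = fun x => fderiv ℝ (iterDir l f) x v := rfl

theorem iterDir_append (l₁ l₂ : List V) (f : V → ℝ) :
    iterDir (l₁ ++ l₂) f = iterDir l₁ (iterDir l₂ f) := by
  simp [iterDir]

theorem contDiff_iterDir {f : V → ℝ} (hf : ContDiff ℝ ∞ f) (l : List V) :
    ContDiff ℝ ∞ (iterDir l f) := by
  induction l with
  | nil => exact hf
  | cons v l ih => exact (ih.fderiv_right (m := ∞) (by simp)).clm_apply contDiff_const

theorem iterDir_perm {f : V → ℝ} (hf : ContDiff ℝ ∞ f) {l₁ l₂ : List V} (h : l₁.Perm l₂) :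
    iterDir l₁ f = iterDir l₂ f := by
  induction h with
  | nil => rfl
  | cons v _ ih => simp [ih]
  | swap v w l =>
    funext x
    have hg := contDiff_iterDir hf l
    have hd : DifferentiableAt ℝ (fderiv ℝ (iterDir l f)) x :=
      ((hg.fderiv_right (m := ∞) (by simp)).differentiable (by simp)) x
    have hsymm : IsSymmSndFDerivAt ℝ (iterDir l f) x :=
      hg.contDiffAt.isSymmSndFDerivAt (by
        rw [minSmoothness_of_isRCLikeNormedField]
        exact WithTop.coe_le_coe.2 (le_top : (2 : ℕ∞) ≤ ⊤))
    simp only [iterDir_cons]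
    rw [fderiv_clm_apply hd (differentiableAt_const _),
      fderiv_clm_apply hd (differentiableAt_const _)]
    simpa using hsymm w v
  | trans _ _ ih₁ ih₂ => exact ih₁.trans ih₂

theorem iteratedFDeriv_eq_iterDir {f : V → ℝ} (hf : ContDiff ℝ ∞ f) (n : ℕ) (x : V)
    (m : Fin n → V) : iteratedFDeriv ℝ n f x m = iterDir (List.ofFn m) f x := by
  induction n generalizing x with
  | zero => simp
  | succ n ih =>
    rw [iteratedFDeriv_succ_apply_left, List.ofFn_succ, iterDir_cons]
    have h1 : iterDir (List.ofFn fun i => m i.succ) f =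
        fun y => iteratedFDeriv ℝ n f y (Fin.tail m) := by
      funext y
      rw [ih]; rfl
    have hd : DifferentiableAt ℝ (iteratedFDeriv ℝ n f) x :=
      (hf.differentiable_iteratedFDeriv (m := n) (by exact_mod_cast WithTop.coe_lt_top _)) x
    rw [h1]
    have := (ContinuousMultilinearMap.apply ℝ (fun _ : Fin n => V) ℝ
      (Fin.tail m)).hasFDerivAt.comp x hd.hasFDerivAt
    have h2 : fderiv ℝ (fun y => iteratedFDeriv ℝ n f y (Fin.tail m)) x = _ := this.fderiv
    change _ = fderiv ℝ (fun y => iteratedFDeriv ℝ n f y (Fin.tail m)) x (m 0)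
    rw [h2]; rfl

end IteratedDirectional

section Partial

variable {X Y : Type*} [NormedAddCommGroup X] [NormedSpace ℝ X]
  [NormedAddCommGroup Y] [NormedSpace ℝ Y]

theorem iterDir_map_inr {f : X × Y → ℝ} (hf : ContDiff ℝ ∞ f) (l : List Y) (x : X) (y : Y) :
    iterDir (l.map fun w => ((0 : X), w)) f (x, y) = iterDir l (fun w => f (x, w)) y := by
  induction l generalizing y with
  | nil => rfl
  | cons w l ih =>
    simp only [List.map_cons, iterDir_cons]
    have h1 : iterDir l (fun w => f (x, w)) =
        fun y => iterDir (l.map fun w => ((0 : X), w)) f (x, y) := funext fun y => (ih y).symm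
    have h2 := ((contDiff_iterDir hf (l.map fun w => ((0 : X), w))).differentiable (by simp)
      (x, y)).hasFDerivAt.comp y ((hasFDerivAt_const x y).prodMk (hasFDerivAt_id y))
    have h3 : fderiv ℝ (fun y => iterDir (l.map fun w => ((0 : X), w)) f (x, y)) y = _ := h2.fderiv
    rw [h1, h3]
    simp

theorem iterDir_map_inl {f : X × Y → ℝ} (hf : ContDiff ℝ ∞ f) (l : List X) (x : X) (y : Y) :
    iterDir (l.map fun u => (u, (0 : Y))) f (x, y) = iterDir l (fun u => f (u, y)) x := by
  induction l generalizing x with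
  | nil => rfl
  | cons w l ih =>
    simp only [List.map_cons, iterDir_cons]
    have h1 : iterDir l (fun u => f (u, y)) =
        fun x => iterDir (l.map fun u => (u, (0 : Y))) f (x, y) := funext fun y => (ih y).symm
    have h2 := ((contDiff_iterDir hf (l.map fun u => (u, (0 : Y)))).differentiable (by simp)
      (x, y)).hasFDerivAt.comp (f := fun x : X => (x, y)) x
        ((hasFDerivAt_id x).prodMk (hasFDerivAt_const y x))
    have h3 : fderiv ℝ (fun x => iterDir (l.map fun u => (u, (0 : Y))) f (x, y)) x = _ := h2.fderiv
    rw [h1, h3]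
    simp

theorem contDiff_iteratedFDeriv_partial {f : X × Y → ℝ} (hf : ContDiff ℝ ∞ f) (l : ℕ) (y : Y) :
    ContDiff ℝ ∞ fun u : X => iteratedFDeriv ℝ l (fun w : Y => f (u, w)) y := by
  have h1 : ∀ u : X, iteratedFDeriv ℝ l (fun w : Y => f (u, w)) y =
      (iteratedFDeriv ℝ l f (u, y)).compContinuousLinearMap
        fun _ => ContinuousLinearMap.inr ℝ X Y := by
    intro u
    have h2 := (ContinuousLinearMap.inr ℝ X Y).iteratedFDeriv_comp_right
      (f := fun z => f ((u, 0) + z)) (n := ∞)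
      (hf.comp (contDiff_const.add contDiff_id)) y (i := l) (by exact_mod_cast le_top)
    rw [iteratedFDeriv_comp_add_left] at h2
    have h3 : (fun w : Y => f (u, w)) =
        (fun z => f ((u, 0) + z)) ∘ (ContinuousLinearMap.inr ℝ X Y) := by
      funext w; simp
    rw [h3, h2]
    have h4 : (u, (0 : Y)) + ContinuousLinearMap.inr ℝ X Y y = (u, y) := by simp
    rw [h4]
  simp only [h1]
  have h2 : ContDiff ℝ ∞ fun u : X => iteratedFDeriv ℝ l f (u, y) :=
    (hf.iteratedFDeriv_right (m := ∞) (i := l)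
      (by exact_mod_cast (le_top : (⊤ : ℕ∞) + (l : ℕ∞) ≤ ⊤))).comp
      (contDiff_id.prodMk contDiff_const)
  exact (ContinuousMultilinearMap.compContinuousLinearMapL
    fun _ : Fin l => ContinuousLinearMap.inr ℝ X Y).contDiff.comp h2

theorem prod_norm_get_eq {Z : Type*} [NormedAddCommGroup Z] (l : List Z) :
    ∏ i, ‖l.get i‖ = (l.map norm).prod := by
  rw [← List.prod_ofFn]
  congr 1
  rw [← List.ofFn_get (l.map norm)]
  simp [List.ofFn_eq_map]

theorem prod_map_norm_nonneg {Z : Type*} [NormedAddCommGroup Z] (l : List Z) :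
    0 ≤ (l.map norm).prod :=
  prod_norm_get_eq l ▸ Finset.prod_nonneg fun _ _ => norm_nonneg _

/-- Directional derivatives in the `X`-directions `lx` and the `Y`-directions `ly` are values of the
mixed partial derivative. -/
theorem abs_iterDir_partial_le {f : X × Y → ℝ} (hf : ContDiff ℝ ∞ f) (lx : List X) (ly : List Y)
    (x : X) (y : Y) :
    |iterDir ((lx.map fun u => (u, (0 : Y))) ++ ly.map fun w => ((0 : X), w)) f (x, y)| ≤
      ‖iteratedFDeriv ℝ lx.length (fun u => iteratedFDeriv ℝ ly.length (fun w => f (u, w)) y) x‖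
        * (lx.map norm).prod * (ly.map norm).prod := by
  rw [iterDir_append, iterDir_map_inl (contDiff_iterDir hf _)]
  have h1 : (fun u => iterDir (ly.map fun w => ((0 : X), w)) f (u, y)) =
      (ContinuousMultilinearMap.apply ℝ (fun _ : Fin ly.length => Y) ℝ ly.get) ∘
        fun u => iteratedFDeriv ℝ ly.length (fun w => f (u, w)) y := by
    funext u
    rw [iterDir_map_inr hf]
    have hfu : ContDiff ℝ ∞ fun w => f (u, w) := hf.comp (contDiff_const.prodMk contDiff_id)
    simp [iteratedFDeriv_eq_iterDir hfu]
  have hT := contDiff_iteratedFDeriv_partial hf ly.length y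
  have h2 : ContDiff ℝ ∞ fun u => iterDir (ly.map fun w => ((0 : X), w)) f (u, y) :=
    (contDiff_iterDir hf _).comp (contDiff_id.prodMk contDiff_const)
  have h3 := iteratedFDeriv_eq_iterDir h2 lx.length x lx.get
  rw [List.ofFn_get] at h3
  rw [← h3, h1, ContinuousLinearMap.iteratedFDeriv_comp_left (n := ∞) _ hT.contDiffAt
    (by exact_mod_cast le_top)]
  calc ‖iteratedFDeriv ℝ lx.length (fun u => iteratedFDeriv ℝ ly.length (fun w => f (u, w)) y) x
          lx.get ly.get‖
      ≤ ‖iteratedFDeriv ℝ lx.length (fun u => iteratedFDeriv ℝ ly.length (fun w => f (u, w)) y) x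
          lx.get‖ * ∏ i, ‖ly.get i‖ := ContinuousMultilinearMap.le_opNorm _ _
    _ ≤ _ := by
      rw [prod_norm_get_eq]
      gcongr
      · exact prod_map_norm_nonneg _
      · rw [← prod_norm_get_eq]; exact ContinuousMultilinearMap.le_opNorm _ _

/-- The joint `n`-th derivative is controlled by the mixed partial derivatives of total order
`n`. -/
theorem norm_iteratedFDeriv_le_of_partial {f : X × Y → ℝ} (hf : ContDiff ℝ ∞ f) (n : ℕ) (x : X)
    (y : Y) {B : ℝ} (hB : ∀ k l, k + l = n →
      ‖iteratedFDeriv ℝ k (fun u => iteratedFDeriv ℝ l (fun w => f (u, w)) y) x‖ ≤ B) :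
    ‖iteratedFDeriv ℝ n f (x, y)‖ ≤ 2 ^ n * B := by
  have hB0 : 0 ≤ B := (norm_nonneg _).trans (hB n 0 (by simp))
  have key : ∀ (l : List (X × Y)) (lx : List X) (ly : List Y),
      lx.length + ly.length + l.length = n →
      |iterDir (l ++ ((lx.map fun u => (u, (0 : Y))) ++ ly.map fun w => ((0 : X), w))) f (x, y)| ≤
        2 ^ l.length * B * (lx.map norm).prod * (ly.map norm).prod * (l.map norm).prod := by
    intro l
    induction l with
    | nil =>
      intro lx ly h
      have h1 := abs_iterDir_partial_le hf lx ly x y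
      refine (by simpa using h1 : _ ≤ _).trans ?_
      have h2 := hB lx.length ly.length (by simpa using h)
      simp only [List.length_nil, pow_zero, one_mul, List.map_nil, List.prod_nil, mul_one]
      gcongr
      · exact prod_map_norm_nonneg _
      · exact prod_map_norm_nonneg _
    | cons v l ih =>
      intro lx ly h
      have h1 := ih (v.1 :: lx) ly (by simp at h ⊢; omega)
      have h2 := ih lx (v.2 :: ly) (by simp at h ⊢; omega)
      set M := (lx.map fun u => (u, (0 : Y))) ++ ly.map fun w => ((0 : X), w) with hM
      have p1 : (l ++ (((v.1 :: lx).map fun u => (u, (0 : Y))) ++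
          ly.map fun w => ((0 : X), w))).Perm ((v.1, (0 : Y)) :: (l ++ M)) := by
        simp only [List.map_cons, List.cons_append]
        exact List.perm_middle
      have p2 : (l ++ ((lx.map fun u => (u, (0 : Y))) ++
          (v.2 :: ly).map fun w => ((0 : X), w))).Perm (((0 : X), v.2) :: (l ++ M)) := by
        simp only [List.map_cons]
        exact (List.Perm.append_left l List.perm_middle).trans List.perm_middle
      rw [iterDir_perm hf p1] at h1
      rw [iterDir_perm hf p2] at h2
      have hv : v = (v.1, (0 : Y)) + ((0 : X), v.2) := by simp
      have h3 : iterDir (v :: l ++ M) f (x, y) =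
          iterDir ((v.1, (0 : Y)) :: (l ++ M)) f (x, y) +
            iterDir (((0 : X), v.2) :: (l ++ M)) f (x, y) := by
        simp only [List.cons_append, iterDir_cons]
        rw [← map_add, ← hv]
      rw [h3]
      refine (abs_add_le _ _).trans ((add_le_add h1 h2).trans ?_)
      simp only [List.map_cons, List.prod_cons, List.length_cons]
      have n1 : ‖v.1‖ ≤ ‖v‖ := norm_fst_le v
      have n2 : ‖v.2‖ ≤ ‖v‖ := norm_snd_le v
      have q1 : 0 ≤ (lx.map norm).prod := prod_map_norm_nonneg _
      have q2 : 0 ≤ (ly.map norm).prod := prod_map_norm_nonneg _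
      have q3 : 0 ≤ (l.map norm).prod := prod_map_norm_nonneg _
      have q4 : 0 ≤ 2 ^ l.length * B * (lx.map norm).prod * (ly.map norm).prod *
        (l.map norm).prod := by positivity
      calc _ = (2 ^ l.length * B * (lx.map norm).prod * (ly.map norm).prod *
            (l.map norm).prod) * (‖v.1‖ + ‖v.2‖) := by ring
        _ ≤ (2 ^ l.length * B * (lx.map norm).prod * (ly.map norm).prod *
            (l.map norm).prod) * (‖v‖ + ‖v‖) := by gcongr
        _ = _ := by ring
  refine ContinuousMultilinearMap.opNorm_le_bound (by positivity) fun m => ?_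
  rw [iteratedFDeriv_eq_iterDir hf]
  have := key (List.ofFn m) [] [] (by simp)
  simpa [List.prod_ofFn, List.map_ofFn] using this

end Partial

section Symbols

variable {d s : ℕ}

theorem one_le_jap {n : ℕ} (x : Euc n) : 1 ≤ jap x := by
  unfold jap
  exact Real.one_le_sqrt.2 (by nlinarith [sq_nonneg ‖x‖])

theorem jap_pos {n : ℕ} (x : Euc n) : 0 < jap x := zero_lt_one.trans_le (one_le_jap x)

/-- Joint derivatives of a symbol do not grow faster than the symbol; the gain in decay of the
partial derivatives is given up here. -/
theorem IsSymbol.exists_joint_bound {me mψ : ℝ} {a : Euc d × Euc s → ℝ} (ha : IsSymbol me mψ a)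
    (n : ℕ) : ∃ C : ℝ, ∀ (x : Euc d) (θ : Euc s),
      ‖iteratedFDeriv ℝ n a (x, θ)‖ ≤ C * jap x ^ me * jap θ ^ mψ := by
  choose C hC using ha.bound
  refine ⟨2 ^ n * ∑ k ∈ Finset.range (n + 1), |C k (n - k)|, fun x θ => ?_⟩
  have hx := one_le_jap x
  have hθ := one_le_jap θ
  have hx0 := jap_pos x
  have hθ0 := jap_pos θ
  rw [mul_assoc, mul_assoc]
  refine norm_iteratedFDeriv_le_of_partial ha.smooth n x θ fun k l hkl => (hC k l x θ).trans ?_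
  have h1 : |C k l| ≤ ∑ k ∈ Finset.range (n + 1), |C k (n - k)| := by
    have : l = n - k := by omega
    rw [this]
    exact Finset.single_le_sum (f := fun k => |C k (n - k)|) (fun _ _ => abs_nonneg _)
      (Finset.mem_range.2 (by omega))
  calc C k l * jap x ^ (me - (k : ℝ)) * jap θ ^ (mψ - (l : ℝ))
      ≤ |C k l| * jap x ^ me * jap θ ^ mψ := by
        have h2 := Real.rpow_le_rpow_of_exponent_le hx (sub_le_self me (Nat.cast_nonneg (α := ℝ) k))
        have h3 := Real.rpow_le_rpow_of_exponent_le hθ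
          (sub_le_self mψ (Nat.cast_nonneg (α := ℝ) l))
        gcongr
        exact le_abs_self _
    _ ≤ (∑ k ∈ Finset.range (n + 1), |C k (n - k)|) * (jap x ^ me * jap θ ^ mψ) := by
        rw [mul_assoc]; gcongr

end Symbols

/-! ### Smooth extension across a hypersurface -/

section Glue

/-- The open half-space `{r > 0}`. -/
def upper (W : Type*) : Set (W × ℝ) := {p | 0 < p.2}

theorem isOpen_upper {W : Type*} [TopologicalSpace W] : IsOpen (upper W) :=
  isOpen_lt continuous_const continuous_snd

theorem tendsto_upper_line {W : Type*} [TopologicalSpace W] (w : W) :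
    Tendsto (fun r : ℝ => (w, r)) (𝓝[>] 0) (𝓝[upper W] (w, 0)) := by
  refine tendsto_nhdsWithin_iff.2 ⟨?_, ?_⟩
  · exact ((Continuous.prodMk_right w).tendsto' 0 (w, 0) rfl).mono_left nhdsWithin_le_nhds
  · filter_upwards [self_mem_nhdsWithin] with r hr using hr

variable {W : Type} [NormedAddCommGroup W] [NormedSpace ℝ W]

/-- Extension by zero preserves differentiability at `{r = 0}` if the function and its derivative
tend to zero there, by the mean value inequality on half-balls. -/
theorem hasFDerivAt_extend_zero {F : Type} [NormedAddCommGroup F] [NormedSpace ℝ F]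
    {h : W × ℝ → F} {U : Set (W × ℝ)} (hU : IsOpen U)
    (hh : DifferentiableOn ℝ h (U ∩ upper W))
    (h0 : ∀ p ∈ U, p.2 = 0 → Tendsto h (𝓝[upper W] p) (𝓝 0))
    (h1 : ∀ p ∈ U, p.2 = 0 → Tendsto (fderiv ℝ h) (𝓝[upper W] p) (𝓝 0))
    {p : W × ℝ} (hp : p ∈ U) :
    HasFDerivAt ((upper W).indicator h) ((upper W).indicator (fderiv ℝ h) p) p := by
  rcases lt_trichotomy p.2 0 with hp2 | hp2 | hp2
  · have hn : p ∉ upper W := fun hc => lt_asymm hp2 hc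
    rw [indicator_of_notMem hn]
    refine (hasFDerivAt_const (0 : F) p).congr_of_eventuallyEq ?_
    filter_upwards [continuous_snd.continuousAt.eventually (gt_mem_nhds hp2)] with y hy
    have hny : y ∉ upper W := fun hc => lt_asymm hy hc
    exact indicator_of_notMem hny h
  · have hn : p ∉ upper W := fun hc => hc.ne' hp2
    rw [indicator_of_notMem hn, hasFDerivAt_iff_isLittleO, Asymptotics.isLittleO_iff]
    intro ε hε
    have hev := (h1 p hp hp2).eventually (Metric.ball_mem_nhds 0 hε)
    rw [eventually_nhdsWithin_iff] at hev
    obtain ⟨δ, hδ, hball⟩ := Metric.eventually_nhds_iff_ball.1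
      (hev.and (hU.mem_nhds hp))
    filter_upwards [Metric.ball_mem_nhds p hδ] with y hy
    rw [indicator_of_notMem hn]
    by_cases hy2 : y ∈ upper W
    swap
    · rw [indicator_of_notMem hy2]; simp only [sub_zero, zero_apply, norm_zero]; positivity
    rw [indicator_of_mem hy2]
    simp only [sub_zero, zero_apply]
    have hyp : y.2 ≤ ‖y - p‖ := by
      have := norm_snd_le (y - p)
      simp only [Prod.snd_sub, hp2, sub_zero] at this
      exact (le_abs_self _).trans this
    -- compare `y` with the points `(y.1, r)`, `r → 0`
    have hy0 : (y.1, (0 : ℝ)) ∈ ball p δ := by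
      rw [mem_ball, dist_eq_norm] at hy ⊢
      refine lt_of_le_of_lt ?_ hy
      rw [Prod.norm_def, Prod.norm_def]
      refine max_le_max le_rfl ?_
      simp [hp2]
    have hmv : ∀ᶠ r : ℝ in 𝓝[>] 0, ‖h y - h (y.1, r)‖ ≤ ε * y.2 := by
      have e1 : ∀ᶠ r : ℝ in 𝓝[>] 0, (y.1, r) ∈ ball p δ :=
        ((Continuous.prodMk_right y.1).tendsto' (0 : ℝ) (y.1, 0) rfl).mono_left
          nhdsWithin_le_nhds |>.eventually (Metric.isOpen_ball.mem_nhds hy0)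
      have e2 : ∀ᶠ r : ℝ in 𝓝[>] 0, r < y.2 := Ioo_mem_nhdsGT hy2 |> fun h =>
        Filter.mem_of_superset h fun r hr => hr.2
      filter_upwards [e1, e2, self_mem_nhdsWithin] with r hr1 hr2 hr3
      have hconv : Convex ℝ (ball p δ ∩ upper W) := by
        refine (convex_ball p δ).inter ?_
        intro a ha b hb s t hs ht hst
        change 0 < s * a.2 + t * b.2
        rcases hs.eq_or_lt with rfl | hs'
        · have : t = 1 := by linarith
          subst this; simpa [upper] using hb
        · have := mul_pos hs' ha
          have := mul_nonneg ht hb.le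
          linarith
      have hb : ∀ z ∈ ball p δ ∩ upper W, ‖fderiv ℝ h z‖ ≤ ε := by
        intro z hz
        have := (hball z hz.1).1 hz.2
        rw [dist_zero_right] at this
        exact this.le
      have hd : ∀ z ∈ ball p δ ∩ upper W, DifferentiableAt ℝ h z := by
        intro z hz
        have hzU := (hball z hz.1).2
        exact (hh z ⟨hzU, hz.2⟩).differentiableAt ((hU.inter isOpen_upper).mem_nhds ⟨hzU, hz.2⟩)
      have := hconv.norm_image_sub_le_of_norm_fderiv_le hd hb (x := (y.1, r)) (y := y)
        ⟨hr1, hr3⟩ ⟨hy, hy2⟩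
      refine this.trans ?_
      gcongr
      have hyr : y - (y.1, r) = (0, y.2 - r) := by ext <;> simp
      rw [hyr, Prod.norm_def]
      simp only [norm_zero, Real.norm_eq_abs]
      rw [max_eq_right (abs_nonneg _), abs_of_nonneg (by linarith)]
      have : (0 : ℝ) < r := hr3
      linarith
    have hlim : Tendsto (fun r : ℝ => ‖h y - h (y.1, r)‖) (𝓝[>] 0) (𝓝 ‖h y - 0‖) := by
      refine Tendsto.norm (tendsto_const_nhds.sub ?_)
      exact (h0 _ (hball _ hy0).2 rfl).comp (tendsto_upper_line y.1)
    have := le_of_tendsto hlim hmv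
    rw [sub_zero] at this
    exact this.trans (by gcongr)
  · have hn : p ∈ upper W := hp2
    rw [indicator_of_mem hn]
    have hd := (hh p ⟨hp, hn⟩).differentiableAt ((hU.inter isOpen_upper).mem_nhds ⟨hp, hn⟩)
    refine hd.hasFDerivAt.congr_of_eventuallyEq ?_
    filter_upwards [isOpen_upper.mem_nhds hn] with y hy
    exact indicator_of_mem hy _

/-- A smooth function on `{r > 0}` all of whose derivatives tend to zero at `{r = 0}` extends
smoothly by zero. -/
theorem contDiffOn_extend_zero {F : Type} [NormedAddCommGroup F] [NormedSpace ℝ F]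
    {h : W × ℝ → F} {U : Set (W × ℝ)} (hU : IsOpen U)
    (hh : ContDiffOn ℝ ∞ h (U ∩ upper W))
    (hflat : ∀ n : ℕ, ∀ p ∈ U, p.2 = 0 →
      Tendsto (fun y => ‖iteratedFDeriv ℝ n h y‖) (𝓝[upper W] p) (𝓝 0)) :
    ContDiffOn ℝ ∞ ((upper W).indicator h) U := by
  have hfderiv : ∀ {F : Type} [NormedAddCommGroup F] [NormedSpace ℝ F] {h : W × ℝ → F},
      ContDiffOn ℝ ∞ h (U ∩ upper W) →
      (∀ n : ℕ, ∀ p ∈ U, p.2 = 0 →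
        Tendsto (fun y => ‖iteratedFDeriv ℝ n h y‖) (𝓝[upper W] p) (𝓝 0)) →
      ∀ p ∈ U, HasFDerivAt ((upper W).indicator h) ((upper W).indicator (fderiv ℝ h) p) p := by
    intro F _ _ h hh hflat p hp
    refine hasFDerivAt_extend_zero hU (hh.differentiableOn (by simp)) ?_ ?_ hp
    · intro p hp hp2
      rw [tendsto_zero_iff_norm_tendsto_zero]
      simpa using hflat 0 p hp hp2
    · intro p hp hp2
      rw [tendsto_zero_iff_norm_tendsto_zero]
      refine (hflat 1 p hp hp2).congr fun y => ?_
      rw [← norm_iteratedFDeriv_fderiv, norm_iteratedFDeriv_zero]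
  rw [contDiffOn_infty]
  intro n
  induction n generalizing F with
  | zero =>
    rw [Nat.cast_zero, contDiffOn_zero]
    exact fun p hp => (hfderiv hh hflat p hp).continuousAt.continuousWithinAt
  | succ n ih =>
    rw [Nat.cast_succ, contDiffOn_succ_iff_fderiv_of_isOpen hU]
    refine ⟨fun p hp => (hfderiv hh hflat p hp).differentiableAt.differentiableWithinAt,
      by simp, ?_⟩
    refine (ih (h := fderiv ℝ h) ?_ ?_).congr fun p hp => (hfderiv hh hflat p hp).fderiv
    · exact hh.fderiv_of_isOpen (hU.inter isOpen_upper) (by simp)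
    · intro m p hp hp2
      refine (hflat (m + 1) p hp hp2).congr fun y => ?_
      rw [norm_iteratedFDeriv_fderiv]

end Glue

section Borel

variable {W : Type} [NormedAddCommGroup W] [NormedSpace ℝ W]

theorem iteratedFDeriv_pow_mul_eq_zero {k n : ℕ} (hn : n < k) {g : W → ℝ} (hg : ContDiff ℝ ∞ g)
    (w : W) : iteratedFDeriv ℝ n (fun p : W × ℝ => p.2 ^ k * g p.1) (w, 0) = 0 := by
  have hpow : ∀ i ≤ n, iteratedFDeriv ℝ i (fun p : W × ℝ => p.2 ^ k) (w, 0) = 0 := by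
    intro i hi
    have h1 := (ContinuousLinearMap.snd ℝ W ℝ).iteratedFDeriv_comp_right
      (f := fun r : ℝ => r ^ k) (n := ∞) (contDiff_id.pow k) (w, 0) (i := i)
      (by exact_mod_cast le_top)
    have h2 : iteratedFDeriv ℝ i (fun r : ℝ => r ^ k) 0 = 0 := by
      rw [← norm_eq_zero, norm_iteratedFDeriv_eq_norm_iteratedDeriv, iteratedDeriv_eq_iterate,
        iter_deriv_pow]
      rw [zero_pow (by omega)]; simp
    have h3 : (fun p : W × ℝ => p.2 ^ k) = (fun r : ℝ => r ^ k) ∘ ContinuousLinearMap.snd ℝ W ℝ :=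
      rfl
    rw [h3, h1]
    simp only [ContinuousLinearMap.coe_snd', h2]
    ext m; simp
  rw [← norm_eq_zero]
  refine le_antisymm ((norm_iteratedFDeriv_mul_le (N := ∞) (contDiff_snd.pow k)
    (hg.comp contDiff_fst) (w, 0) (by exact_mod_cast le_top)).trans (le_of_eq ?_)) (norm_nonneg _)
  refine Finset.sum_eq_zero fun i hi => ?_
  rw [hpow i (by simp at hi; omega)]; simp

/-- Borel's lemma with parameters: there is a smooth function with prescribed Taylor
coefficients `g k` (smooth functions with compact support) along `{r = 0}`. -/
theorem exists_borel_sum {g : ℕ → W → ℝ} (hg : ∀ k, ContDiff ℝ ∞ (g k))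
    (hgc : ∀ k, HasCompactSupport (g k)) :
    ∃ B : W × ℝ → ℝ, ContDiff ℝ ∞ B ∧ ∀ N n : ℕ, n < N → ∀ w,
      iteratedFDeriv ℝ n (fun p => B p - ∑ k ∈ Finset.range N, p.2 ^ k * g k p.1) (w, 0) = 0 := by
  let ψ : ContDiffBump (0 : ℝ) := ⟨1, 2, one_pos, one_lt_two⟩
  let τ : ℕ → W × ℝ → ℝ := fun k p => p.2 ^ k * ψ p.2 * g k p.1
  have hτ : ∀ k, ContDiff ℝ ∞ (τ k) := fun k =>
    ((contDiff_snd.pow k).mul (ψ.contDiff.comp contDiff_snd)).mul ((hg k).comp contDiff_fst)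
  have hτc : ∀ k, HasCompactSupport (τ k) := fun k => by
    refine HasCompactSupport.of_support_subset_isCompact
      ((hgc k).isCompact.prod ψ.hasCompactSupport.isCompact) fun p hp => ?_
    refine ⟨subset_tsupport _ fun h => hp ?_, subset_tsupport _ fun h => hp ?_⟩
    · simp [τ, h]
    · simp [τ, h]
  have hτb : ∀ k n : ℕ, ∃ M : ℝ, ∀ p, ‖iteratedFDeriv ℝ n (τ k) p‖ ≤ M := by
    intro k n
    have h1 : Continuous (iteratedFDeriv ℝ n (τ k)) :=
      (hτ k).continuous_iteratedFDeriv (by exact_mod_cast le_top)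
    exact ((hτc k).iteratedFDeriv (𝕜 := ℝ) n).exists_bound_of_continuous h1
  choose M hM using hτb
  have hM0 : ∀ k n, 0 ≤ M k n := fun k n => (norm_nonneg _).trans (hM k n 0)
  -- the scales at which the terms are cut off
  let S : ℕ → ℝ := fun k => 1 + ∑ n ∈ Finset.range k, M k n
  have hS : ∀ k, 1 ≤ S k := fun k =>
    le_add_of_nonneg_right (Finset.sum_nonneg fun n _ => hM0 k n)
  let ε : ℕ → ℝ := fun k => (2 ^ k * S k)⁻¹
  have hε : ∀ k, 0 < ε k := fun k => by have := hS k; positivity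
  have hε1 : ∀ k, ε k ≤ 1 := fun k => by
    refine inv_le_one_of_one_le₀ ?_
    exact one_le_mul_of_one_le_of_one_le (one_le_pow₀ one_le_two) (hS k)
  let term : ℕ → W × ℝ → ℝ := fun k p => p.2 ^ k * ψ ((ε k)⁻¹ * p.2) * g k p.1
  have hterm : ∀ k, ContDiff ℝ ∞ (term k) := fun k =>
    ((contDiff_snd.pow k).mul (ψ.contDiff.comp (contDiff_const.mul contDiff_snd))).mul
      ((hg k).comp contDiff_fst)
  let L : ℕ → W × ℝ →L[ℝ] W × ℝ := fun k =>
    (ContinuousLinearMap.fst ℝ W ℝ).prod ((ε k)⁻¹ • ContinuousLinearMap.snd ℝ W ℝ)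
  have hL : ∀ k, ‖L k‖ ≤ (ε k)⁻¹ := fun k => by
    have h1 : 1 ≤ (ε k)⁻¹ := (one_le_inv₀ (hε k)).2 (hε1 k)
    refine ContinuousLinearMap.opNorm_le_bound _ (by linarith) fun p => ?_
    rw [Prod.norm_def]
    refine max_le ?_ ?_
    · calc ‖p.1‖ ≤ 1 * ‖p‖ := by rw [one_mul]; exact norm_fst_le p
        _ ≤ _ := by gcongr
    · change ‖(ε k)⁻¹ * p.2‖ ≤ _
      rw [norm_mul, Real.norm_of_nonneg (by linarith)]
      gcongr
      exact norm_snd_le p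
  have hterm_eq : ∀ k, term k = fun p => ε k ^ k • (τ k ∘ L k) p := by
    intro k
    funext p
    have h2 := (hε k).ne'
    simp only [term, τ, L, Function.comp, smul_eq_mul, ContinuousLinearMap.prod_apply,
      ContinuousLinearMap.coe_fst', smul_apply, ContinuousLinearMap.coe_snd',
      mul_pow, inv_pow]
    field_simp
  have hbound : ∀ k n p, ‖iteratedFDeriv ℝ n (term k) p‖ ≤ ε k ^ k * (M k n * (ε k)⁻¹ ^ n) := by
    intro k n p
    rw [hterm_eq]
    have h1 : ContDiff ℝ ∞ (τ k ∘ L k) := (hτ k).comp (L k).contDiff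
    have h2 : iteratedFDeriv ℝ n (fun p => ε k ^ k • (τ k ∘ L k) p) p =
        ε k ^ k • iteratedFDeriv ℝ n (τ k ∘ L k) p := by
      rw [← iteratedFDeriv_const_smul_apply]
      · rfl
      · exact (h1.of_le (by exact_mod_cast le_top)).contDiffAt
    rw [h2, norm_smul, Real.norm_of_nonneg (pow_nonneg (hε k).le _),
      (L k).iteratedFDeriv_comp_right (n := ∞) (hτ k) p (by exact_mod_cast le_top)]
    have := (hε k).le
    gcongr
    refine (ContinuousMultilinearMap.norm_compContinuousLinearMap_le _ _).trans ?_
    rw [Finset.prod_const, Finset.card_univ, Fintype.card_fin]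
    gcongr
    · exact hM0 k n
    · exact hM k n _
    · exact hL k
  let v : ℕ → ℕ → ℝ := fun n k => ε k ^ k * (M k n * (ε k)⁻¹ ^ n)
  have hv : ∀ n, Summable (v n) := by
    intro n
    refine Summable.of_norm_bounded_eventually_nat (g := fun k => (1 / 2 : ℝ) ^ k)
      (summable_geometric_of_lt_one (by norm_num) (by norm_num)) ?_
    filter_upwards [eventually_gt_atTop n] with k hk
    have h1 : 0 ≤ v n k := mul_nonneg (pow_nonneg (hε k).le _)
      (mul_nonneg (hM0 k n) (pow_nonneg (inv_nonneg.2 (hε k).le) _))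
    rw [Real.norm_of_nonneg h1]
    have h2 : ε k ^ k * (ε k)⁻¹ ^ n ≤ ε k := by
      obtain ⟨j, rfl⟩ := Nat.exists_eq_add_of_lt hk
      have h3 := (hε (n + j + 1)).ne'
      have : ε (n + j + 1) ^ (n + j + 1) * (ε (n + j + 1))⁻¹ ^ n = ε (n + j + 1) ^ (j + 1) := by
        generalize ε (n + j + 1) = e at h3
        rw [inv_pow, add_assoc n j 1, pow_add, mul_right_comm, mul_inv_cancel₀ (pow_ne_zero _ h3),
          one_mul]
      rw [this]
      exact pow_le_of_le_one (hε _).le (hε1 _) (by omega)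
    have h4 : M k n ≤ S k := by
      have := Finset.single_le_sum (f := fun n => M k n) (s := Finset.range k)
        (fun i _ => hM0 k i) (Finset.mem_range.2 hk)
      simp only [S]; linarith
    calc v n k = (ε k ^ k * (ε k)⁻¹ ^ n) * M k n := by simp only [v]; ring
      _ ≤ ε k * S k := mul_le_mul h2 h4 (hM0 k n) (hε k).le
      _ = (1 / 2) ^ k := by
        have := hS k
        simp only [ε, one_div, inv_pow]
        field_simp
  have hBs : ContDiff ℝ ∞ fun p => ∑' k, term k p :=
    contDiff_tsum (N := ⊤) hterm (fun n _ => hv n) fun n k p _ => hbound k n p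
  refine ⟨fun p => ∑' k, term k p, hBs, fun N n hn w => ?_⟩
  have hP : ∀ k, ContDiff ℝ ∞ fun p : W × ℝ => p.2 ^ k * g k p.1 := fun k =>
    (contDiff_snd.pow k).mul ((hg k).comp contDiff_fst)
  have hnear : ∀ k, iteratedFDeriv ℝ n (term k) (w, 0) =
      iteratedFDeriv ℝ n (fun p : W × ℝ => p.2 ^ k * g k p.1) (w, 0) := by
    intro k
    refine Filter.EventuallyEq.eq_of_nhds (Filter.EventuallyEq.iteratedFDeriv ℝ ?_ n)
    have hc : Tendsto (fun p : W × ℝ => (ε k)⁻¹ * p.2) (𝓝 (w, 0)) (𝓝 0) :=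
      (by fun_prop : Continuous fun p : W × ℝ => (ε k)⁻¹ * p.2).tendsto' _ _ (by simp)
    filter_upwards [hc.eventually ψ.eventuallyEq_one] with p hp
    simp [term, hp]
  have h1 : iteratedFDeriv ℝ n (fun p => ∑' k, term k p) (w, 0) =
      ∑ k ∈ Finset.range N, iteratedFDeriv ℝ n (fun p : W × ℝ => p.2 ^ k * g k p.1) (w, 0) := by
    rw [iteratedFDeriv_tsum_apply (N := ⊤) hterm (fun n _ => hv n)
      (fun n k p _ => hbound k n p) le_top, tsum_eq_sum (s := Finset.range N)]
    · exact Finset.sum_congr rfl fun k _ => hnear k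
    · intro k hk
      rw [hnear, iteratedFDeriv_pow_mul_eq_zero (by simp at hk; omega) (hg k)]
  have hn' : (n : ℕ∞ω) ≤ ∞ := by exact_mod_cast le_top
  have h2 : ContDiff ℝ ∞ fun p : W × ℝ => ∑ k ∈ Finset.range N, p.2 ^ k * g k p.1 :=
    ContDiff.sum fun k _ => hP k
  have h3 := iteratedFDeriv_sub_apply (i := n) (hBs.of_le hn').contDiffAt
    (h2.of_le hn').contDiffAt (x := (w, (0 : ℝ)))
  have h4 : iteratedFDeriv ℝ n (fun p : W × ℝ => ∑ k ∈ Finset.range N, p.2 ^ k * g k p.1) (w, 0) =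
      ∑ k ∈ Finset.range N, iteratedFDeriv ℝ n (fun p : W × ℝ => p.2 ^ k * g k p.1) (w, 0) := by
    rw [iteratedFDeriv_sum fun k _ => (hP k).of_le hn']
    simp
  refine Eq.trans ?_ (h3.trans (by rw [h1, h4, sub_self]))
  rfl

end Borel

/-! ### Polyhomogeneous functions at infinity -/

section Poly

variable {d s : ℕ}

/-- `(x, σ, r) ↦ (x, σ / r)`. -/
def unscale (p : (Euc d × Euc s) × ℝ) : Euc d × Euc s := (p.1.1, p.2⁻¹ • p.1.2)

theorem contDiffOn_unscale :
    ContDiffOn ℝ ∞ (unscale (d := d) (s := s)) (upper (Euc d × Euc s)) := by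
  refine contDiff_fst.fst.contDiffOn.prodMk (ContDiffOn.fun_smul ?_ contDiff_fst.snd.contDiffOn)
  exact contDiff_snd.contDiffOn.inv fun p hp => (ne_of_gt hp : p.2 ≠ 0)

theorem contDiffAt_unscale {p : (Euc d × Euc s) × ℝ} (hp : 0 < p.2) :
    ContDiffAt ℝ ∞ (unscale (d := d) (s := s)) p :=
  contDiffOn_unscale.contDiffAt (isOpen_upper.mem_nhds hp)

/-- The derivatives of `(x, σ, r) ↦ (x, σ / r)` grow at most polynomially in `1 / r`; this follows
by homogeneity from the bounds at `r = 1`. -/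
theorem exists_bound_iteratedFDeriv_unscale (w₀ : Euc d × Euc s) (n : ℕ) :
    ∃ K : ℝ, 1 ≤ K ∧ ∀ᶠ p in 𝓝[upper (Euc d × Euc s)] (w₀, 0), ∀ i ≤ n,
      ‖iteratedFDeriv ℝ i unscale p‖ ≤ K * p.2⁻¹ ^ (i + 1) := by
  have hc : ∀ i : ℕ, ContinuousAt
      (fun w : Euc d × Euc s => ‖iteratedFDeriv ℝ i unscale (w, (1 : ℝ))‖) w₀ := by
    intro i
    have h1 : ContinuousOn (iteratedFDeriv ℝ i (unscale (d := d) (s := s))) (upper _) := by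
      refine (contDiffOn_unscale.continuousOn_iteratedFDerivWithin (m := i)
        (by exact_mod_cast le_top) isOpen_upper.uniqueDiffOn).congr fun p hp => ?_
      rw [iteratedFDerivWithin_of_isOpen _ isOpen_upper hp]
    have h2 : ContinuousAt (iteratedFDeriv ℝ i (unscale (d := d) (s := s))) (w₀, 1) :=
      h1.continuousAt (isOpen_upper.mem_nhds (by simp [upper]))
    exact (ContinuousAt.comp (f := fun w : Euc d × Euc s => (w, (1 : ℝ))) h2
      (by fun_prop)).norm
  let K₀ : ℕ → ℝ := fun i => ‖iteratedFDeriv ℝ i unscale (w₀, (1 : ℝ))‖ + 1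
  have hK₀ : ∀ i, 0 ≤ K₀ i := fun i => by positivity
  refine ⟨1 + ∑ i ∈ Finset.range (n + 1), K₀ i,
    le_add_of_nonneg_right (Finset.sum_nonneg fun i _ => hK₀ i), ?_⟩
  have h1 : ∀ᶠ w in 𝓝 w₀, ∀ i ∈ Finset.range (n + 1),
      ‖iteratedFDeriv ℝ i unscale (w, (1 : ℝ))‖ < K₀ i :=
    (Finset.eventually_all _).2 fun i _ => (hc i).eventually (gt_mem_nhds (lt_add_one _))
  have h2 : ∀ᶠ p in 𝓝[upper (Euc d × Euc s)] (w₀, 0), p.2 < 1 :=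
    (continuous_snd.continuousAt.eventually (gt_mem_nhds (by simp))).filter_mono
      nhdsWithin_le_nhds
  have h3 : ∀ᶠ p in 𝓝[upper (Euc d × Euc s)] (w₀, 0), ∀ i ∈ Finset.range (n + 1),
      ‖iteratedFDeriv ℝ i unscale (p.1, (1 : ℝ))‖ < K₀ i :=
    ((continuous_fst.tendsto (w₀, (0 : ℝ))).eventually h1).filter_mono nhdsWithin_le_nhds
  filter_upwards [h2, h3, self_mem_nhdsWithin] with p hp1 hp2 hp3 i hi
  obtain ⟨w, r⟩ := p
  have hr : 0 < r := hp3
  have hr1 : r < 1 := hp1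
  have hri : 1 ≤ r⁻¹ := (one_le_inv₀ hr).2 hr1.le
  have hi' : i ∈ Finset.range (n + 1) := Finset.mem_range.2 (by omega)
  let D : ((Euc d × Euc s) × ℝ) ≃L[ℝ] ((Euc d × Euc s) × ℝ) :=
    (ContinuousLinearEquiv.refl ℝ (Euc d × Euc s)).prodCongr
      (ContinuousLinearEquiv.unitsEquivAut ℝ (Units.mk0 r⁻¹ (inv_ne_zero hr.ne')))
  have hD : ∀ p, D p = (p.1, p.2 * r⁻¹) := fun p => rfl
  let S : Euc d × Euc s →L[ℝ] Euc d × Euc s :=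
    (ContinuousLinearMap.fst ℝ _ _).prod (r⁻¹ • ContinuousLinearMap.snd ℝ _ _)
  have hSD : (unscale (d := d) (s := s)) = S ∘ (unscale ∘ D) := by
    funext p
    simp only [unscale, Function.comp, hD, S, ContinuousLinearMap.prod_apply,
      ContinuousLinearMap.coe_fst', smul_apply, ContinuousLinearMap.coe_snd', smul_smul]
    congr 2
    field_simp
  have hDp : D (w, r) = (w, 1) := by rw [hD]; simp [hr.ne']
  have hDn : ‖(D : ((Euc d × Euc s) × ℝ) →L[ℝ] ((Euc d × Euc s) × ℝ))‖ ≤ r⁻¹ := by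
    refine ContinuousLinearMap.opNorm_le_bound _ (by positivity) fun p => ?_
    change ‖D p‖ ≤ _
    rw [hD, Prod.norm_def]
    refine max_le ?_ ?_
    · calc ‖p.1‖ ≤ 1 * ‖p‖ := by rw [one_mul]; exact norm_fst_le p
        _ ≤ _ := by gcongr
    · rw [norm_mul, mul_comm, Real.norm_of_nonneg (inv_nonneg.2 hr.le)]
      gcongr
      exact norm_snd_le p
  have hSn : ‖S‖ ≤ r⁻¹ := by
    refine ContinuousLinearMap.opNorm_le_bound _ (by positivity) fun p => ?_
    rw [Prod.norm_def]
    refine max_le ?_ ?_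
    · calc ‖p.1‖ ≤ 1 * ‖p‖ := by rw [one_mul]; exact norm_fst_le p
        _ ≤ _ := by gcongr
    · change ‖r⁻¹ • p.2‖ ≤ _
      rw [norm_smul, Real.norm_of_nonneg (inv_nonneg.2 hr.le)]
      gcongr
      exact norm_snd_le p
  have hcomp : iteratedFDeriv ℝ i (unscale ∘ D) (w, r) =
      (iteratedFDeriv ℝ i unscale (w, (1 : ℝ))).compContinuousLinearMap
        fun _ => (D : ((Euc d × Euc s) × ℝ) →L[ℝ] ((Euc d × Euc s) × ℝ)) := by
    have := D.iteratedFDerivWithin_comp_right (unscale (d := d) (s := s)) (s := univ)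
      uniqueDiffOn_univ (x := (w, r)) (mem_univ _) i
    rw [preimage_univ, iteratedFDerivWithin_univ, iteratedFDerivWithin_univ, hDp] at this
    exact this
  have hsm : ContDiffAt ℝ ∞ (unscale ∘ D) (w, r) := by
    refine ContDiffAt.comp _ ?_ D.contDiff.contDiffAt
    rw [hDp]
    exact contDiffAt_unscale (by simp)
  rw [hSD, ContinuousLinearMap.iteratedFDeriv_comp_left (n := ∞) S hsm (by exact_mod_cast le_top)]
  refine (ContinuousLinearMap.norm_compContinuousMultilinearMap_le _ _).trans ?_
  rw [hcomp]
  have hK : K₀ i ≤ 1 + ∑ i ∈ Finset.range (n + 1), K₀ i := by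
    have := Finset.single_le_sum (f := K₀) (fun i _ => hK₀ i) hi'
    linarith
  calc ‖S‖ * ‖(iteratedFDeriv ℝ i unscale (w, (1 : ℝ))).compContinuousLinearMap
        fun _ => (D : ((Euc d × Euc s) × ℝ) →L[ℝ] ((Euc d × Euc s) × ℝ))‖
      ≤ r⁻¹ * (K₀ i * r⁻¹ ^ i) := by
        gcongr
        refine (ContinuousMultilinearMap.norm_compContinuousLinearMap_le _ _).trans ?_
        rw [Finset.prod_const, Finset.card_univ, Fintype.card_fin]
        gcongr
        exact (hp2 i hi').le
    _ = K₀ i * r⁻¹ ^ (i + 1) := by ring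
    _ ≤ _ := by gcongr

theorem norm_le_jap {n : ℕ} (x : Euc n) : ‖x‖ ≤ jap x := by
  refine Real.le_sqrt_of_sq_le ?_
  linarith

theorem continuous_jap {n : ℕ} : Continuous (jap : Euc n → ℝ) := by
  unfold jap; fun_prop

/-- A function of `(x, θ)` with sufficient decay in `θ` becomes flat along `{r = 0}` under the
substitution `θ = σ / r`. -/
theorem tendsto_iteratedFDeriv_comp_unscale {R : Euc d × Euc s → ℝ} (hR : ContDiff ℝ ∞ R) {n : ℕ}
    (hb : ∀ i : ℕ, ∃ C m : ℝ, ∀ x θ, ‖iteratedFDeriv ℝ i R (x, θ)‖ ≤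
      C * jap x ^ m * jap θ ^ (-((2 * n + 1 : ℕ) : ℝ))) {w₀ : Euc d × Euc s} (hw₀ : w₀.2 ≠ 0) :
    Tendsto (fun p => ‖iteratedFDeriv ℝ n (fun p => p.2 * R (unscale p)) p‖)
      (𝓝[upper (Euc d × Euc s)] (w₀, 0)) (𝓝 0) := by
  choose C m hC using hb
  obtain ⟨K, hK1, hK⟩ := exists_bound_iteratedFDeriv_unscale w₀ n
  have hlt : ∀ᶠ p in 𝓝[upper (Euc d × Euc s)] (w₀, 0), p.2 < 1 :=
    (continuous_snd.continuousAt.eventually (gt_mem_nhds (by simp))).filter_mono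
      nhdsWithin_le_nhds
  set c := ‖w₀.2‖ / 2 with hc
  have hc0 : 0 < c := by have := norm_pos_iff.2 hw₀; positivity
  have hσ : ∀ᶠ p in 𝓝[upper (Euc d × Euc s)] (w₀, 0), c < ‖p.1.2‖ := by
    have : Continuous fun p : (Euc d × Euc s) × ℝ => ‖p.1.2‖ := by fun_prop
    refine (this.continuousAt.eventually (lt_mem_nhds ?_)).filter_mono nhdsWithin_le_nhds
    have := norm_pos_iff.2 hw₀
    change c < ‖w₀.2‖
    linarith
  let J : ℕ → ℝ := fun i => jap w₀.1 ^ m i + 1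
  have hJ : ∀ᶠ p in 𝓝[upper (Euc d × Euc s)] (w₀, 0), ∀ i ∈ Finset.range (n + 1),
      jap p.1.1 ^ m i < J i := by
    rw [Finset.eventually_all]
    intro i _
    have : ContinuousAt (fun p : (Euc d × Euc s) × ℝ => jap p.1.1 ^ m i) (w₀, 0) :=
      ((continuous_jap.comp continuous_fst.fst).continuousAt).rpow_const
        (Or.inl (jap_pos _).ne')
    exact (this.eventually (gt_mem_nhds (lt_add_one _))).filter_mono nhdsWithin_le_nhds
  let T : ℝ := ∑ i ∈ Finset.range (n + 1), |C i| * |J i|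
  have hT : 0 ≤ T := Finset.sum_nonneg fun i _ => by positivity
  -- derivatives of `R ∘ unscale`
  have hu : ∀ j ≤ n, Tendsto (fun p => ‖iteratedFDeriv ℝ j (R ∘ unscale) p‖)
      (𝓝[upper (Euc d × Euc s)] (w₀, 0)) (𝓝 0) := by
    intro j hj
    have hz : Tendsto (fun p : (Euc d × Euc s) × ℝ =>
        (j.factorial * (T * c⁻¹ ^ (2 * n + 1)) * K ^ j) * p.2)
        (𝓝[upper (Euc d × Euc s)] (w₀, 0)) (𝓝 0) := by
      refine Tendsto.mono_left ?_ nhdsWithin_le_nhds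
      exact (by fun_prop : Continuous fun p : (Euc d × Euc s) × ℝ =>
        (j.factorial * (T * c⁻¹ ^ (2 * n + 1)) * K ^ j) * p.2).tendsto' _ _ (by simp)
    refine squeeze_zero' (Eventually.of_forall fun _ => norm_nonneg _) ?_ hz
    filter_upwards [hK, hlt, hσ, hJ, self_mem_nhdsWithin] with p hp1 hp2 hp3 hp4 hp5
    have hr : 0 < p.2 := hp5
    have hri : 1 ≤ p.2⁻¹ := (one_le_inv₀ hr).2 hp2.le
    have hjap : jap (p.2⁻¹ • p.1.2) ^ (-((2 * n + 1 : ℕ) : ℝ)) ≤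
        c⁻¹ ^ (2 * n + 1) * p.2 ^ (2 * n + 1) := by
      rw [Real.rpow_neg (jap_pos _).le, Real.rpow_natCast, ← mul_pow, ← inv_pow]
      have h1 : c * p.2⁻¹ ≤ jap (p.2⁻¹ • p.1.2) := by
        refine le_trans ?_ (norm_le_jap _)
        rw [norm_smul, Real.norm_of_nonneg (inv_nonneg.2 hr.le), mul_comm]
        gcongr
      have h2 : 0 < c * p.2⁻¹ := by positivity
      have h3 : c⁻¹ * p.2 = (c * p.2⁻¹)⁻¹ := by rw [mul_inv, inv_inv]
      rw [h3]
      gcongr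
      exact inv_nonneg.2 (jap_pos _).le
    have hRb : ∀ i ≤ j, ‖iteratedFDerivWithin ℝ i R univ (unscale p)‖ ≤
        T * c⁻¹ ^ (2 * n + 1) * p.2 ^ (2 * n + 1) := by
      intro i hi
      have hi' : i ∈ Finset.range (n + 1) := Finset.mem_range.2 (by omega)
      rw [iteratedFDerivWithin_univ]
      refine (hC i _ _).trans ?_
      have h1 : |C i| * |J i| ≤ T :=
        Finset.single_le_sum (f := fun i => |C i| * |J i|) (fun i _ => by positivity) hi'
      have h2 : (0 : ℝ) ≤ jap p.1.1 ^ m i := Real.rpow_nonneg (jap_pos _).le _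
      have h3 : (0 : ℝ) ≤ jap (p.2⁻¹ • p.1.2) ^ (-((2 * n + 1 : ℕ) : ℝ)) :=
        Real.rpow_nonneg (jap_pos _).le _
      calc C i * jap p.1.1 ^ m i * jap (p.2⁻¹ • p.1.2) ^ (-((2 * n + 1 : ℕ) : ℝ))
          ≤ |C i| * |J i| * (c⁻¹ ^ (2 * n + 1) * p.2 ^ (2 * n + 1)) := by
            gcongr
            · exact le_abs_self _
            · exact (hp4 i hi').le.trans (le_abs_self _)
        _ ≤ T * (c⁻¹ ^ (2 * n + 1) * p.2 ^ (2 * n + 1)) := by gcongr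
        _ = _ := by ring
    have hub : ∀ i, 1 ≤ i → i ≤ j →
        ‖iteratedFDerivWithin ℝ i (unscale (d := d) (s := s)) (upper _) p‖ ≤
          (K * p.2⁻¹ ^ 2) ^ i := by
      intro i hi hij
      rw [iteratedFDerivWithin_of_isOpen _ isOpen_upper hp5]
      refine (hp1 i (hij.trans hj)).trans ?_
      rw [mul_pow, ← pow_mul]
      gcongr
      · exact le_self_pow₀ hK1 (by omega)
      omega
    have h1 := norm_iteratedFDerivWithin_comp_le (N := ∞) (n := j) hR.contDiffOn
      contDiffOn_unscale (by exact_mod_cast le_top) uniqueDiffOn_univ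
      isOpen_upper.uniqueDiffOn (mapsTo_univ _ _) hp5 hRb hub
    rw [iteratedFDerivWithin_of_isOpen _ isOpen_upper hp5] at h1
    refine h1.trans ?_
    have h2 : p.2 ^ (2 * n + 1) * (p.2⁻¹ ^ 2) ^ j ≤ p.2 := by
      rw [← pow_mul]
      have : p.2 ^ (2 * n + 1) = p.2 ^ (2 * j) * p.2 ^ (2 * (n - j) + 1) := by
        rw [← pow_add]; congr 1; omega
      rw [this, mul_right_comm, ← mul_pow, mul_inv_cancel₀ hr.ne', one_pow, one_mul]
      exact pow_le_of_le_one hr.le hp2.le (by omega)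
    calc j.factorial * (T * c⁻¹ ^ (2 * n + 1) * p.2 ^ (2 * n + 1)) * (K * p.2⁻¹ ^ 2) ^ j
        = (j.factorial * (T * c⁻¹ ^ (2 * n + 1)) * K ^ j) *
            (p.2 ^ (2 * n + 1) * (p.2⁻¹ ^ 2) ^ j) := by rw [mul_pow]; ring
      _ ≤ _ := by gcongr
  -- the factor `r` is harmless
  have hz : Tendsto (fun p : (Euc d × Euc s) × ℝ => ∑ i ∈ Finset.range (n + 1),
      (n.choose i : ℝ) * ‖iteratedFDeriv ℝ i (Prod.snd : (Euc d × Euc s) × ℝ → ℝ) p‖ *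
        ‖iteratedFDeriv ℝ (n - i) (R ∘ unscale) p‖)
      (𝓝[upper (Euc d × Euc s)] (w₀, 0)) (𝓝 0) := by
    have h0 : ∑ i ∈ Finset.range (n + 1), (n.choose i : ℝ) *
      ‖iteratedFDeriv ℝ i (Prod.snd : (Euc d × Euc s) × ℝ → ℝ) (w₀, 0)‖ * 0 = 0 := by simp
    refine (tendsto_finsetSum _ fun i _ => Tendsto.mul (Tendsto.mul tendsto_const_nhds ?_)
      (hu (n - i) (Nat.sub_le n i))).trans (congrArg 𝓝 h0).le
    have : Continuous (iteratedFDeriv ℝ i (Prod.snd : (Euc d × Euc s) × ℝ → ℝ)) :=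
      contDiff_snd.continuous_iteratedFDeriv (m := i) (n := ∞) (by exact_mod_cast le_top)
    exact (this.norm.tendsto _).mono_left nhdsWithin_le_nhds
  refine squeeze_zero' (Eventually.of_forall fun _ => norm_nonneg _) ?_ hz
  filter_upwards [self_mem_nhdsWithin] with p hp
  have h1 := norm_iteratedFDerivWithin_mul_le (N := ∞) (n := n)
    (f := (Prod.snd : (Euc d × Euc s) × ℝ → ℝ)) (g := R ∘ unscale) contDiff_snd.contDiffOn
    (hR.comp_contDiffOn contDiffOn_unscale) isOpen_upper.uniqueDiffOn hp
    (by exact_mod_cast le_top)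
  simpa only [iteratedFDerivWithin_of_isOpen _ isOpen_upper hp] using! h1

/-- Functions that are polyhomogeneous of degree `1` in the second variable, in terms of bounds on
their joint derivatives that are locally uniform in the first variable. -/
structure PolyTheta (a : Euc d × Euc s → ℝ) : Prop where
  smooth : ContDiff ℝ ∞ a
  expansion : ∃ (χ : Euc s → ℝ) (b : ℕ → Euc d × Euc s → ℝ),
    (∃ R : ℝ, ∀ θ, R ≤ ‖θ‖ → χ θ = 1) ∧ (∀ k : ℕ, IsHomTheta (1 - (k : ℝ)) (b k)) ∧
    ∀ N : ℕ, ContDiff ℝ ∞ (fun p => a p - ∑ k ∈ Finset.range N, χ p.2 * b k p) ∧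
      ∀ n : ℕ, ∃ C m : ℝ, ∀ x θ,
        ‖iteratedFDeriv ℝ n (fun p => a p - ∑ k ∈ Finset.range N, χ p.2 * b k p) (x, θ)‖ ≤
          C * jap x ^ m * jap θ ^ (1 - (N : ℝ))

theorem IsClassicalTheta.polyTheta {me : ℝ} {a : Euc d × Euc s → ℝ}
    (ha : IsClassicalTheta me 1 a) : PolyTheta a := by
  obtain ⟨h1, χ, b, hχ, hb, hN⟩ := ha
  refine ⟨h1.smooth, χ, b, hχ.one_far, hb, fun N => ⟨(hN N).smooth, fun n => ?_⟩⟩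
  obtain ⟨C, hC⟩ := (hN N).exists_joint_bound n
  exact ⟨C, me, hC⟩

theorem IsHomX.swap {m : ℝ} {b : Euc d × Euc s → ℝ} (hb : IsHomX m b) :
    IsHomTheta m (fun p : Euc s × Euc d => b p.swap) := by
  refine ⟨hb.1.comp (contDiff_snd.prodMk contDiff_fst).contDiffOn fun p hp => hp,
    fun t ht x θ hθ => hb.2 t ht θ x hθ⟩

theorem IsHomTheta.swap {m : ℝ} {b : Euc d × Euc s → ℝ} (hb : IsHomTheta m b) :
    IsHomX m (fun p : Euc s × Euc d => b p.swap) := by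
  refine ⟨hb.1.comp (contDiff_snd.prodMk contDiff_fst).contDiffOn fun p hp => hp,
    fun t ht x θ hθ => hb.2 t ht θ x hθ⟩

theorem IsClassicalX.polyTheta_swap {mψ : ℝ} {a : Euc d × Euc s → ℝ}
    (ha : IsClassicalX 1 mψ a) : PolyTheta (fun p : Euc s × Euc d => a p.swap) := by
  obtain ⟨h1, χ, b, hχ, hb, hN⟩ := ha
  have hsw : ContDiff ℝ ∞ (Prod.swap : Euc s × Euc d → Euc d × Euc s) :=
    contDiff_snd.prodMk contDiff_fst
  refine ⟨h1.smooth.comp hsw, χ, fun k p => b k p.swap, hχ.one_far, fun k => (hb k).swap,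
    fun N => ⟨(hN N).smooth.comp hsw, fun n => ?_⟩⟩
  obtain ⟨C, hC⟩ := (hN N).exists_joint_bound n
  refine ⟨C, mψ, fun x θ => ?_⟩
  let e : Euc s × Euc d ≃ₗᵢ[ℝ] Euc d × Euc s :=
    { LinearEquiv.prodComm ℝ (Euc s) (Euc d) with
      norm_map' := fun p => by simp [Prod.norm_def, max_comm] }
  have := e.norm_iteratedFDeriv_comp_right
    (fun p => a p - ∑ j ∈ Finset.range N, χ p.1 * b j p) (x, θ) n
  refine (le_of_eq this).trans ((hC θ x).trans (le_of_eq ?_))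
  ring

theorem IsHomTheta.mul_eq {b : Euc d × Euc s → ℝ} {k : ℕ} (hb : IsHomTheta (1 - (k : ℝ)) b)
    {x : Euc d} {σ : Euc s} (hσ : σ ≠ 0) {r : ℝ} (hr : 0 < r) :
    r * b (x, r⁻¹ • σ) = r ^ k * b (x, σ) := by
  rw [hb.2 _ (inv_pos.2 hr) x σ hσ, ← mul_assoc]
  congr 1
  rw [Real.inv_rpow hr.le, ← Real.rpow_neg hr.le, neg_sub, Real.rpow_sub hr, Real.rpow_natCast,
    Real.rpow_one]
  field_simp

/-- If `a` is polyhomogeneous of degree `1` in `θ`, then `r a(x, σ / r)` extends smoothly across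
`{r = 0, σ ≠ 0}`: Borel summation gives a smooth function with the right Taylor coefficients, and
the difference is flat. -/
theorem PolyTheta.exists_extension_zero {a : Euc d × Euc s → ℝ} (ha : PolyTheta a)
    {w₀ : Euc d × Euc s} (hw₀ : w₀.2 ≠ 0) :
    ∃ B : (Euc d × Euc s) × ℝ → ℝ, SmoothNear B (w₀, 0) ∧
      ∀ᶠ p in 𝓝 (w₀, 0), 0 < p.2 → B p = p.2 * a (unscale p) := by
  obtain ⟨has, χ, b, ⟨R, hR⟩, hb, hN⟩ := ha
  have hpos := norm_pos_iff.2 hw₀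
  let η : ContDiffBump w₀ := ⟨‖w₀.2‖ / 4, ‖w₀.2‖ / 2, by positivity, by linarith⟩
  have hne : ∀ w ∈ closedBall w₀ (‖w₀.2‖ / 2), w.2 ≠ 0 := by
    intro w hw h0
    rw [mem_closedBall, dist_eq_norm] at hw
    have := (norm_snd_le (w - w₀)).trans hw
    rw [Prod.snd_sub, h0, zero_sub, norm_neg] at this
    linarith
  let g : ℕ → Euc d × Euc s → ℝ := fun k w => η w * b k w
  have hg : ∀ k, ContDiff ℝ ∞ (g k) := by
    intro k
    rw [contDiff_iff_contDiffAt]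
    intro w
    by_cases hw : w ∈ closedBall w₀ (‖w₀.2‖ / 2)
    · refine η.contDiff.contDiffAt.mul ((hb k).1.contDiffAt ?_)
      exact (isOpen_ne_fun continuous_snd continuous_const).mem_nhds (hne w hw)
    · have : g k =ᶠ[𝓝 w] fun _ => 0 := by
        filter_upwards [isClosed_closedBall.isOpen_compl.mem_nhds hw] with z hz
        have : η z = 0 := by
          refine η.zero_of_le_dist ?_
          have : ¬ dist z w₀ ≤ ‖w₀.2‖ / 2 := hz
          exact (not_le.1 this).le
        simp [g, this]
      exact contDiffAt_const.congr_of_eventuallyEq this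
  have hgc : ∀ k, HasCompactSupport (g k) := fun k => η.hasCompactSupport.mul_right
  obtain ⟨B, hB, hBN⟩ := exists_borel_sum hg hgc
  let U : Set ((Euc d × Euc s) × ℝ) := ball w₀ (‖w₀.2‖ / 4) ×ˢ univ
  have hU : IsOpen U := isOpen_ball.prod isOpen_univ
  have hη : ∀ w ∈ ball w₀ (‖w₀.2‖ / 4), η w = 1 := fun w hw =>
    η.one_of_mem_closedBall (ball_subset_closedBall hw)
  have hUne : ∀ w ∈ ball w₀ (‖w₀.2‖ / 4), w.2 ≠ 0 := fun w hw =>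
    hne w (closedBall_subset_closedBall (by linarith) (ball_subset_closedBall hw))
  let h : (Euc d × Euc s) × ℝ → ℝ := fun p => p.2 * a (unscale p) - B p
  have hhs : ContDiffOn ℝ ∞ h (U ∩ upper _) := by
    refine ContDiffOn.mono (t := U ∩ upper _) (s := upper _) ?_ inter_subset_right
    exact (contDiff_snd.contDiffOn.mul (has.comp_contDiffOn contDiffOn_unscale)).sub
      hB.contDiffOn
  have hflat : ∀ n : ℕ, ∀ p ∈ U, p.2 = 0 →
      Tendsto (fun y => ‖iteratedFDeriv ℝ n h y‖) (𝓝[upper _] p) (𝓝 0) := by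
    rintro n ⟨w, r⟩ hp rfl
    have hw : w ∈ ball w₀ (‖w₀.2‖ / 4) := hp.1
    -- the remainder of order `N = 2n + 2`
    let N := 2 * n + 2
    let Rm : Euc d × Euc s → ℝ := fun p => a p - ∑ k ∈ Finset.range N, χ p.2 * b k p
    have hRm : ContDiff ℝ ∞ Rm := (hN N).1
    have h1 := tendsto_iteratedFDeriv_comp_unscale hRm (n := n) (w₀ := w) (by
      intro i
      obtain ⟨C, m, hC⟩ := (hN N).2 i
      refine ⟨C, m, fun x θ => ?_⟩
      have := hC x θ
      rw [show (1 : ℝ) - (N : ℝ) = -((2 * n + 1 : ℕ) : ℝ) by simp [N]; ring] at this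
      exact this) (hUne w hw)
    let Pm : (Euc d × Euc s) × ℝ → ℝ := fun p => B p - ∑ k ∈ Finset.range N, p.2 ^ k * g k p.1
    have hPm : ContDiff ℝ ∞ Pm := hB.sub (ContDiff.sum fun k _ =>
      (contDiff_snd.pow k).mul ((hg k).comp contDiff_fst))
    have h2 : Tendsto (fun p => ‖iteratedFDeriv ℝ n Pm p‖) (𝓝[upper _] (w, 0)) (𝓝 0) := by
      have hc : Continuous (iteratedFDeriv ℝ n Pm) :=
        hPm.continuous_iteratedFDeriv (m := n) (by exact_mod_cast le_top)
      have := (hc.norm.tendsto (w, 0)).mono_left (nhdsWithin_le_nhds (s := upper _))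
      rwa [hBN N n (by omega) w, norm_zero] at this
    have h12 := h1.add h2
    rw [add_zero] at h12
    refine squeeze_zero' (Eventually.of_forall fun _ => norm_nonneg _) ?_ h12
    have hev : ∀ᶠ p in 𝓝 (w, (0 : ℝ)), p ∈ U ∧ p.2 * R < ‖p.1.2‖ := by
      refine (hU.eventually_mem hp).and ?_
      have hc : Continuous fun p : (Euc d × Euc s) × ℝ => ‖p.1.2‖ - p.2 * R := by fun_prop
      have : 0 < ‖w.2‖ - 0 * R := by simpa using hUne w hw
      filter_upwards [hc.continuousAt.eventually (lt_mem_nhds this)] with p hp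
      linarith
    have hev2 := (eventually_eventually_nhds.2 hev).filter_mono
      (nhdsWithin_le_nhds (s := upper (Euc d × Euc s)))
    filter_upwards [hev2, self_mem_nhdsWithin] with p hp1 hp2
    have heq : h =ᶠ[𝓝 p] fun y => y.2 * Rm (unscale y) - Pm y := by
      filter_upwards [hp1, isOpen_upper.mem_nhds hp2] with y hy1 hy2
      have hr : 0 < y.2 := hy2
      have hχ : χ (unscale y).2 = 1 := by
        refine hR _ ?_
        change R ≤ ‖y.2⁻¹ • y.1.2‖
        rw [norm_smul, Real.norm_of_nonneg (inv_nonneg.2 hr.le), ← div_eq_inv_mul,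
          le_div_iff₀ hr, mul_comm]
        exact hy1.2.le
      have hk : ∀ k, y.2 * (χ (unscale y).2 * b k (unscale y)) = y.2 ^ k * g k y.1 := by
        intro k
        rw [hχ, one_mul]
        simp only [g]
        rw [hη _ hy1.1.1, one_mul]
        exact (hb k).mul_eq (hUne _ hy1.1.1) hr
      simp only [h, Rm, Pm, mul_sub, Finset.mul_sum, hk]
      ring
    rw [heq.iteratedFDeriv ℝ n |>.eq_of_nhds]
    have hn' : (n : ℕ∞ω) ≤ ∞ := by exact_mod_cast le_top
    have c1 : ContDiffAt ℝ n (fun y : (Euc d × Euc s) × ℝ => y.2 * Rm (unscale y)) p :=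
      (contDiffAt_snd.mul (hRm.contDiffAt.comp p (contDiffAt_unscale hp2))).of_le hn'
    have h3 := iteratedFDeriv_sub_apply c1 (hPm.of_le hn').contDiffAt
    refine (le_of_eq (congrArg norm h3)).trans (norm_sub_le _ _)
  have hE := contDiffOn_extend_zero hU hhs hflat
  have hUmem : U ∈ 𝓝 (w₀, (0 : ℝ)) :=
    hU.mem_nhds ⟨mem_ball_self (by positivity), mem_univ _⟩
  refine ⟨fun p => B p + (upper _).indicator h p, ?_, ?_⟩
  · filter_upwards [hU.mem_nhds (mem_of_mem_nhds hUmem)] with p hp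
    exact hB.contDiffAt.add (hE.contDiffAt (hU.mem_nhds hp))
  · refine Eventually.of_forall fun p hp => ?_
    have : p ∈ upper (Euc d × Euc s) := hp
    change B p + (upper _).indicator h p = _
    rw [indicator_of_mem this]
    simp [h]

/-- `r a(x, σ / r)` extends smoothly to the closed half-space `{r ≥ 0}` and beyond. -/
theorem PolyTheta.exists_extension {a : Euc d × Euc s → ℝ} (ha : PolyTheta a) (x₀ : Euc d)
    {P₀ : Euc s × ℝ} (hP₀ : 0 < P₀.2 ∨ (P₀.2 = 0 ∧ P₀.1 ≠ 0)) :
    ∃ B : Euc d × (Euc s × ℝ) → ℝ, SmoothNear B (x₀, P₀) ∧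
      ∀ᶠ p in 𝓝 (x₀, P₀), 0 < p.2.2 → B p = p.2.2 * a (p.1, p.2.2⁻¹ • p.2.1) := by
  have hassoc : ContDiff ℝ ∞ fun p : Euc d × (Euc s × ℝ) => ((p.1, p.2.1), p.2.2) :=
    (contDiff_fst.prodMk contDiff_snd.fst).prodMk contDiff_snd.snd
  rcases hP₀ with h | ⟨h, h'⟩
  · refine ⟨fun p => p.2.2 * a (p.1, p.2.2⁻¹ • p.2.1), ?_, Eventually.of_forall fun p _ => rfl⟩
    have hc : Continuous fun p : Euc d × (Euc s × ℝ) => p.2.2 := by fun_prop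
    filter_upwards [hc.continuousAt.eventually (lt_mem_nhds h)] with p hp
    refine contDiffAt_snd.snd.mul (ha.smooth.contDiffAt.comp p ?_)
    exact contDiffAt_fst.prodMk ((contDiffAt_snd.snd.inv hp.ne').smul contDiffAt_snd.fst)
  · obtain ⟨σ₀, r₀⟩ := P₀
    obtain rfl : r₀ = 0 := h
    obtain ⟨B, hB, hBa⟩ := ha.exists_extension_zero (w₀ := (x₀, σ₀)) h'
    refine ⟨fun p => B ((p.1, p.2.1), p.2.2), SmoothNear.comp (g := B) hB (hassoc.smoothNear _), ?_⟩
    exact (hassoc.continuous.tendsto' (x₀, (σ₀, (0 : ℝ))) ((x₀, σ₀), 0) rfl).eventually hBa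

end Poly

/-! ### Homogeneous coordinates for the radial compactification -/

/-- If `f` is the identity up to a scalar function, then the kernel of its differential is at most
radial; the scalar function need not be differentiable. -/
theorem exists_eq_smul_of_fderiv_eq_zero {E : Type*} [NormedAddCommGroup E] [NormedSpace ℝ E]
    {f : E → E} {f' : E →L[ℝ] E} {P : E} {m : E → ℝ} (hP : P ≠ 0) (hm : m P ≠ 0)
    (hf : ∀ᶠ Q in 𝓝 P, f Q = m Q • Q) (hf' : HasFDerivAt f f' P) {v : E} (hv : f' v = 0) :
    ∃ c : ℝ, v = c • P := by
  obtain ⟨ℓ, -, hℓ⟩ := exists_dual_vector ℝ P (norm_ne_zero_iff.2 hP)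
  have hℓ0 : ℓ P ≠ 0 := by rw [hℓ]; simpa using hP
  have h1 := (ℓ.hasFDerivAt (x := P)).fun_smul hf'
  have h2 := (ℓ.hasFDerivAt.comp P hf').fun_smul (hasFDerivAt_id P)
  have heq : (fun Q => ℓ Q • f Q) =ᶠ[𝓝 P] fun Q => (ℓ ∘ f) Q • id Q := by
    filter_upwards [hf] with Q hQ
    simp only [Function.comp, hQ, map_smul, smul_eq_mul, id, smul_smul]
    rw [mul_comm]
  have h3 := DFunLike.congr_fun (h1.unique (h2.congr_of_eventuallyEq heq)) v
  simp [hv, hf.self_of_nhds, smul_smul] at h3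
  have h4 : v = (m P * ℓ P)⁻¹ • ((m P * ℓ P) • v) := by
    rw [smul_smul, inv_mul_cancel₀ (mul_ne_zero hm hℓ0), one_smul]
  rw [← h3, smul_smul] at h4
  exact ⟨_, h4⟩

namespace Compactification

variable {n : ℕ} (κ : Compactification n)

theorem invFun_eq {y : Euc n} (h1 : 2 / 3 < ‖y‖) (h2 : ‖y‖ < 1) :
    κ.invFun y = (1 - ‖y‖)⁻¹ • (‖y‖⁻¹ • y) := by
  have hy : 0 < ‖y‖ := by linarith
  have h3 : 0 < 1 - ‖y‖ := by linarith
  set x : Euc n := (1 - ‖y‖)⁻¹ • (‖y‖⁻¹ • y) with hx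
  have hxn : ‖x‖ = (1 - ‖y‖)⁻¹ := by
    rw [hx, norm_smul, norm_smul, norm_inv ‖y‖, norm_norm, inv_mul_cancel₀ hy.ne', mul_one,
      Real.norm_of_nonneg (inv_nonneg.2 h3.le)]
  have hx3 : 3 < ‖x‖ := by
    rw [hxn, lt_inv_comm₀ (by norm_num) h3]
    linarith
  have : κ.toFun x = y := by
    rw [κ.toFun_eq x hx3, hxn, hx]
    simp only [smul_smul]
    rw [show (1 - 1 / (1 - ‖y‖)⁻¹) * ((1 - ‖y‖)⁻¹⁻¹ * ((1 - ‖y‖)⁻¹ * ‖y‖⁻¹)) = 1 by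
      field_simp; ring, one_smul]
  exact (congrArg κ.invFun this).symm.trans (κ.left_inv x)

/-- By hypothesis `1 - h` does not vanish in the open ball; as the ball is connected and
`h(y) = |y|` for `|y| > 2/3`, it is positive. (In dimension `0` there are no such `y`, and the claim
may fail.) -/
theorem h_lt_one (hn : 0 < n) {y : Euc n} (hy : ‖y‖ < 1) : κ.h y < 1 := by
  have hne : ∀ z : Euc n, ‖z‖ < 1 → κ.h z ≠ 1 := by
    intro z hz
    rcases lt_trichotomy ‖z‖ (2 / 3) with h | h | h
    · intro h1
      exact κ.h_ne z h (by rw [h1, sub_self])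
    · -- on the sphere of radius `2/3`, `h` is determined by continuity
      have hc : ContinuousWithinAt κ.h (closedBall 0 1) z :=
        κ.contDiffOn_h.continuousOn z (by simpa using hz.le)
      have hs : Tendsto (fun t : ℝ => t • z) (𝓝[>] 1) (𝓝[closedBall 0 1] z) := by
        refine tendsto_nhdsWithin_iff.2 ⟨?_, ?_⟩
        · have : Continuous fun t : ℝ => t • z := by fun_prop
          exact (this.tendsto' 1 z (one_smul _ _)).mono_left nhdsWithin_le_nhds
        · have : ∀ᶠ t : ℝ in 𝓝[>] 1, t < 3 / 2 :=
            (gt_mem_nhds (by norm_num)).filter_mono nhdsWithin_le_nhds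
          filter_upwards [this, self_mem_nhdsWithin] with t ht ht'
          have ht1 : 1 < t := ht'
          rw [mem_closedBall_zero_iff, norm_smul, Real.norm_of_nonneg (by linarith), h]
          linarith
      have h1 := hc.tendsto.comp hs
      have h2 : Tendsto (fun t : ℝ => t * ‖z‖) (𝓝[>] 1) (𝓝 ‖z‖) := by
        have : Continuous fun t : ℝ => t * ‖z‖ := by fun_prop
        exact (this.tendsto' 1 _ (one_mul _)).mono_left nhdsWithin_le_nhds
      have h3 : κ.h ∘ (fun t : ℝ => t • z) =ᶠ[𝓝[>] 1] fun t => t * ‖z‖ := by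
        have : ∀ᶠ t : ℝ in 𝓝[>] 1, t < 3 / 2 :=
          (gt_mem_nhds (by norm_num)).filter_mono nhdsWithin_le_nhds
        filter_upwards [this, self_mem_nhdsWithin] with t ht ht'
        have ht1 : 1 < t := ht'
        have hn : ‖t • z‖ = t * ‖z‖ := by rw [norm_smul, Real.norm_of_nonneg (by linarith)]
        rw [Function.comp, κ.h_eq _ (by rw [hn, h]; linarith) (by rw [hn, h]; linarith), hn]
      have h4 := tendsto_nhds_unique h1 (h2.congr' h3.symm)
      rw [h4, h]
      norm_num
    · rw [κ.h_eq z h hz.le]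
      exact hz.ne
  by_contra hcon
  rw [not_lt] at hcon
  let e : Euc n := EuclideanSpace.single ⟨0, hn⟩ (5 / 6 : ℝ)
  have he : ‖e‖ = 5 / 6 := by simp [e]
  have hce : κ.h e = 5 / 6 := by rw [κ.h_eq e (by rw [he]; norm_num) (by rw [he]; norm_num), he]
  have hpre : IsPreconnected (ball (0 : Euc n) 1) := (convex_ball _ _).isPreconnected
  have hcont : ContinuousOn κ.h (ball 0 1) :=
    κ.contDiffOn_h.continuousOn.mono ball_subset_closedBall
  obtain ⟨z, hz, hz1⟩ := hpre.intermediate_value (by simp [he]; norm_num : e ∈ ball 0 1)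
    (by simpa using hy : y ∈ ball 0 1) hcont (show (1 : ℝ) ∈ Icc _ _ from
      ⟨by rw [hce]; norm_num, hcon⟩)
  exact hne z (by simpa using hz) hz1

/-- Homogeneous coordinates on `𝔹ⁿ`: the point `y` of the open ball is sent to `(ỹ x, ỹ)` with
`x = ι⁻¹(y)` and `ỹ = 1 - h(y)`. The formula valid near the sphere is used to extend the map to
all of `ℝⁿ`. -/
def lift (y : Euc n) : Euc n × ℝ :=
  open Classical in
  if ‖y‖ < 1 then ((1 - κ.h y) • κ.invFun y, 1 - κ.h y) else (‖y‖⁻¹ • y, 1 - ‖y‖)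

theorem lift_of_lt {y : Euc n} (hy : ‖y‖ < 1) :
    κ.lift y = ((1 - κ.h y) • κ.invFun y, 1 - κ.h y) := if_pos hy

theorem lift_of_two_thirds_lt {y : Euc n} (hy : 2 / 3 < ‖y‖) :
    κ.lift y = (‖y‖⁻¹ • y, 1 - ‖y‖) := by
  by_cases h : ‖y‖ < 1
  · rw [κ.lift_of_lt h, κ.h_eq y hy h.le, κ.invFun_eq hy h, smul_smul,
      mul_inv_cancel₀ (by linarith), one_smul]
  · exact if_neg h

theorem lift_of_norm_eq_one {y : Euc n} (hy : ‖y‖ = 1) : κ.lift y = (y, 0) := by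
  rw [κ.lift_of_two_thirds_lt (by rw [hy]; norm_num), hy]; simp

theorem contDiff_lift : ContDiff ℝ ∞ κ.lift := by
  rw [contDiff_iff_contDiffAt]
  intro y
  by_cases h : ‖y‖ < 1
  · have hb : ball (0 : Euc n) 1 ∈ 𝓝 y := isOpen_ball.mem_nhds (by simpa using h)
    have h1 : ContDiffAt ℝ ∞ κ.h y :=
      κ.contDiffOn_h.contDiffAt (mem_of_superset hb ball_subset_closedBall)
    have h2 : ContDiffAt ℝ ∞ κ.invFun y := κ.contDiffOn_invFun.contDiffAt hb
    have h3 : ContDiffAt ℝ ∞ (fun z => 1 - κ.h z) y := contDiffAt_const.sub h1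
    refine ContDiffAt.congr_of_eventuallyEq ((h3.smul h2).prodMk h3) ?_
    filter_upwards [hb] with z hz
    exact κ.lift_of_lt (by simpa using hz)
  · have hy : 2 / 3 < ‖y‖ := by linarith [not_lt.1 h]
    have hy0 : y ≠ 0 := norm_pos_iff.1 (by linarith)
    have hn : ContDiffAt ℝ ∞ (fun z : Euc n => ‖z‖) y := contDiffAt_norm ℝ hy0
    have h3 : ContDiffAt ℝ ∞ (fun z : Euc n => 1 - ‖z‖) y := contDiffAt_const.sub hn
    refine ContDiffAt.congr_of_eventuallyEq
      (((hn.inv (norm_ne_zero_iff.2 hy0)).smul contDiffAt_id).prodMk h3) ?_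
    filter_upwards [continuous_norm.continuousAt.eventually (lt_mem_nhds hy)] with z hz
    exact κ.lift_of_two_thirds_lt hz

theorem lift_snd_pos (hn : 0 < n) {y : Euc n} (hy : ‖y‖ < 1) : 0 < (κ.lift y).2 := by
  rw [κ.lift_of_lt hy]
  linarith [κ.h_lt_one hn hy]

theorem lift_snd_nonneg_iff (hn : 0 < n) {y : Euc n} : 0 ≤ (κ.lift y).2 ↔ ‖y‖ ≤ 1 := by
  by_cases h : ‖y‖ < 1
  · exact iff_of_true (κ.lift_snd_pos hn h).le h.le
  · rw [κ.lift_of_two_thirds_lt (by linarith [not_lt.1 h])]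
    exact sub_nonneg

theorem lift_snd_eq_zero_iff (hn : 0 < n) {y : Euc n} : (κ.lift y).2 = 0 ↔ ‖y‖ = 1 := by
  by_cases h : ‖y‖ < 1
  · exact iff_of_false (κ.lift_snd_pos hn h).ne' h.ne
  · rw [κ.lift_of_two_thirds_lt (by linarith [not_lt.1 h])]
    change 1 - ‖y‖ = 0 ↔ _
    constructor <;> intro h <;> linarith

theorem lift_snd_pos_iff (hn : 0 < n) {y : Euc n} : 0 < (κ.lift y).2 ↔ ‖y‖ < 1 := by
  refine ⟨fun h => ?_, κ.lift_snd_pos hn⟩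
  refine lt_of_le_of_ne ((κ.lift_snd_nonneg_iff hn).1 h.le) fun h1 => ?_
  rw [(κ.lift_snd_eq_zero_iff hn).2 h1] at h
  exact lt_irrefl _ h

/-- The points of the closed half space `{r ≥ 0}` of `ℝⁿ × ℝ`, with the origin of `{r = 0}`
removed: the homogeneous coordinates of points of `𝔹ⁿ`. -/
def halfSpace (n : ℕ) : Set (Euc n × ℝ) := {P | 0 < P.2 ∨ (P.2 = 0 ∧ P.1 ≠ 0)}

theorem lift_mem_halfSpace (hn : 0 < n) {y : Euc n} (hy : ‖y‖ ≤ 1) : κ.lift y ∈ halfSpace n := by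
  rcases hy.lt_or_eq with h | h
  · exact Or.inl (κ.lift_snd_pos hn h)
  · rw [κ.lift_of_norm_eq_one h]
    exact Or.inr ⟨rfl, norm_pos_iff.1 (by rw [h]; norm_num)⟩

/-- The point of `𝔹ⁿ` with homogeneous coordinates `(G, r)`, that is `ι(G / r)`; the formula valid
for small `r > 0` is used to extend the map to `r ≤ 0`. -/
def proj (P : Euc n × ℝ) : Euc n :=
  open Classical in
  if 0 < P.2 then κ.toFun (P.2⁻¹ • P.1) else (‖P.1‖⁻¹ - P.2 * ‖P.1‖⁻¹ ^ 2) • P.1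

theorem proj_of_pos {P : Euc n × ℝ} (hP : 0 < P.2) : κ.proj P = κ.toFun (P.2⁻¹ • P.1) := if_pos hP

theorem proj_of_lt {P : Euc n × ℝ} (hP : P.1 ≠ 0) (hP' : 3 * P.2 < ‖P.1‖) :
    κ.proj P = (‖P.1‖⁻¹ - P.2 * ‖P.1‖⁻¹ ^ 2) • P.1 := by
  by_cases h : 0 < P.2
  · have hp := norm_pos_iff.2 hP
    have hn : ‖P.2⁻¹ • P.1‖ = P.2⁻¹ * ‖P.1‖ := by
      rw [norm_smul, Real.norm_of_nonneg (inv_nonneg.2 h.le)]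
    rw [κ.proj_of_pos h, κ.toFun_eq _ (by rw [hn, ← div_eq_inv_mul, lt_div_iff₀ h]; exact hP'), hn]
    simp only [smul_smul]
    congr 1
    field_simp
  · exact if_neg h

theorem smoothNear_proj {P : Euc n × ℝ} (hP : P ∈ halfSpace n) : SmoothNear κ.proj P := by
  rcases hP with h | ⟨h, h'⟩
  · have h1 : ∀ᶠ Q in 𝓝 P, 0 < Q.2 := continuous_snd.continuousAt.eventually (lt_mem_nhds h)
    have h2 : SmoothNear (fun Q : Euc n × ℝ => κ.toFun (Q.2⁻¹ • Q.1)) P := by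
      filter_upwards [h1] with Q hQ
      exact κ.contDiff_toFun.contDiffAt.comp Q
        ((contDiffAt_snd.inv hQ.ne').smul contDiffAt_fst)
    refine h2.congr ?_
    filter_upwards [h1] with Q hQ
    exact κ.proj_of_pos hQ
  · have h1 : ∀ᶠ Q : Euc n × ℝ in 𝓝 P, Q.1 ≠ 0 :=
      continuous_fst.continuousAt.eventually (isOpen_ne.mem_nhds h')
    have h1' : ∀ᶠ Q : Euc n × ℝ in 𝓝 P, 0 < ‖Q.1‖ - 3 * Q.2 := by
      have : Continuous fun Q : Euc n × ℝ => ‖Q.1‖ - 3 * Q.2 := by fun_prop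
      refine this.continuousAt.eventually (lt_mem_nhds ?_)
      have := norm_pos_iff.2 h'
      simpa [h] using h'
    have h2 : SmoothNear
        (fun Q : Euc n × ℝ => (‖Q.1‖⁻¹ - Q.2 * ‖Q.1‖⁻¹ ^ 2) • Q.1) P := by
      filter_upwards [h1] with Q hQ
      have hn : ContDiffAt ℝ ∞ (fun Q : Euc n × ℝ => ‖Q.1‖⁻¹) Q :=
        (contDiffAt_fst.norm ℝ hQ).inv (norm_ne_zero_iff.2 hQ)
      exact (hn.sub (contDiffAt_snd.mul (hn.pow 2))).smul contDiffAt_fst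
    refine h2.congr ?_
    filter_upwards [h1, h1'] with Q hQ hQ'
    exact κ.proj_of_lt hQ (by linarith)

theorem proj_lift (hn : 0 < n) (y : Euc n) : κ.proj (κ.lift y) = y := by
  by_cases h : ‖y‖ < 1
  · have hr := κ.lift_snd_pos hn h
    rw [κ.proj_of_pos hr]
    rw [κ.lift_of_lt h] at hr ⊢
    rw [smul_smul, inv_mul_cancel₀ (ne_of_gt hr), one_smul, κ.right_inv y (by simpa using h)]
  · have hy : 0 < ‖y‖ := by linarith [not_lt.1 h]
    rw [κ.lift_of_two_thirds_lt (by linarith [not_lt.1 h])]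
    have hn1 : ‖‖y‖⁻¹ • y‖ = 1 := by
      rw [norm_smul, norm_inv, norm_norm, inv_mul_cancel₀ hy.ne']
    have h0 : ‖y‖⁻¹ • y ≠ 0 := norm_pos_iff.1 (by rw [hn1]; norm_num)
    rw [κ.proj_of_lt h0 (by rw [hn1]; simp only; linarith [not_lt.1 h])]
    simp only [hn1, smul_smul]
    rw [show (1⁻¹ - (1 - ‖y‖) * 1⁻¹ ^ 2) * ‖y‖⁻¹ = 1 by field_simp; ring, one_smul]

theorem norm_proj_lt {P : Euc n × ℝ} (hP : 0 < P.2) : ‖κ.proj P‖ < 1 := by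
  rw [κ.proj_of_pos hP]
  simpa using κ.toFun_mem (P.2⁻¹ • P.1)

theorem norm_proj_eq_one {P : Euc n × ℝ} (hP : P.2 = 0) (hP' : P.1 ≠ 0) : ‖κ.proj P‖ = 1 := by
  rw [κ.proj_of_lt hP' (by rw [hP]; simpa using hP'), hP, zero_mul, sub_zero, norm_smul, norm_inv,
    norm_norm, inv_mul_cancel₀ (norm_ne_zero_iff.2 hP')]

theorem norm_proj_le {P : Euc n × ℝ} (hP : P ∈ halfSpace n) : ‖κ.proj P‖ ≤ 1 := by
  rcases hP with h | ⟨h, h'⟩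
  · exact (κ.norm_proj_lt h).le
  · exact (κ.norm_proj_eq_one h h').le

/-- Homogeneous coordinates are unique up to a positive factor. -/
theorem exists_lift_proj_eq (hn : 0 < n) {P : Euc n × ℝ} (hP : P ∈ halfSpace n) :
    ∃ m : Euc n × ℝ → ℝ, ContinuousAt m P ∧ 0 < m P ∧
      ∀ᶠ Q in 𝓝 P, κ.lift (κ.proj Q) = m Q • Q := by
  have hP0 : P ≠ 0 := by
    rintro rfl
    rcases hP with h | ⟨-, h⟩
    · exact lt_irrefl _ h
    · exact h rfl
  have key : ∀ᶠ Q in 𝓝 P, ∃ c : ℝ, 0 < c ∧ κ.lift (κ.proj Q) = c • Q := by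
    rcases hP with h | ⟨h, h'⟩
    · filter_upwards [continuous_snd.continuousAt.eventually (lt_mem_nhds h)] with Q hQ
      have h1 := κ.norm_proj_lt hQ
      have h2 := κ.h_lt_one hn h1
      refine ⟨(1 - κ.h (κ.proj Q)) * Q.2⁻¹, mul_pos (by linarith) (inv_pos.2 hQ), ?_⟩
      rw [κ.lift_of_lt h1]
      refine Prod.ext ?_ ?_
      · change _ = _ • Q.1
        rw [mul_smul, κ.proj_of_pos hQ, κ.left_inv]
      · change _ = _ * Q.2
        rw [mul_assoc, inv_mul_cancel₀ hQ.ne', mul_one]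
    · have h1 : ∀ᶠ Q : Euc n × ℝ in 𝓝 P, Q.1 ≠ 0 :=
        continuous_fst.continuousAt.eventually (isOpen_ne.mem_nhds h')
      have h2 : ∀ᶠ Q : Euc n × ℝ in 𝓝 P, 0 < ‖Q.1‖ - 3 * Q.2 := by
        have : Continuous fun Q : Euc n × ℝ => ‖Q.1‖ - 3 * Q.2 := by fun_prop
        refine this.continuousAt.eventually (lt_mem_nhds ?_)
        simpa [h] using h'
      filter_upwards [h1, h2] with Q hQ hQ'
      have hp := norm_pos_iff.2 hQ
      refine ⟨‖Q.1‖⁻¹, inv_pos.2 hp, ?_⟩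
      rw [κ.proj_of_lt hQ (by linarith)]
      have hc : 2 / 3 < 1 - Q.2 * ‖Q.1‖⁻¹ := by
        rw [← div_eq_mul_inv]
        have : Q.2 / ‖Q.1‖ < 1 / 3 := by rw [div_lt_iff₀ hp]; linarith
        linarith
      have hnorm : ‖(‖Q.1‖⁻¹ - Q.2 * ‖Q.1‖⁻¹ ^ 2) • Q.1‖ = 1 - Q.2 * ‖Q.1‖⁻¹ := by
        rw [norm_smul, show ‖Q.1‖⁻¹ - Q.2 * ‖Q.1‖⁻¹ ^ 2 = (1 - Q.2 * ‖Q.1‖⁻¹) * ‖Q.1‖⁻¹ by ring,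
          norm_mul, norm_inv, norm_norm, mul_assoc, inv_mul_cancel₀ hp.ne', mul_one,
          Real.norm_of_nonneg (by linarith)]
      rw [κ.lift_of_two_thirds_lt (by rw [hnorm]; exact hc), hnorm]
      refine Prod.ext ?_ ?_
      · change _ • _ • Q.1 = _ • Q.1
        rw [smul_smul]
        congr 1
        have : 1 - Q.2 * ‖Q.1‖⁻¹ ≠ 0 := by linarith
        rw [show ‖Q.1‖⁻¹ - Q.2 * ‖Q.1‖⁻¹ ^ 2 = (1 - Q.2 * ‖Q.1‖⁻¹) * ‖Q.1‖⁻¹ by ring, ← mul_assoc,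
          inv_mul_cancel₀ this, one_mul]
      · change _ = ‖Q.1‖⁻¹ * Q.2
        ring
  have hnorm : ∀ᶠ Q in 𝓝 P, κ.lift (κ.proj Q) = (‖κ.lift (κ.proj Q)‖ / ‖Q‖) • Q := by
    filter_upwards [key, isOpen_ne.mem_nhds hP0] with Q hQ hQ0
    obtain ⟨c, hc, hQc⟩ := hQ
    rw [hQc, norm_smul, Real.norm_of_nonneg hc.le, mul_div_cancel_right₀ _ (norm_ne_zero_iff.2 hQ0)]
  refine ⟨fun Q => ‖κ.lift (κ.proj Q)‖ / ‖Q‖, ?_, ?_, hnorm⟩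
  · refine ContinuousAt.div ?_ continuous_norm.continuousAt (norm_ne_zero_iff.2 hP0)
    exact (κ.contDiff_lift.continuous.continuousAt.comp (κ.smoothNear_proj hP).continuousAt).norm
  · obtain ⟨c, hc, hPc⟩ := key.self_of_nhds
    have : 0 < ‖κ.lift (κ.proj P)‖ := by
      rw [hPc, norm_smul]
      exact mul_pos (norm_pos_iff.2 hc.ne') (norm_pos_iff.2 hP0)
    exact div_pos this (norm_pos_iff.2 hP0)

/-- The kernel of the differential of `proj` is spanned by the radial direction. -/
theorem eq_smul_of_fderiv_proj_eq_zero (hn : 0 < n) {P : Euc n × ℝ} (hP : P ∈ halfSpace n)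
    {v : Euc n × ℝ} (hv : fderiv ℝ κ.proj P v = 0) : ∃ c : ℝ, v = c • P := by
  obtain ⟨m, -, hm, hmP⟩ := κ.exists_lift_proj_eq hn hP
  have hP0 : P ≠ 0 := by
    rintro rfl
    rcases hP with h | ⟨-, h⟩
    · exact lt_irrefl _ h
    · exact h rfl
  exact exists_eq_smul_of_fderiv_eq_zero hP0 hm.ne' hmP
    ((κ.contDiff_lift.differentiable (by simp) _).hasFDerivAt.comp P
      (κ.smoothNear_proj hP).hasFDerivAt) (by simp [hv])

theorem smoothNear_lift (y : Euc n) : SmoothNear κ.lift y := κ.contDiff_lift.smoothNear y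

/-- The boundary defining function `ỹ` has a non-zero differential along the sphere. -/
theorem fderiv_lift_snd_self {y : Euc n} (hy : ‖y‖ = 1) :
    fderiv ℝ (fun z => (κ.lift z).2) y y = -1 := by
  have hd : HasFDerivAt (fun z => (κ.lift z).2) (fderiv ℝ (fun z => (κ.lift z).2) y) y :=
    (κ.contDiff_lift.snd.differentiable (by simp) y).hasFDerivAt
  have hd' : HasFDerivAt (fun z => (κ.lift z).2) (fderiv ℝ (fun z => (κ.lift z).2) y)
      ((1 : ℝ) • y) := by rwa [one_smul]
  have hc : HasDerivAt (fun t : ℝ => t • y) y 1 := by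
    simpa using (hasDerivAt_id (1 : ℝ)).smul_const y
  have h1 := hd'.comp_hasDerivAt (1 : ℝ) hc
  have h2 : HasDerivAt (fun t : ℝ => 1 - t) (-1) 1 := by
    simpa using (hasDerivAt_id (1 : ℝ)).const_sub 1
  refine h1.unique (h2.congr_of_eventuallyEq ?_)
  filter_upwards [lt_mem_nhds (show (2 / 3 : ℝ) < 1 by norm_num)] with t ht
  have hn : ‖t • y‖ = t := by rw [norm_smul, hy, mul_one, Real.norm_of_nonneg (by linarith)]
  rw [Function.comp, κ.lift_of_two_thirds_lt (by rw [hn]; exact ht), hn]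

end Compactification

/-! ### The rescaled differential of a phase function -/

section Covector

variable {d s : ℕ}

/-- Pairs of homogeneous coordinates `((ω, ρ), (σ, r))` of points of `𝔹ᵈ × 𝔹ˢ`; the point with
`ρ, r > 0` stands for `(x, θ) = (ω / ρ, σ / r)`. -/
abbrev HomCoord (d s : ℕ) : Type := (Euc d × ℝ) × (Euc s × ℝ)

/-- The homogeneous coordinates of interior points. -/
def interiorCoord (d s : ℕ) : Set (HomCoord d s) := {P | 0 < P.1.2 ∧ 0 < P.2.2}

/-- The embedding `(u, w) ↦ ((u, 0), (w, 0))`. -/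
def horizontal (d s : ℕ) : Euc d × Euc s →L[ℝ] HomCoord d s :=
  ((ContinuousLinearMap.inl ℝ (Euc d) ℝ).comp (ContinuousLinearMap.fst ℝ _ _)).prod
    ((ContinuousLinearMap.inl ℝ (Euc s) ℝ).comp (ContinuousLinearMap.snd ℝ _ _))

@[simp] theorem horizontal_apply (v : Euc d × Euc s) :
    horizontal d s v = ((v.1, 0), (v.2, 0)) := rfl

/-- `(u, w) ↦ (a u, b w)`. -/
def diagScale (d s : ℕ) (a b : ℝ) : Euc d × Euc s →L[ℝ] Euc d × Euc s :=
  (a • ContinuousLinearMap.fst ℝ _ _).prod (b • ContinuousLinearMap.snd ℝ _ _)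

@[simp] theorem diagScale_apply (a b : ℝ) (v : Euc d × Euc s) :
    diagScale d s a b v = (a • v.1, b • v.2) := rfl

/-- `((ω, ρ), (σ, r)) ↦ (ω / ρ, σ / r)`. -/
def dehomog (P : HomCoord d s) : Euc d × Euc s := (P.1.2⁻¹ • P.1.1, P.2.2⁻¹ • P.2.1)

/-- The rescaled differential `(u, w) ↦ r ∂ₓφ(ω/ρ, σ/r) u + ρ ∂_θφ(ω/ρ, σ/r) w`. -/
def covec (φ : Euc d × Euc s → ℝ) (P : HomCoord d s) : Euc d × Euc s →L[ℝ] ℝ :=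
  (fderiv ℝ φ (dehomog P)).comp (diagScale d s P.2.2 P.1.2)

/-- `ρ r φ(ω/ρ, σ/r)`. -/
def homog (φ : Euc d × Euc s → ℝ) (P : HomCoord d s) : ℝ := P.1.2 * P.2.2 * φ (dehomog P)

theorem isOpen_interiorCoord : IsOpen (interiorCoord d s) :=
  (isOpen_lt continuous_const continuous_fst.snd).inter
    (isOpen_lt continuous_const continuous_snd.snd)

theorem contDiffAt_dehomog {P : HomCoord d s} (hP : P ∈ interiorCoord d s) :
    ContDiffAt ℝ ∞ (dehomog (d := d) (s := s)) P :=
  ((contDiffAt_fst.snd.inv hP.1.ne').smul contDiffAt_fst.fst).prodMk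
    ((contDiffAt_snd.snd.inv hP.2.ne').smul contDiffAt_snd.fst)

theorem contDiffAt_homog {φ : Euc d × Euc s → ℝ} {P : HomCoord d s} (hP : P ∈ interiorCoord d s)
    (hφ : ContDiffAt ℝ ∞ φ (dehomog P)) : ContDiffAt ℝ ∞ (homog φ) P :=
  (contDiffAt_fst.snd.mul contDiffAt_snd.snd).mul (hφ.comp P (contDiffAt_dehomog hP))

/-- The rescaled differential is the horizontal part of the differential of `ρ r φ(ω/ρ, σ/r)`. -/
theorem covec_eq_fderiv_homog {φ : Euc d × Euc s → ℝ} {P : HomCoord d s}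
    (hP : P ∈ interiorCoord d s) (hφ : DifferentiableAt ℝ φ (dehomog P)) :
    covec φ P = (fderiv ℝ (homog φ) P).comp (horizontal d s) := by
  refine ContinuousLinearMap.ext fun v => ?_
  have hd : DifferentiableAt ℝ (homog φ) P :=
    (DifferentiableAt.mul (by fun_prop) (by fun_prop)).mul
      (hφ.comp P ((contDiffAt_dehomog hP).differentiableAt (by simp)))
  have h1 := hd.hasFDerivAt.hasLineDerivAt (horizontal d s v)
  have h2 := (hφ.hasFDerivAt.hasLineDerivAt (P.1.2⁻¹ • v.1, P.2.2⁻¹ • v.2)).const_mul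
    (P.1.2 * P.2.2)
  have heq : (fun t : ℝ => P.1.2 * P.2.2 *
      φ (dehomog P + t • (P.1.2⁻¹ • v.1, P.2.2⁻¹ • v.2))) =
      fun t : ℝ => homog φ (P + t • horizontal d s v) := by
    funext t
    simp [homog, dehomog, smul_comm t]
  rw [heq] at h2
  rw [ContinuousLinearMap.comp_apply, h1.unique h2, ← smul_eq_mul, ← map_smul]
  change fderiv ℝ φ (dehomog P) (P.2.2 • v.1, P.1.2 • v.2) = _
  have h3 := hP.1.ne'
  have h4 := hP.2.ne'
  congr 1
  simp only [Prod.smul_mk, smul_smul]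
  congr 2 <;> field_simp

theorem dehomog_smul {a b : ℝ} (ha : 0 < a) (hb : 0 < b) (P : HomCoord d s) :
    dehomog (a • P.1, b • P.2) = dehomog P := by
  simp only [dehomog, Prod.smul_fst, Prod.smul_snd, smul_smul, smul_eq_mul, mul_inv]
  congr 2 <;> field_simp

/-- The homogeneity of the rescaled differential in the two pairs of homogeneous coordinates. -/
theorem covec_smul (φ : Euc d × Euc s → ℝ) {a b : ℝ} (ha : 0 < a) (hb : 0 < b)
    (P : HomCoord d s) :
    covec φ (a • P.1, b • P.2) = (covec φ P).comp (diagScale d s b a) := by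
  rw [covec, dehomog_smul ha hb, covec, ContinuousLinearMap.comp_assoc]
  congr 1
  refine ContinuousLinearMap.ext fun v => ?_
  simp [smul_smul, mul_comm]

theorem covec_swap {φ : Euc d × Euc s → ℝ} (hφ : ContDiff ℝ ∞ φ) (P : HomCoord d s)
    (v : Euc d × Euc s) :
    covec (fun p : Euc s × Euc d => φ p.swap) P.swap v.swap = covec φ P v := by
  have h1 : HasFDerivAt (fun p : Euc s × Euc d => φ p.swap)
      ((fderiv ℝ φ (dehomog P)).comp ((ContinuousLinearMap.snd ℝ _ _).prod
        (ContinuousLinearMap.fst ℝ _ _))) (dehomog P.swap) :=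
    HasFDerivAt.comp (g := φ) (dehomog P.swap) (hφ.differentiable (by simp) _).hasFDerivAt
      (((ContinuousLinearMap.snd ℝ (Euc s) (Euc d)).prod
        (ContinuousLinearMap.fst ℝ _ _)).hasFDerivAt)
  rw [covec, h1.fderiv]
  rfl

theorem continuousOn_covec {φ : Euc d × Euc s → ℝ} (hφ : ContDiff ℝ ∞ φ) :
    ContinuousOn (covec φ) (interiorCoord d s) := by
  intro P hP
  refine ContinuousAt.continuousWithinAt (ContinuousAt.clm_comp ?_ ?_)
  · exact (hφ.continuous_fderiv (by simp)).continuousAt.comp (contDiffAt_dehomog hP).continuousAt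
  · have h1 : Continuous fun P : HomCoord d s => P.2.2 := by fun_prop
    have h2 : Continuous fun P : HomCoord d s => P.1.2 := by fun_prop
    have : Continuous fun P : HomCoord d s => diagScale d s P.2.2 P.1.2 := by
      let L := (ContinuousLinearMap.compL ℝ (Euc d × Euc s) (Euc d) (Euc d × Euc s)
        (ContinuousLinearMap.inl ℝ _ _)) (ContinuousLinearMap.fst ℝ _ _)
      let M := (ContinuousLinearMap.compL ℝ (Euc d × Euc s) (Euc s) (Euc d × Euc s)
        (ContinuousLinearMap.inr ℝ _ _)) (ContinuousLinearMap.snd ℝ _ _)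
      have he : (fun P : HomCoord d s => diagScale d s P.2.2 P.1.2) =
          fun P : HomCoord d s => P.2.2 • L + P.1.2 • M := by
        funext P
        refine ContinuousLinearMap.ext fun v => ?_
        simp [L, M]
      rw [he]
      fun_prop
    exact this.continuousAt

/-- An expansion of `φ` of two terms, homogeneous in `x`, with the properties that are invariant
under exchanging the roles of `x` and `θ`. -/
structure HasTwoTermExpansion (φ : Euc d × Euc s → ℝ) : Prop where
  smooth : ContDiff ℝ ∞ φ
  expansion : ∃ (χ : Euc d → ℝ) (b₀ b₁ : Euc d × Euc s → ℝ),
    (∃ R : ℝ, ∀ x, R ≤ ‖x‖ → χ x = 1) ∧ IsHomX 1 b₀ ∧ IsHomX 0 b₁ ∧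
    PolyTheta (fun p => χ p.1 * b₀ p) ∧ PolyTheta (fun p => χ p.1 * b₁ p) ∧
    ∃ ψ : Euc d × Euc s → ℝ, ContDiff ℝ ∞ ψ ∧
      (∀ p, φ p = χ p.1 * b₀ p + χ p.1 * b₁ p + ψ p) ∧
      ∃ C : ℝ, 0 ≤ C ∧ ∀ x θ,
        jap x ^ 2 * ‖(fderiv ℝ ψ (x, θ)).comp (ContinuousLinearMap.inl ℝ _ _)‖ ≤ C * jap θ ∧
        jap x * ‖(fderiv ℝ ψ (x, θ)).comp (ContinuousLinearMap.inr ℝ _ _)‖ ≤ C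

theorem IsSymbol.norm_fderiv_inl_le {me mψ : ℝ} {a : Euc d × Euc s → ℝ} (ha : IsSymbol me mψ a) :
    ∃ C : ℝ, ∀ x θ, ‖(fderiv ℝ a (x, θ)).comp (ContinuousLinearMap.inl ℝ _ _)‖ ≤
      C * jap x ^ (me - 1) * jap θ ^ mψ := by
  obtain ⟨C, hC⟩ := ha.bound 1 0
  refine ⟨C, fun x θ => ?_⟩
  have h := hC x θ
  have h1 : (fun u : Euc d => iteratedFDeriv ℝ 0 (fun w : Euc s => a (u, w)) θ) =
      (continuousMultilinearCurryFin0 ℝ (Euc s) ℝ).symm ∘ fun u : Euc d => a (u, θ) := by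
    funext u
    rw [iteratedFDeriv_zero_eq_comp]
    rfl
  have h2 : HasFDerivAt (fun u : Euc d => a (u, θ))
      ((fderiv ℝ a (x, θ)).comp (ContinuousLinearMap.inl ℝ _ _)) x :=
    (ha.smooth.differentiable (by simp) _).hasFDerivAt.comp x (hasFDerivAt_prodMk_left x θ)
  rw [h1, LinearIsometryEquiv.norm_iteratedFDeriv_comp_left, norm_iteratedFDeriv_one,
    h2.fderiv] at h
  simpa using h

theorem IsSymbol.norm_fderiv_inr_le {me mψ : ℝ} {a : Euc d × Euc s → ℝ} (ha : IsSymbol me mψ a) :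
    ∃ C : ℝ, ∀ x θ, ‖(fderiv ℝ a (x, θ)).comp (ContinuousLinearMap.inr ℝ _ _)‖ ≤
      C * jap x ^ me * jap θ ^ (mψ - 1) := by
  obtain ⟨C, hC⟩ := ha.bound 0 1
  refine ⟨C, fun x θ => ?_⟩
  have h := hC x θ
  have h2 : HasFDerivAt (fun w : Euc s => a (x, w))
      ((fderiv ℝ a (x, θ)).comp (ContinuousLinearMap.inr ℝ _ _)) θ :=
    (ha.smooth.differentiable (by simp) _).hasFDerivAt.comp θ (hasFDerivAt_prodMk_right x θ)
  rw [norm_iteratedFDeriv_zero, norm_iteratedFDeriv_one, h2.fderiv] at h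
  simpa using h

theorem IsClassical.hasTwoTermExpansion {φ : Euc d × Euc s → ℝ} (hφ : IsClassical 1 1 φ) :
    HasTwoTermExpansion φ := by
  obtain ⟨χ, b, hχ, hb, hcl, hN⟩ := hφ.expansion_x
  have hN2 := hN 2
  obtain ⟨C₁, hC₁⟩ := hN2.norm_fderiv_inl_le
  obtain ⟨C₂, hC₂⟩ := hN2.norm_fderiv_inr_le
  refine ⟨hφ.symbol.smooth, χ, b 0, b 1, hχ.one_far, by simpa using hb 0, by simpa using hb 1,
    (hcl 0).polyTheta, (hcl 1).polyTheta, _, hN2.smooth, fun p => ?_, |C₁| + |C₂|, by positivity,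
    fun x θ => ⟨?_, ?_⟩⟩
  · simp [Finset.sum_range_succ]
  · have h1 := hC₁ x θ
    have hx := jap_pos x
    have hθ := jap_pos θ
    rw [show (1 : ℝ) - ((2 : ℕ) : ℝ) - 1 = -((2 : ℕ) : ℝ) by norm_num, Real.rpow_neg hx.le,
      Real.rpow_natCast, Real.rpow_one] at h1
    calc _ ≤ jap x ^ 2 * (C₁ * (jap x ^ 2)⁻¹ * jap θ) := by gcongr
      _ = C₁ * jap θ := by field_simp
      _ ≤ _ := by
        gcongr
        linarith [le_abs_self C₁, abs_nonneg C₂]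
  · have h1 := hC₂ x θ
    have hx := jap_pos x
    rw [show (1 : ℝ) - ((2 : ℕ) : ℝ) = -1 by norm_num, Real.rpow_neg hx.le, sub_self,
      Real.rpow_zero, Real.rpow_one, mul_one] at h1
    calc _ ≤ jap x * (C₂ * (jap x)⁻¹) := by gcongr
      _ = C₂ := by field_simp
      _ ≤ _ := by linarith [le_abs_self C₂, abs_nonneg C₁]

theorem fderiv_comp_swap {a : Euc d × Euc s → ℝ} (ha : ContDiff ℝ ∞ a) (x : Euc s)
    (θ : Euc d) :
    (fderiv ℝ (fun p : Euc s × Euc d => a p.swap) (x, θ)).comp (ContinuousLinearMap.inl ℝ _ _) =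
        (fderiv ℝ a (θ, x)).comp (ContinuousLinearMap.inr ℝ _ _) ∧
      (fderiv ℝ (fun p : Euc s × Euc d => a p.swap) (x, θ)).comp (ContinuousLinearMap.inr ℝ _ _) =
        (fderiv ℝ a (θ, x)).comp (ContinuousLinearMap.inl ℝ _ _) := by
  have h1 : HasFDerivAt (fun p : Euc s × Euc d => a p.swap)
      ((fderiv ℝ a (θ, x)).comp ((ContinuousLinearMap.snd ℝ _ _).prod
        (ContinuousLinearMap.fst ℝ _ _))) (x, θ) :=
    HasFDerivAt.comp (g := a) (x, θ) (ha.differentiable (by simp) _).hasFDerivAt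
      (((ContinuousLinearMap.snd ℝ (Euc s) (Euc d)).prod
        (ContinuousLinearMap.fst ℝ _ _)).hasFDerivAt)
  rw [h1.fderiv]
  exact ⟨rfl, rfl⟩

theorem IsClassical.hasTwoTermExpansion_swap {φ : Euc d × Euc s → ℝ} (hφ : IsClassical 1 1 φ) :
    HasTwoTermExpansion (fun p : Euc s × Euc d => φ p.swap) := by
  obtain ⟨χ, b, hχ, hb, hcl, hN⟩ := hφ.expansion_theta
  have hN2 := hN 2
  obtain ⟨C₁, hC₁⟩ := hN2.norm_fderiv_inl_le
  obtain ⟨C₂, hC₂⟩ := hN2.norm_fderiv_inr_le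
  have hsw : ContDiff ℝ ∞ (Prod.swap : Euc s × Euc d → Euc d × Euc s) :=
    contDiff_snd.prodMk contDiff_fst
  refine ⟨hφ.symbol.smooth.comp hsw, χ, fun p => b 0 p.swap, fun p => b 1 p.swap, hχ.one_far,
    IsHomTheta.swap (by simpa using hb 0), IsHomTheta.swap (by simpa using hb 1),
    (hcl 0).polyTheta_swap, (hcl 1).polyTheta_swap,
    fun p => (fun p => φ p - ∑ j ∈ Finset.range 2, χ p.2 * b j p) p.swap,
    hN2.smooth.comp hsw, fun p => ?_, |C₁| + |C₂|, by positivity,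
    fun x θ => ⟨?_, ?_⟩⟩
  · simp [Finset.sum_range_succ]
  · rw [(fderiv_comp_swap hN2.smooth x θ).1]
    have h1 := hC₂ θ x
    have hx := jap_pos x
    have hθ := jap_pos θ
    rw [show (1 : ℝ) - ((2 : ℕ) : ℝ) - 1 = -((2 : ℕ) : ℝ) by norm_num, Real.rpow_neg hx.le,
      Real.rpow_natCast, Real.rpow_one] at h1
    calc _ ≤ jap x ^ 2 * (C₂ * jap θ * (jap x ^ 2)⁻¹) := by gcongr
      _ = C₂ * jap θ := by field_simp
      _ ≤ _ := by
        gcongr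
        linarith [le_abs_self C₂, abs_nonneg C₁]
  · rw [(fderiv_comp_swap hN2.smooth x θ).2]
    have h1 := hC₁ θ x
    have hx := jap_pos x
    rw [show (1 : ℝ) - ((2 : ℕ) : ℝ) = -1 by norm_num, Real.rpow_neg hx.le, sub_self,
      Real.rpow_zero, Real.rpow_one, mul_one] at h1
    calc _ ≤ jap x * (C₁ * (jap x)⁻¹) := by gcongr
      _ = C₁ := by field_simp
      _ ≤ _ := by linarith [le_abs_self C₁, abs_nonneg C₂]

end Covector

open Compactification (halfSpace)

/-! ### Expansions of the rescaled differential at the faces -/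

section Expansion

variable {d s : ℕ}

/-- `E(P) = (DΦ₀ + ε DΦ₁)(P) ∘ J + O(ε²)` for the rescaled differential `E` of `φ`, near `P₀`, where
`ε` defines a boundary face and `J` is the horizontal embedding. -/
def IsExpansionAt (φ : Euc d × Euc s → ℝ) (ε : HomCoord d s → ℝ) (P₀ : HomCoord d s)
    (Φ₀ Φ₁ : HomCoord d s → ℝ) : Prop :=
  SmoothNear Φ₀ P₀ ∧ SmoothNear Φ₁ P₀ ∧ ∃ C : ℝ, ∀ᶠ P in 𝓝 P₀, P ∈ interiorCoord d s →
    ‖covec φ P - (fderiv ℝ Φ₀ P + ε P • fderiv ℝ Φ₁ P).comp (horizontal d s)‖ ≤ C * ε P ^ 2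

/-- A homogeneous term gives rise to a function that is smooth up to the boundary. -/
theorem exists_extension_of_isHomX {m : ℝ} {χ : Euc d → ℝ} {b : Euc d × Euc s → ℝ}
    (hχ : ∃ R : ℝ, ∀ x, R ≤ ‖x‖ → χ x = 1) (hb : IsHomX m b)
    (hp : PolyTheta (fun p => χ p.1 * b p)) {P₀ : HomCoord d s} (h1 : P₀.1.1 ≠ 0)
    (h2 : P₀.2 ∈ halfSpace s) :
    ∃ Φ : HomCoord d s → ℝ, SmoothNear Φ P₀ ∧
      ∀ᶠ P in 𝓝 P₀, 0 < P.2.2 → Φ P = P.2.2 * b (P.1.1, P.2.2⁻¹ • P.2.1) := by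
  obtain ⟨R, hR⟩ := hχ
  have hn := norm_pos_iff.2 h1
  -- by homogeneity it is enough to consider points so far away that `χ = 1`
  let T : ℝ := (|R| + 1) / ‖P₀.1.1‖
  have hT : 0 < T := by positivity
  have hTn : R < T * ‖P₀.1.1‖ := by
    rw [div_mul_cancel₀ _ hn.ne']
    linarith [le_abs_self R]
  obtain ⟨B, hB, hBe⟩ := hp.exists_extension (T • P₀.1.1) h2
  have hτ : ContDiff ℝ ∞ fun P : HomCoord d s => (T • P.1.1, P.2) :=
    (contDiff_fst.fst.const_smul T).prodMk contDiff_snd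
  refine ⟨fun P => (T ^ m)⁻¹ * B (T • P.1.1, P.2), ?_, ?_⟩
  · have : SmoothNear (fun P : HomCoord d s => B (T • P.1.1, P.2)) P₀ :=
      SmoothNear.comp (g := B) (f := fun P : HomCoord d s => (T • P.1.1, P.2)) hB
        (hτ.smoothNear _)
    exact SmoothNear.smul (contDiff_const.smoothNear _) this
  · have h3 := (hτ.continuous.tendsto P₀).eventually hBe
    have h4 : ∀ᶠ P : HomCoord d s in 𝓝 P₀, R < T * ‖P.1.1‖ := by
      have : Continuous fun P : HomCoord d s => T * ‖P.1.1‖ := by fun_prop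
      exact this.continuousAt.eventually (lt_mem_nhds hTn)
    have h5 : ∀ᶠ P : HomCoord d s in 𝓝 P₀, P.1.1 ≠ 0 :=
      continuous_fst.fst.continuousAt.eventually (isOpen_ne.mem_nhds h1)
    filter_upwards [h3, h4, h5] with P hP1 hP2 hP3 hr
    have hχ1 : χ (T • P.1.1) = 1 := hR _ (by
      rw [norm_smul, Real.norm_of_nonneg hT.le]; exact hP2.le)
    rw [hP1 hr]
    rw [hχ1, one_mul, hb.2 T hT _ _ hP3]
    have : T ^ m ≠ 0 := (Real.rpow_pos_of_pos hT m).ne'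
    field_simp

/-- A two-term expansion in `x` gives the expansion of the rescaled differential at the face
`{ρ = 0}`. -/
theorem HasTwoTermExpansion.exists_isExpansionAt {φ : Euc d × Euc s → ℝ}
    (hφ : HasTwoTermExpansion φ) {P₀ : HomCoord d s} (h0 : P₀.1.2 = 0) (h1 : P₀.1.1 ≠ 0)
    (h2 : P₀.2 ∈ halfSpace s) :
    ∃ Φ₀ Φ₁, IsExpansionAt φ (fun P => P.1.2) P₀ Φ₀ Φ₁ := by
  obtain ⟨hsm, χ, b₀, b₁, hχ, hb₀, hb₁, hp₀, hp₁, ψ, hψ, hφψ, C, hC0, hC⟩ := hφ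
  obtain ⟨Φ₀, hΦ₀, he₀⟩ := exists_extension_of_isHomX hχ hb₀ hp₀ h1 h2
  obtain ⟨Φ₁, hΦ₁, he₁⟩ := exists_extension_of_isHomX hχ hb₁ hp₁ h1 h2
  obtain ⟨R, hR⟩ := hχ
  have hn := norm_pos_iff.2 h1
  set c := ‖P₀.1.1‖ / 2 with hc
  have hc0 : 0 < c := by positivity
  set K := |P₀.2.2| + ‖P₀.2.1‖ + 1 with hK
  have hK0 : 0 < K := by positivity
  refine ⟨Φ₀, Φ₁, hΦ₀, hΦ₁, C * (K / c ^ 2 + 1 / c), ?_⟩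
  have h3 : ∀ᶠ P : HomCoord d s in 𝓝 P₀, c < ‖P.1.1‖ := by
    have : Continuous fun P : HomCoord d s => ‖P.1.1‖ := by fun_prop
    exact this.continuousAt.eventually (lt_mem_nhds (by linarith))
  have h4 : ∀ᶠ P : HomCoord d s in 𝓝 P₀, |P.2.2| + ‖P.2.1‖ < K := by
    have : Continuous fun P : HomCoord d s => |P.2.2| + ‖P.2.1‖ := by fun_prop
    exact this.continuousAt.eventually (gt_mem_nhds (by linarith))
  have h5 : ∀ᶠ P : HomCoord d s in 𝓝 P₀, P.1.2 * R < ‖P.1.1‖ := by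
    have : Continuous fun P : HomCoord d s => ‖P.1.1‖ - P.1.2 * R := by fun_prop
    have h : 0 < ‖P₀.1.1‖ - P₀.1.2 * R := by rw [h0]; linarith
    filter_upwards [this.continuousAt.eventually (lt_mem_nhds h)] with P hP
    linarith
  have h6 : ∀ᶠ P in 𝓝 P₀, P ∈ interiorCoord d s →
      homog φ P = Φ₀ P + P.1.2 * Φ₁ P + homog ψ P := by
    filter_upwards [he₀, he₁, h3, h5] with P hP0 hP1 hP3 hP5 hP
    obtain ⟨hρ, hr⟩ := hP
    have hχ1 : χ (P.1.2⁻¹ • P.1.1) = 1 := by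
      refine hR _ ?_
      rw [norm_smul, Real.norm_of_nonneg (inv_nonneg.2 hρ.le), ← div_eq_inv_mul,
        le_div_iff₀ hρ, mul_comm]
      exact hP5.le
    have hne : P.1.1 ≠ 0 := norm_pos_iff.1 (hc0.trans hP3)
    rw [homog, hφψ, hP0 hr, hP1 hr, homog]
    simp only [dehomog]
    rw [hχ1, hb₀.2 _ (inv_pos.2 hρ) _ _ hne, hb₁.2 _ (inv_pos.2 hρ) _ _ hne, Real.rpow_one,
      Real.rpow_zero]
    field_simp
  filter_upwards [h6.eventually_nhds, h3, h4, hΦ₀, hΦ₁] with P hP6 hP3 hP4 hP0 hP1 hP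
  obtain ⟨hρ, hr⟩ := hP
  have hd0 := (hP0.differentiableAt (by simp)).hasFDerivAt
  have hd1 := (hP1.differentiableAt (by simp)).hasFDerivAt
  have hdψ : DifferentiableAt ℝ (homog ψ) P :=
    (contDiffAt_homog ⟨hρ, hr⟩ hψ.contDiffAt).differentiableAt (by simp)
  have hρd : HasFDerivAt (fun P : HomCoord d s => P.1.2)
      ((ContinuousLinearMap.snd ℝ (Euc d) ℝ).comp (ContinuousLinearMap.fst ℝ _ _)) P :=
    ((ContinuousLinearMap.snd ℝ (Euc d) ℝ).comp
      (ContinuousLinearMap.fst ℝ (Euc d × ℝ) (Euc s × ℝ))).hasFDerivAt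
  have hsum := (hd0.fun_add (hρd.fun_mul hd1)).fun_add hdψ.hasFDerivAt
  have heq : homog φ =ᶠ[𝓝 P] fun P => Φ₀ P + P.1.2 * Φ₁ P + homog ψ P := by
    filter_upwards [hP6, isOpen_interiorCoord.mem_nhds ⟨hρ, hr⟩] with Q hQ hQ'
    exact hQ hQ'
  have hE : covec φ P - (fderiv ℝ Φ₀ P + P.1.2 • fderiv ℝ Φ₁ P).comp (horizontal d s) =
      covec ψ P := by
    rw [covec_eq_fderiv_homog ⟨hρ, hr⟩ (hsm.differentiable (by simp) _),
      covec_eq_fderiv_homog ⟨hρ, hr⟩ (hψ.differentiable (by simp) _),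
      (hsum.congr_of_eventuallyEq heq).fderiv]
    refine ContinuousLinearMap.ext fun v => ?_
    simp
  rw [hE]
  -- the remainder is of second order at the face
  set x := P.1.2⁻¹ • P.1.1 with hx
  set θ := P.2.2⁻¹ • P.2.1 with hθ
  obtain ⟨hb1, hb2⟩ := hC x θ
  have hjx : c / P.1.2 ≤ jap x := by
    refine le_trans ?_ (norm_le_jap x)
    rw [hx, norm_smul, Real.norm_of_nonneg (inv_nonneg.2 hρ.le), div_eq_inv_mul]
    gcongr
  have hjθ : P.2.2 * jap θ ≤ K := by
    have h1 : jap θ ≤ 1 + ‖θ‖ := by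
      refine Real.sqrt_le_iff.2 ⟨by positivity, ?_⟩
      nlinarith [norm_nonneg θ]
    have h2 : P.2.2 * ‖θ‖ = ‖P.2.1‖ := by
      rw [hθ, norm_smul, Real.norm_of_nonneg (inv_nonneg.2 hr.le), ← mul_assoc,
        mul_inv_cancel₀ hr.ne', one_mul]
    have h3 : |P.2.2| = P.2.2 := abs_of_pos hr
    nlinarith
  set A := ‖(fderiv ℝ ψ (x, θ)).comp (ContinuousLinearMap.inl ℝ _ _)‖ with hA
  set B := ‖(fderiv ℝ ψ (x, θ)).comp (ContinuousLinearMap.inr ℝ _ _)‖ with hB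
  have hA0 : 0 ≤ A := norm_nonneg _
  have hB0 : 0 ≤ B := norm_nonneg _
  have hρc : 0 < c / P.1.2 := by positivity
  have hA1 : P.2.2 * A ≤ C * K / c ^ 2 * P.1.2 ^ 2 := by
    have h1 : (c / P.1.2) ^ 2 * (P.2.2 * A) ≤ C * K := by
      calc (c / P.1.2) ^ 2 * (P.2.2 * A) ≤ jap x ^ 2 * (P.2.2 * A) := by gcongr
        _ = P.2.2 * (jap x ^ 2 * A) := by ring
        _ ≤ P.2.2 * (C * jap θ) := by gcongr
        _ = C * (P.2.2 * jap θ) := by ring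
        _ ≤ _ := by gcongr
    calc P.2.2 * A = (c / P.1.2) ^ 2 * (P.2.2 * A) * (P.1.2 ^ 2 / c ^ 2) := by
          field_simp
      _ ≤ C * K * (P.1.2 ^ 2 / c ^ 2) := by gcongr
      _ = _ := by ring
  have hB1 : P.1.2 * B ≤ C / c * P.1.2 ^ 2 := by
    have h1 : c / P.1.2 * B ≤ C := by
      calc c / P.1.2 * B ≤ jap x * B := by gcongr
        _ ≤ C := hb2
    calc P.1.2 * B = c / P.1.2 * B * (P.1.2 ^ 2 / c) := by field_simp
      _ ≤ C * (P.1.2 ^ 2 / c) := by gcongr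
      _ = _ := by ring
  have hcov : covec ψ P = P.2.2 • ((fderiv ℝ ψ (x, θ)).comp (ContinuousLinearMap.inl ℝ _ _)).comp
      (ContinuousLinearMap.fst ℝ _ _) +
      P.1.2 • ((fderiv ℝ ψ (x, θ)).comp (ContinuousLinearMap.inr ℝ _ _)).comp
      (ContinuousLinearMap.snd ℝ _ _) := by
    refine ContinuousLinearMap.ext fun v => ?_
    change fderiv ℝ ψ (x, θ) (P.2.2 • v.1, P.1.2 • v.2) =
      P.2.2 • fderiv ℝ ψ (x, θ) (v.1, 0) + P.1.2 • fderiv ℝ ψ (x, θ) (0, v.2)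
    rw [← map_smul, ← map_smul, ← map_add]
    simp
  rw [hcov]
  calc _ ≤ P.2.2 * (A * 1) + P.1.2 * (B * 1) := by
        refine (norm_add_le _ _).trans (add_le_add ?_ ?_)
        · rw [norm_smul, Real.norm_of_nonneg hr.le]
          gcongr
          exact (ContinuousLinearMap.opNorm_comp_le _ _).trans
            (mul_le_mul_of_nonneg_left (ContinuousLinearMap.norm_fst_le _ _ _) hA0)
        · rw [norm_smul, Real.norm_of_nonneg hρ.le]
          gcongr
          exact (ContinuousLinearMap.opNorm_comp_le _ _).trans
            (mul_le_mul_of_nonneg_left (ContinuousLinearMap.norm_snd_le _ _ _) hB0)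
    _ ≤ C * K / c ^ 2 * P.1.2 ^ 2 + C / c * P.1.2 ^ 2 := by
        rw [mul_one, mul_one]
        exact add_le_add hA1 hB1
    _ = _ := by ring

theorem contDiff_swap_homCoord (d s : ℕ) :
    ContDiff ℝ ∞ (Prod.swap : HomCoord d s → HomCoord s d) :=
  contDiff_snd.prodMk contDiff_fst

/-- A two-term expansion in `θ` gives the expansion of the rescaled differential at the face
`{r = 0}`. -/
theorem HasTwoTermExpansion.exists_isExpansionAt_swap {φ : Euc d × Euc s → ℝ}
    (hsm : ContDiff ℝ ∞ φ)
    (hφ : HasTwoTermExpansion (fun p : Euc s × Euc d => φ p.swap)) {P₀ : HomCoord d s}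
    (h0 : P₀.2.2 = 0) (h1 : P₀.2.1 ≠ 0) (h2 : P₀.1 ∈ halfSpace d) :
    ∃ Φ₀ Φ₁, IsExpansionAt φ (fun P => P.2.2) P₀ Φ₀ Φ₁ := by
  obtain ⟨Φ₀, Φ₁, hΦ₀, hΦ₁, C, hC⟩ := hφ.exists_isExpansionAt (P₀ := P₀.swap) h0 h1 h2
  have hsw := contDiff_swap_homCoord d s
  refine ⟨fun P => Φ₀ P.swap, fun P => Φ₁ P.swap,
    SmoothNear.comp (g := Φ₀) (f := Prod.swap) hΦ₀ (hsw.smoothNear _),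
    SmoothNear.comp (g := Φ₁) (f := Prod.swap) hΦ₁ (hsw.smoothNear _), C, ?_⟩
  filter_upwards [(hsw.continuous.tendsto P₀).eventually hC,
    (hsw.continuous.tendsto P₀).eventually hΦ₀, (hsw.continuous.tendsto P₀).eventually hΦ₁]
    with P hP hP0 hP1 hPi
  have hder : ∀ {Φ : HomCoord s d → ℝ}, ContDiffAt ℝ ∞ Φ P.swap →
      fderiv ℝ (fun P : HomCoord d s => Φ P.swap) P = (fderiv ℝ Φ P.swap).comp
        ((ContinuousLinearMap.snd ℝ _ _).prod (ContinuousLinearMap.fst ℝ _ _)) := by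
    intro Φ hΦ
    exact (HasFDerivAt.comp (g := Φ) P (hΦ.differentiableAt (by simp)).hasFDerivAt
      (((ContinuousLinearMap.snd ℝ (Euc d × ℝ) (Euc s × ℝ)).prod
        (ContinuousLinearMap.fst ℝ _ _)).hasFDerivAt)).fderiv
  rw [hder hP0, hder hP1]
  have h3 := hP ⟨hPi.2, hPi.1⟩
  refine (ContinuousLinearMap.opNorm_le_bound _ ((norm_nonneg _).trans h3) fun v => ?_)
  have h4 := ContinuousLinearMap.le_of_opNorm_le _ h3 v.swap
  have h5 : ‖v.swap‖ = ‖v‖ := by simp [Prod.norm_def, max_comm]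
  rw [h5] at h4
  simp only [sub_apply, covec_swap hsm] at h4
  exact h4

end Expansion

/-! ### Extension of the rescaled differential to the boundary -/

section ExtendedCovector

variable {d s : ℕ}

/-- The homogeneous coordinates of points of `𝔹ᵈ × 𝔹ˢ`. -/
def closedCoord (d s : ℕ) : Set (HomCoord d s) := {P | P.1 ∈ halfSpace d ∧ P.2 ∈ halfSpace s}

/-- The continuous extension of the rescaled differential to the boundary. -/
def extCovec (φ : Euc d × Euc s → ℝ) : HomCoord d s → (Euc d × Euc s →L[ℝ] ℝ) :=
  extendFrom (interiorCoord d s) (covec φ)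

theorem halfSpace_snd_nonneg {n : ℕ} {P : Euc n × ℝ} (hP : P ∈ halfSpace n) : 0 ≤ P.2 := by
  rcases hP with h | ⟨h, -⟩
  · exact h.le
  · exact h.ge

theorem halfSpace_fst_ne_zero {n : ℕ} {P : Euc n × ℝ} (hP : P ∈ halfSpace n) (h0 : P.2 = 0) :
    P.1 ≠ 0 := by
  rcases hP with h | ⟨-, h⟩
  · exact absurd h0 h.ne'
  · exact h

theorem smul_mem_halfSpace {n : ℕ} {P : Euc n × ℝ} (hP : P ∈ halfSpace n) {a : ℝ} (ha : 0 < a) :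
    a • P ∈ halfSpace n := by
  rcases hP with h | ⟨h, h'⟩
  · exact Or.inl (mul_pos ha h)
  · exact Or.inr ⟨by simp [h], smul_ne_zero ha.ne' h'⟩

theorem norm_sq_add_sq_pos {n : ℕ} {P : Euc n × ℝ} (hP : P ∈ halfSpace n) :
    0 < P.2 ^ 2 + ‖P.1‖ ^ 2 := by
  rcases hP with h | ⟨-, h⟩
  · positivity
  · have := norm_pos_iff.2 h
    positivity

theorem interiorCoord_subset_closedCoord : interiorCoord d s ⊆ closedCoord d s :=
  fun _ hP => ⟨Or.inl hP.1, Or.inl hP.2⟩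

theorem closedCoord_subset_closure : closedCoord d s ⊆ closure (interiorCoord d s) := by
  intro P hP
  have h1 := halfSpace_snd_nonneg hP.1
  have h2 := halfSpace_snd_nonneg hP.2
  have hc : Continuous fun t : ℝ => P + t • (((0, 1), (0, 1)) : HomCoord d s) := by fun_prop
  have ht : Tendsto (fun t : ℝ => P + t • (((0, 1), (0, 1)) : HomCoord d s)) (𝓝[>] 0) (𝓝 P) :=
    (hc.tendsto' 0 P (by simp)).mono_left nhdsWithin_le_nhds
  refine mem_closure_of_tendsto ht ?_
  filter_upwards [self_mem_nhdsWithin] with t ht0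
  have ht1 : (0 : ℝ) < t := ht0
  constructor
  · change 0 < P.1.2 + t * 1
    linarith
  · change 0 < P.2.2 + t * 1
    linarith

/-- A function defining the closed face `f`. (For the corner one of the two functions is used.) -/
def faceFn : Face → HomCoord d s → ℝ
  | .e => fun P => P.1.2
  | .ψ => fun P => P.2.2
  | .ψe => fun P => P.2.2

theorem continuous_faceFn (f : Face) : Continuous (faceFn (d := d) (s := s) f) := by
  cases f <;> unfold faceFn <;> fun_prop

theorem IsClassical.exists_isExpansionAt {φ : Euc d × Euc s → ℝ} (hφ : IsClassical 1 1 φ)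
    (f : Face) {P₀ : HomCoord d s} (hP₀ : P₀ ∈ closedCoord d s) (h0 : faceFn f P₀ = 0) :
    ∃ Φ₀ Φ₁, IsExpansionAt φ (faceFn f) P₀ Φ₀ Φ₁ := by
  cases f with
  | e =>
    exact hφ.hasTwoTermExpansion.exists_isExpansionAt h0 (halfSpace_fst_ne_zero hP₀.1 h0) hP₀.2
  | ψ =>
    exact hφ.hasTwoTermExpansion_swap.exists_isExpansionAt_swap hφ.symbol.smooth h0
      (halfSpace_fst_ne_zero hP₀.2 h0) hP₀.1
  | ψe =>
    exact hφ.hasTwoTermExpansion_swap.exists_isExpansionAt_swap hφ.symbol.smooth h0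
      (halfSpace_fst_ne_zero hP₀.2 h0) hP₀.1

/-- The first two terms of an expansion. -/
def expansionSum (ε : HomCoord d s → ℝ) (Φ₀ Φ₁ : HomCoord d s → ℝ) (P : HomCoord d s) :
    Euc d × Euc s →L[ℝ] ℝ :=
  (fderiv ℝ Φ₀ P + ε P • fderiv ℝ Φ₁ P).comp (horizontal d s)

theorem continuousAt_expansionSum {ε : HomCoord d s → ℝ} {Φ₀ Φ₁ : HomCoord d s → ℝ}
    {P : HomCoord d s} (hε : ContinuousAt ε P) (h0 : SmoothNear Φ₀ P) (h1 : SmoothNear Φ₁ P) :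
    ContinuousAt (expansionSum ε Φ₀ Φ₁) P := by
  refine ContinuousAt.clm_comp ?_ continuousAt_const
  exact h0.smoothNear_fderiv.continuousAt.add (hε.smul h1.smoothNear_fderiv.continuousAt)

theorem IsExpansionAt.tendsto_covec {φ : Euc d × Euc s → ℝ} {ε : HomCoord d s → ℝ}
    {P₀ : HomCoord d s} {Φ₀ Φ₁ : HomCoord d s → ℝ} (h : IsExpansionAt φ ε P₀ Φ₀ Φ₁)
    (hε : ContinuousAt ε P₀) (h0 : ε P₀ = 0) :
    Tendsto (covec φ) (𝓝[interiorCoord d s] P₀) (𝓝 (expansionSum ε Φ₀ Φ₁ P₀)) := by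
  obtain ⟨h1, h2, C, hC⟩ := h
  have hA := (continuousAt_expansionSum hε h1 h2).tendsto.mono_left
    (nhdsWithin_le_nhds (s := interiorCoord d s))
  have hz : Tendsto (fun P => C * ε P ^ 2) (𝓝[interiorCoord d s] P₀) (𝓝 0) := by
    have : ContinuousAt (fun P => C * ε P ^ 2) P₀ := continuousAt_const.mul (hε.pow 2)
    have h3 := this.tendsto.mono_left (nhdsWithin_le_nhds (s := interiorCoord d s))
    simpa [h0] using h3
  have hd : Tendsto (fun P => covec φ P - expansionSum ε Φ₀ Φ₁ P) (𝓝[interiorCoord d s] P₀)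
      (𝓝 0) := by
    refine squeeze_zero_norm' ?_ hz
    filter_upwards [hC.filter_mono nhdsWithin_le_nhds, self_mem_nhdsWithin] with P hP hPi
    exact hP hPi
  simpa using hd.add hA

theorem IsClassical.exists_tendsto_covec {φ : Euc d × Euc s → ℝ} (hφ : IsClassical 1 1 φ)
    {P : HomCoord d s} (hP : P ∈ closedCoord d s) :
    ∃ ℓ, Tendsto (covec φ) (𝓝[interiorCoord d s] P) (𝓝 ℓ) := by
  by_cases h1 : P.1.2 = 0
  · obtain ⟨Φ₀, Φ₁, h⟩ := hφ.exists_isExpansionAt .e hP h1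
    exact ⟨_, h.tendsto_covec (continuous_faceFn _).continuousAt h1⟩
  · by_cases h2 : P.2.2 = 0
    · obtain ⟨Φ₀, Φ₁, h⟩ := hφ.exists_isExpansionAt .ψ hP h2
      exact ⟨_, h.tendsto_covec (continuous_faceFn _).continuousAt h2⟩
    · exact ⟨_, continuousOn_covec hφ.symbol.smooth P
        ⟨lt_of_le_of_ne (halfSpace_snd_nonneg hP.1) (Ne.symm h1),
          lt_of_le_of_ne (halfSpace_snd_nonneg hP.2) (Ne.symm h2)⟩⟩

theorem IsClassical.tendsto_covec {φ : Euc d × Euc s → ℝ} (hφ : IsClassical 1 1 φ)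
    {P : HomCoord d s} (hP : P ∈ closedCoord d s) :
    Tendsto (covec φ) (𝓝[interiorCoord d s] P) (𝓝 (extCovec φ P)) :=
  tendsto_extendFrom (hφ.exists_tendsto_covec hP)

theorem IsClassical.extCovec_eq {φ : Euc d × Euc s → ℝ} (hφ : IsClassical 1 1 φ)
    {P : HomCoord d s} (hP : P ∈ interiorCoord d s) : extCovec φ P = covec φ P :=
  extendFrom_eq (subset_closure hP) (continuousOn_covec hφ.symbol.smooth P hP)

theorem IsClassical.continuousOn_extCovec {φ : Euc d × Euc s → ℝ} (hφ : IsClassical 1 1 φ) :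
    ContinuousOn (extCovec φ) (closedCoord d s) :=
  continuousOn_extendFrom closedCoord_subset_closure fun _ hP => hφ.exists_tendsto_covec hP

theorem nhdsWithin_interiorCoord_neBot {P : HomCoord d s} (hP : P ∈ closedCoord d s) :
    (𝓝[interiorCoord d s] P).NeBot :=
  mem_closure_iff_nhdsWithin_neBot.1 (closedCoord_subset_closure hP)

theorem IsClassical.extCovec_smul {φ : Euc d × Euc s → ℝ} (hφ : IsClassical 1 1 φ)
    {P : HomCoord d s} (hP : P ∈ closedCoord d s) {a b : ℝ} (ha : 0 < a) (hb : 0 < b) :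
    extCovec φ (a • P.1, b • P.2) = (extCovec φ P).comp (diagScale d s b a) := by
  have hne := nhdsWithin_interiorCoord_neBot hP
  have hQ : (a • P.1, b • P.2) ∈ closedCoord d s :=
    ⟨smul_mem_halfSpace hP.1 ha, smul_mem_halfSpace hP.2 hb⟩
  have ht : Tendsto (fun P : HomCoord d s => (a • P.1, b • P.2)) (𝓝[interiorCoord d s] P)
      (𝓝[interiorCoord d s] (a • P.1, b • P.2)) := by
    refine tendsto_nhdsWithin_iff.2 ⟨?_, ?_⟩
    · have : Continuous fun P : HomCoord d s => (a • P.1, b • P.2) := by fun_prop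
      exact this.continuousAt.tendsto.mono_left nhdsWithin_le_nhds
    · filter_upwards [self_mem_nhdsWithin] with Q hQ
      exact ⟨mul_pos ha hQ.1, mul_pos hb hQ.2⟩
  have h1 := (hφ.tendsto_covec hQ).comp ht
  have h2 : Tendsto (fun P => (covec φ P).comp (diagScale d s b a)) (𝓝[interiorCoord d s] P)
      (𝓝 ((extCovec φ P).comp (diagScale d s b a))) :=
    
    ((continuous_id.clm_comp (continuous_const (y := diagScale d s b a))).tendsto
      (extCovec φ P)).comp (hφ.tendsto_covec hP)
  refine tendsto_nhds_unique h1 (h2.congr fun Q => ?_)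
  exact (covec_smul φ ha hb Q).symm

/-- The expansion persists for the continuous extension to the boundary. -/
theorem IsExpansionAt.norm_extCovec_sub_le {φ : Euc d × Euc s → ℝ} {ε : HomCoord d s → ℝ}
    {P₀ : HomCoord d s} {Φ₀ Φ₁ : HomCoord d s → ℝ} (h : IsExpansionAt φ ε P₀ Φ₀ Φ₁)
    (hφ : IsClassical 1 1 φ) (hε : Continuous ε) :
    ∃ C : ℝ, ∀ᶠ P in 𝓝 P₀, P ∈ closedCoord d s →
      ‖extCovec φ P - expansionSum ε Φ₀ Φ₁ P‖ ≤ C * ε P ^ 2 := by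
  obtain ⟨h1, h2, C, hC⟩ := h
  refine ⟨C, ?_⟩
  filter_upwards [hC.eventually_nhds, h1.eventually, h2.eventually] with P hP hP1 hP2 hPc
  have hne := nhdsWithin_interiorCoord_neBot hPc
  have h3 := ((hφ.tendsto_covec hPc).sub ((continuousAt_expansionSum hε.continuousAt hP1
    hP2).tendsto.mono_left nhdsWithin_le_nhds)).norm
  have h4 : Tendsto (fun P => C * ε P ^ 2) (𝓝[interiorCoord d s] P) (𝓝 (C * ε P ^ 2)) :=
    ((by fun_prop : Continuous fun P => C * ε P ^ 2).tendsto P).mono_left nhdsWithin_le_nhds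
  refine le_of_tendsto_of_tendsto h3 h4 ?_
  filter_upwards [hP.filter_mono nhdsWithin_le_nhds, self_mem_nhdsWithin] with Q hQ hQi
  exact hQ hQi

theorem faceFn_smul_eq_zero {f : Face} {P : HomCoord d s} (h : faceFn f P = 0) (a b : ℝ) :
    faceFn f (a • P.1, b • P.2) = 0 := by
  cases f
  · change a * P.1.2 = 0
    rw [show P.1.2 = 0 from h, mul_zero]
  all_goals
    change b * P.2.2 = 0
    rw [show P.2.2 = 0 from h, mul_zero]

theorem IsExpansionAt.extCovec_eq {φ : Euc d × Euc s → ℝ} {f : Face}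
    {P₀ : HomCoord d s} {Φ₀ Φ₁ : HomCoord d s → ℝ} (h : IsExpansionAt φ (faceFn f) P₀ Φ₀ Φ₁)
    (hφ : IsClassical 1 1 φ) :
    ∀ᶠ P in 𝓝 P₀, P ∈ closedCoord d s → faceFn f P = 0 →
      extCovec φ P = (fderiv ℝ Φ₀ P).comp (horizontal d s) := by
  obtain ⟨C, hC⟩ := h.norm_extCovec_sub_le hφ (continuous_faceFn f)
  filter_upwards [hC] with P hP hPc h0
  have := hP hPc
  rw [h0, zero_pow two_ne_zero, mul_zero, norm_le_zero_iff, sub_eq_zero] at this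
  rw [this, expansionSum, h0, zero_smul, add_zero]

/-- Euler's identities for the leading term: differentiate the homogeneity in each of the two pairs
of homogeneous coordinates. -/
theorem IsExpansionAt.euler {φ : Euc d × Euc s → ℝ} {f : Face}
    {P₀ : HomCoord d s} {Φ₀ Φ₁ : HomCoord d s → ℝ} (h : IsExpansionAt φ (faceFn f) P₀ Φ₀ Φ₁)
    (hφ : IsClassical 1 1 φ) (hP₀ : P₀ ∈ closedCoord d s) (h0 : faceFn f P₀ = 0)
    (v : Euc d × Euc s) :
    fderiv ℝ (fderiv ℝ Φ₀) P₀ (P₀.1, 0) (horizontal d s v) = extCovec φ P₀ (0, v.2) ∧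
      fderiv ℝ (fderiv ℝ Φ₀) P₀ (0, P₀.2) (horizontal d s v) = extCovec φ P₀ (v.1, 0) := by
  have hE := h.extCovec_eq hφ
  have hD : HasFDerivAt (fun P => fderiv ℝ Φ₀ P (horizontal d s v))
      ((fderiv ℝ (fderiv ℝ Φ₀) P₀).flip (horizontal d s v)) P₀ := by
    have h1 := h.1.smoothNear_fderiv.hasFDerivAt.clm_apply
      (hasFDerivAt_const (horizontal d s v) P₀)
    refine h1.congr_fderiv ?_
    ext w <;> simp
  have hpos : ∀ᶠ a : ℝ in 𝓝 1, 0 < a := lt_mem_nhds one_pos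
  constructor
  · have hc : HasDerivAt (fun a : ℝ => ((a • P₀.1, P₀.2) : HomCoord d s)) (P₀.1, 0) 1 := by
      have := ((hasDerivAt_id (1 : ℝ)).smul_const P₀.1).prodMk (hasDerivAt_const (1 : ℝ) P₀.2)
      simpa using this
    have hc1 : (fun a : ℝ => ((a • P₀.1, P₀.2) : HomCoord d s)) 1 = P₀ := by simp
    have h1 := HasFDerivAt.comp_hasDerivAt (1 : ℝ) (by simp only [one_smul]; exact hD) hc
    have h2 : HasDerivAt (fun a : ℝ => extCovec φ P₀ (v.1, 0) + a • extCovec φ P₀ (0, v.2))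
        (extCovec φ P₀ (0, v.2)) 1 := by
      simpa using ((hasDerivAt_id (1 : ℝ)).smul_const (extCovec φ P₀ (0, v.2))).const_add
        (extCovec φ P₀ (v.1, 0))
    refine h1.unique (h2.congr_of_eventuallyEq ?_)
    have hct : ∀ᶠ a : ℝ in 𝓝 1, ((a • P₀.1, P₀.2) : HomCoord d s) ∈ closedCoord d s →
        faceFn f ((a • P₀.1, P₀.2) : HomCoord d s) = 0 → extCovec φ (a • P₀.1, P₀.2) =
          (fderiv ℝ Φ₀ (a • P₀.1, P₀.2)).comp (horizontal d s) :=
      (hc.continuousAt.tendsto.trans (congrArg 𝓝 hc1).le) hE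
    filter_upwards [hpos, hct] with a ha hEa
    have hm : ((a • P₀.1, P₀.2) : HomCoord d s) = (a • P₀.1, (1 : ℝ) • P₀.2) := by rw [one_smul]
    rw [hm] at hEa
    have h3 := hEa ⟨smul_mem_halfSpace hP₀.1 ha, smul_mem_halfSpace hP₀.2 one_pos⟩
      (faceFn_smul_eq_zero h0 _ _)
    have h4 := hφ.extCovec_smul hP₀ ha one_pos
    change fderiv ℝ Φ₀ (a • P₀.1, P₀.2) (horizontal d s v) = _
    rw [hm, ← ContinuousLinearMap.comp_apply, ← h3, h4, ← map_smul, ← map_add]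
    simp
  · have hc : HasDerivAt (fun a : ℝ => ((P₀.1, a • P₀.2) : HomCoord d s)) (0, P₀.2) 1 := by
      have := (hasDerivAt_const (1 : ℝ) P₀.1).prodMk ((hasDerivAt_id (1 : ℝ)).smul_const P₀.2)
      simpa using this
    have hc1 : (fun a : ℝ => ((P₀.1, a • P₀.2) : HomCoord d s)) 1 = P₀ := by simp
    have h1 := HasFDerivAt.comp_hasDerivAt (1 : ℝ) (by simp only [one_smul]; exact hD) hc
    have h2 : HasDerivAt (fun a : ℝ => extCovec φ P₀ (0, v.2) + a • extCovec φ P₀ (v.1, 0))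
        (extCovec φ P₀ (v.1, 0)) 1 := by
      simpa using ((hasDerivAt_id (1 : ℝ)).smul_const (extCovec φ P₀ (v.1, 0))).const_add
        (extCovec φ P₀ (0, v.2))
    refine h1.unique (h2.congr_of_eventuallyEq ?_)
    have hct : ∀ᶠ a : ℝ in 𝓝 1, ((P₀.1, a • P₀.2) : HomCoord d s) ∈ closedCoord d s →
        faceFn f ((P₀.1, a • P₀.2) : HomCoord d s) = 0 → extCovec φ (P₀.1, a • P₀.2) =
          (fderiv ℝ Φ₀ (P₀.1, a • P₀.2)).comp (horizontal d s) :=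
      (hc.continuousAt.tendsto.trans (congrArg 𝓝 hc1).le) hE
    filter_upwards [hpos, hct] with a ha hEa
    have hm : ((P₀.1, a • P₀.2) : HomCoord d s) = ((1 : ℝ) • P₀.1, a • P₀.2) := by rw [one_smul]
    rw [hm] at hEa
    have h3 := hEa ⟨smul_mem_halfSpace hP₀.1 one_pos, smul_mem_halfSpace hP₀.2 ha⟩
      (faceFn_smul_eq_zero h0 _ _)
    have h4 := hφ.extCovec_smul hP₀ one_pos ha
    change fderiv ℝ Φ₀ (P₀.1, a • P₀.2) (horizontal d s v) = _
    rw [hm, ← ContinuousLinearMap.comp_apply, ← h3, h4, ← map_smul, ← map_add]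
    simp

theorem gradX_eq {φ : Euc d × Euc s → ℝ} {p : Euc d × Euc s} (hφ : DifferentiableAt ℝ φ p) :
    gradX φ p = (InnerProductSpace.toDual ℝ (Euc d)).symm
      ((fderiv ℝ φ p).comp (ContinuousLinearMap.inl ℝ _ _)) := by
  have h : HasFDerivAt (fun u => φ (u, p.2))
      ((fderiv ℝ φ p).comp (ContinuousLinearMap.inl ℝ _ _)) p.1 :=
    hφ.hasFDerivAt.comp p.1 (hasFDerivAt_prodMk_left p.1 p.2)
  rw [gradX, gradient, h.fderiv]

theorem gradTheta_eq {φ : Euc d × Euc s → ℝ} {p : Euc d × Euc s} (hφ : DifferentiableAt ℝ φ p) :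
    gradTheta φ p = (InnerProductSpace.toDual ℝ (Euc s)).symm
      ((fderiv ℝ φ p).comp (ContinuousLinearMap.inr ℝ _ _)) := by
  have h : HasFDerivAt (fun w => φ (p.1, w))
      ((fderiv ℝ φ p).comp (ContinuousLinearMap.inr ℝ _ _)) p.2 :=
    hφ.hasFDerivAt.comp p.2 (hasFDerivAt_prodMk_right p.1 p.2)
  rw [gradTheta, gradient, h.fderiv]

theorem covec_comp_inl (φ : Euc d × Euc s → ℝ) (P : HomCoord d s) :
    (covec φ P).comp (ContinuousLinearMap.inl ℝ _ _) =
      P.2.2 • (fderiv ℝ φ (dehomog P)).comp (ContinuousLinearMap.inl ℝ _ _) := by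
  refine ContinuousLinearMap.ext fun u => ?_
  change fderiv ℝ φ (dehomog P) (P.2.2 • u, P.1.2 • 0) = P.2.2 • fderiv ℝ φ (dehomog P) (u, 0)
  rw [← map_smul, Prod.smul_mk, smul_zero, smul_zero]

theorem covec_comp_inr (φ : Euc d × Euc s → ℝ) (P : HomCoord d s) :
    (covec φ P).comp (ContinuousLinearMap.inr ℝ _ _) =
      P.1.2 • (fderiv ℝ φ (dehomog P)).comp (ContinuousLinearMap.inr ℝ _ _) := by
  refine ContinuousLinearMap.ext fun u => ?_
  change fderiv ℝ φ (dehomog P) (P.2.2 • 0, P.1.2 • u) = P.1.2 • fderiv ℝ φ (dehomog P) (0, u)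
  rw [← map_smul, Prod.smul_mk, smul_zero, smul_zero]

theorem sq_mul_jap_sq {n : ℕ} {r : ℝ} (hr : 0 < r) (σ : Euc n) :
    r ^ 2 * jap (r⁻¹ • σ) ^ 2 = r ^ 2 + ‖σ‖ ^ 2 := by
  rw [jap, Real.sq_sqrt (by positivity), norm_smul, Real.norm_of_nonneg (inv_nonneg.2 hr.le)]
  field_simp

theorem smul_gradX_eq {φ : Euc d × Euc s → ℝ} (hφ : ContDiff ℝ ∞ φ) (P : HomCoord d s) :
    P.2.2 • gradX φ (dehomog P) = (InnerProductSpace.toDual ℝ (Euc d)).symm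
      ((covec φ P).comp (ContinuousLinearMap.inl ℝ _ _)) := by
  rw [gradX_eq (hφ.differentiable (by simp) _), covec_comp_inl, map_smulₛₗ]
  rfl

theorem smul_gradTheta_eq {φ : Euc d × Euc s → ℝ} (hφ : ContDiff ℝ ∞ φ) (P : HomCoord d s) :
    P.1.2 • gradTheta φ (dehomog P) = (InnerProductSpace.toDual ℝ (Euc s)).symm
      ((covec φ P).comp (ContinuousLinearMap.inr ℝ _ _)) := by
  rw [gradTheta_eq (hφ.differentiable (by simp) _), covec_comp_inr, map_smulₛₗ]
  rfl

/-- The phase condition at the boundary: the rescaled differential does not vanish there. -/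
theorem IsClassicalPhase.extCovec_inl_ne_zero {φ : Euc d × Euc s → ℝ} (hφ : IsClassicalPhase φ)
    {P : HomCoord d s} (hP : P ∈ closedCoord d s) (hb : P.1.2 = 0 ∨ P.2.2 = 0)
    (hz : (extCovec φ P).comp (ContinuousLinearMap.inr ℝ _ _) = 0) :
    (extCovec φ P).comp (ContinuousLinearMap.inl ℝ _ _) ≠ 0 := by
  obtain ⟨R, hR, c, hc, hel⟩ := hφ.elliptic
  have hne := nhdsWithin_interiorCoord_neBot hP
  have ht := hφ.classical.tendsto_covec hP
  have hfar : ∀ᶠ Q in 𝓝[interiorCoord d s] P, R ≤ ‖(dehomog Q).1‖ + ‖(dehomog Q).2‖ := by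
    have key : ∀ {n : ℕ} {σ : Euc n} {r : ℝ}, 0 < r → r * R < ‖σ‖ → R ≤ ‖r⁻¹ • σ‖ := by
      intro n σ r hr h
      rw [norm_smul, Real.norm_of_nonneg (inv_nonneg.2 hr.le), ← div_eq_inv_mul, le_div_iff₀ hr,
        mul_comm]
      exact h.le
    rcases hb with h | h
    · have hc : Continuous fun Q : HomCoord d s => ‖Q.1.1‖ - Q.1.2 * R := by fun_prop
      have h0 : 0 < ‖P.1.1‖ - P.1.2 * R := by
        rw [h]; simpa using halfSpace_fst_ne_zero hP.1 h
      filter_upwards [(hc.continuousAt.eventually (lt_mem_nhds h0)).filter_mono nhdsWithin_le_nhds,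
        self_mem_nhdsWithin] with Q hQ hQi
      have := key hQi.1 (by linarith : Q.1.2 * R < ‖Q.1.1‖)
      exact this.trans (le_add_of_nonneg_right (norm_nonneg _))
    · have hc : Continuous fun Q : HomCoord d s => ‖Q.2.1‖ - Q.2.2 * R := by fun_prop
      have h0 : 0 < ‖P.2.1‖ - P.2.2 * R := by
        rw [h]; simpa using halfSpace_fst_ne_zero hP.2 h
      filter_upwards [(hc.continuousAt.eventually (lt_mem_nhds h0)).filter_mono nhdsWithin_le_nhds,
        self_mem_nhdsWithin] with Q hQ hQi
      have := key hQi.2 (by linarith : Q.2.2 * R < ‖Q.2.1‖)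
      exact this.trans (le_add_of_nonneg_left (norm_nonneg _))
  have hle : ∀ᶠ Q in 𝓝[interiorCoord d s] P,
      c * ((Q.1.2 ^ 2 + ‖Q.1.1‖ ^ 2) * (Q.2.2 ^ 2 + ‖Q.2.1‖ ^ 2)) ≤
        (Q.1.2 ^ 2 + ‖Q.1.1‖ ^ 2) * ‖(covec φ Q).comp (ContinuousLinearMap.inl ℝ _ _)‖ ^ 2 +
        (Q.2.2 ^ 2 + ‖Q.2.1‖ ^ 2) * ‖(covec φ Q).comp (ContinuousLinearMap.inr ℝ _ _)‖ ^ 2 := by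
    filter_upwards [hfar, self_mem_nhdsWithin] with Q hQ hQi
    have h1 := hel _ _ hQ
    have hX : Q.2.2 ^ 2 * ‖gradX φ (dehomog Q)‖ ^ 2 =
        ‖(covec φ Q).comp (ContinuousLinearMap.inl ℝ _ _)‖ ^ 2 := by
      rw [← (InnerProductSpace.toDual ℝ (Euc d)).symm.norm_map
        ((covec φ Q).comp (ContinuousLinearMap.inl ℝ _ _)),
        ← smul_gradX_eq hφ.classical.symbol.smooth, norm_smul, mul_pow, Real.norm_eq_abs, sq_abs]
    have hΘ : Q.1.2 ^ 2 * ‖gradTheta φ (dehomog Q)‖ ^ 2 =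
        ‖(covec φ Q).comp (ContinuousLinearMap.inr ℝ _ _)‖ ^ 2 := by
      rw [← (InnerProductSpace.toDual ℝ (Euc s)).symm.norm_map
        ((covec φ Q).comp (ContinuousLinearMap.inr ℝ _ _)),
        ← smul_gradTheta_eq hφ.classical.symbol.smooth, norm_smul, mul_pow, Real.norm_eq_abs,
        sq_abs]
    rw [← hX, ← hΘ, ← sq_mul_jap_sq hQi.1, ← sq_mul_jap_sq hQi.2]
    have h2 : 0 ≤ Q.1.2 ^ 2 * Q.2.2 ^ 2 := by positivity
    have h3 := mul_le_mul_of_nonneg_left h1 h2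
    refine le_trans (le_of_eq ?_) (h3.trans (le_of_eq ?_))
    · simp only [dehomog]; ring
    · simp only [dehomog]; ring
  intro hz'
  have hq1 : Tendsto (fun Q : HomCoord d s => Q.1.2 ^ 2 + ‖Q.1.1‖ ^ 2) (𝓝[interiorCoord d s] P)
      (𝓝 (P.1.2 ^ 2 + ‖P.1.1‖ ^ 2)) :=
    ((by fun_prop : Continuous fun Q : HomCoord d s => Q.1.2 ^ 2 + ‖Q.1.1‖ ^ 2).tendsto
      P).mono_left nhdsWithin_le_nhds
  have hq2 : Tendsto (fun Q : HomCoord d s => Q.2.2 ^ 2 + ‖Q.2.1‖ ^ 2) (𝓝[interiorCoord d s] P)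
      (𝓝 (P.2.2 ^ 2 + ‖P.2.1‖ ^ 2)) :=
    ((by fun_prop : Continuous fun Q : HomCoord d s => Q.2.2 ^ 2 + ‖Q.2.1‖ ^ 2).tendsto
      P).mono_left nhdsWithin_le_nhds
  have hl : Tendsto (fun Q => ‖(covec φ Q).comp (ContinuousLinearMap.inl ℝ _ _)‖ ^ 2)
      (𝓝[interiorCoord d s] P) (𝓝 0) := by
    have := ((continuous_id.clm_comp (continuous_const
      (y := ContinuousLinearMap.inl ℝ (Euc d) (Euc s)))).norm.pow 2).tendsto (extCovec φ P)
    have h1 := this.comp ht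
    simpa [hz'] using! h1
  have hr : Tendsto (fun Q => ‖(covec φ Q).comp (ContinuousLinearMap.inr ℝ _ _)‖ ^ 2)
      (𝓝[interiorCoord d s] P) (𝓝 0) := by
    have := ((continuous_id.clm_comp (continuous_const
      (y := ContinuousLinearMap.inr ℝ (Euc d) (Euc s)))).norm.pow 2).tendsto (extCovec φ P)
    have h1 := this.comp ht
    simpa [hz] using! h1
  have hlim := le_of_tendsto_of_tendsto ((hq1.mul hq2).const_mul c)
    ((hq1.mul hl).add (hq2.mul hr)) hle
  have h1 := norm_sq_add_sq_pos hP.1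
  have h2 := norm_sq_add_sq_pos hP.2
  have : 0 < c * ((P.1.2 ^ 2 + ‖P.1.1‖ ^ 2) * (P.2.2 ^ 2 + ‖P.2.1‖ ^ 2)) := by positivity
  simp only [mul_zero, add_zero] at hlim
  linarith

end ExtendedCovector

/-! ### The boundary data in homogeneous coordinates -/

section BallCoordinates

variable {d s : ℕ} (κd : Compactification d) (κs : Compactification s)

/-- Homogeneous coordinates on `𝔹ᵈ × 𝔹ˢ`. -/
def lift₂ (p : Euc d × Euc s) : HomCoord d s := (κd.lift p.1, κs.lift p.2)

/-- The two boundary defining functions `ỹ` and `γ̃` of `𝔹ᵈ × 𝔹ˢ`. -/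
def bdf (i : Fin 2) (p : Euc d × Euc s) : ℝ := ![(κd.lift p.1).2, (κs.lift p.2).2] i

@[simp] theorem bdf_zero (p : Euc d × Euc s) : bdf κd κs 0 p = (κd.lift p.1).2 := rfl

@[simp] theorem bdf_one (p : Euc d × Euc s) : bdf κd κs 1 p = (κs.lift p.2).2 := rfl

/-- The boundary defining functions that vanish on a face. -/
def faceIdx : Face → Finset (Fin 2)
  | .e => {0}
  | .ψ => {1}
  | .ψe => {0, 1}

theorem contDiff_lift₂ : ContDiff ℝ ∞ (lift₂ κd κs) :=
  (κd.contDiff_lift.comp contDiff_fst).prodMk (κs.contDiff_lift.comp contDiff_snd)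

theorem contDiff_bdf (i : Fin 2) : ContDiff ℝ ∞ (bdf κd κs i) := by
  fin_cases i
  · exact (κd.contDiff_lift.comp contDiff_fst).snd
  · exact (κs.contDiff_lift.comp contDiff_snd).snd

theorem mem_cball2_iff {p : Euc d × Euc s} : p ∈ cball2 d s ↔ ‖p.1‖ ≤ 1 ∧ ‖p.2‖ ≤ 1 := by
  simp [cball2, mem_prod]

theorem mem_oball2_iff {p : Euc d × Euc s} : p ∈ oball2 d s ↔ ‖p.1‖ < 1 ∧ ‖p.2‖ < 1 := by
  simp [oball2, mem_prod]

theorem cball2_subset_closure : cball2 d s ⊆ closure (oball2 d s) := by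
  rw [oball2, closure_prod_eq, closure_ball _ one_ne_zero, closure_ball _ one_ne_zero]
  exact subset_rfl

theorem isCompact_cball2 : IsCompact (cball2 d s) :=
  (isCompact_closedBall _ _).prod (isCompact_closedBall _ _)

theorem uniqueDiffOn_cball2 : UniqueDiffOn ℝ (cball2 d s) := by
  refine UniqueDiffOn.prod ?_ ?_ <;>
  exact uniqueDiffOn_convex (convex_closedBall _ _)
    ⟨0, by rw [interior_closedBall _ one_ne_zero]; exact mem_ball_self one_pos⟩

theorem mem_closedFace_iff' {f : Face} {p : Euc d × Euc s} :
    p ∈ closedFace d s f ↔ p ∈ cball2 d s ∧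
      (0 ∈ faceIdx f → ‖p.1‖ = 1) ∧ (1 ∈ faceIdx f → ‖p.2‖ = 1) := by
  cases f <;>
  simp only [closedFace, cball2, faceIdx, mem_prod, mem_sphere_zero_iff_norm,
    mem_closedBall_zero_iff, Finset.mem_singleton, Finset.mem_insert, zero_ne_one, one_ne_zero,
    or_true, or_false, forall_true_left, IsEmpty.forall_iff, and_true, true_and]
  · exact ⟨fun h => ⟨⟨h.1.le, h.2⟩, h.1⟩, fun h => ⟨h.2, h.1.2⟩⟩
  · exact ⟨fun h => ⟨⟨h.1, h.2.le⟩, h.2⟩, fun h => ⟨h.1.1, h.2⟩⟩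
  · exact ⟨fun h => ⟨⟨h.1.le, h.2.le⟩, h⟩, fun h => h.2⟩

theorem mem_openFace_iff' {f : Face} {p : Euc d × Euc s} :
    p ∈ openFace d s f ↔ p ∈ cball2 d s ∧
      (0 ∈ faceIdx f ↔ ‖p.1‖ = 1) ∧ (1 ∈ faceIdx f ↔ ‖p.2‖ = 1) := by
  cases f <;>
  simp only [openFace, cball2, faceIdx, mem_prod, mem_sphere_zero_iff_norm, mem_ball_zero_iff,
    mem_closedBall_zero_iff, Finset.mem_singleton, Finset.mem_insert, zero_ne_one, one_ne_zero,
    or_true, or_false, true_iff, false_iff]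
  · exact ⟨fun h => ⟨⟨h.1.le, h.2.le⟩, h.1, h.2.ne⟩, fun h => ⟨h.2.1, lt_of_le_of_ne h.1.2 h.2.2⟩⟩
  · exact ⟨fun h => ⟨⟨h.1.le, h.2.le⟩, h.1.ne, h.2⟩, fun h => ⟨lt_of_le_of_ne h.1.1 h.2.1, h.2.2⟩⟩
  · exact ⟨fun h => ⟨⟨h.1.le, h.2.le⟩, h⟩, fun h => h.2⟩

theorem openFace_subset_closedFace {f g : Face} (h : faceIdx f ⊆ faceIdx g) :
    openFace d s g ⊆ closedFace d s f := by
  intro p hp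
  rw [mem_openFace_iff'] at hp
  rw [mem_closedFace_iff']
  exact ⟨hp.1, fun h0 => hp.2.1.1 (h h0), fun h0 => hp.2.2.1 (h h0)⟩

theorem closedFace_subset_cball2 (f : Face) : closedFace d s f ⊆ cball2 d s :=
  fun _ hp => (mem_closedFace_iff'.1 hp).1

theorem isClosed_closedFace (f : Face) : IsClosed (closedFace d s f) := by
  cases f
  · exact isClosed_sphere.prod isClosed_closedBall
  · exact isClosed_closedBall.prod isClosed_sphere
  · exact isClosed_sphere.prod isClosed_sphere

theorem mem_bdry_iff {p : Euc d × Euc s} :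
    p ∈ bdry d s ↔ p ∈ cball2 d s ∧ (‖p.1‖ = 1 ∨ ‖p.2‖ = 1) := by
  constructor
  · rintro ⟨f, hf⟩
    rw [mem_openFace_iff'] at hf
    refine ⟨hf.1, ?_⟩
    cases f
    · exact Or.inl (hf.2.1.1 (by simp [faceIdx]))
    · exact Or.inr (hf.2.2.1 (by simp [faceIdx]))
    · exact Or.inl (hf.2.1.1 (by simp [faceIdx]))
  · rintro ⟨hp, h⟩
    by_cases h1 : ‖p.1‖ = 1
    · by_cases h2 : ‖p.2‖ = 1
      · exact ⟨.ψe, mem_openFace_iff'.2 ⟨hp, by simp [faceIdx, h1], by simp [faceIdx, h2]⟩⟩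
      · exact ⟨.e, mem_openFace_iff'.2 ⟨hp, by simp [faceIdx, h1], by simp [faceIdx, h2]⟩⟩
    · have h2 : ‖p.2‖ = 1 := h.resolve_left h1
      exact ⟨.ψ, mem_openFace_iff'.2 ⟨hp, by simp [faceIdx, h1], by simp [faceIdx, h2]⟩⟩

theorem bdry_eq_union : bdry d s = closedFace d s .e ∪ closedFace d s .ψ := by
  ext p
  rw [mem_bdry_iff, mem_union, mem_closedFace_iff', mem_closedFace_iff']
  simp [faceIdx]
  tauto

theorem closedFace_inter : closedFace d s .e ∩ closedFace d s .ψ = closedFace d s .ψe := by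
  ext p
  rw [mem_inter_iff, mem_closedFace_iff', mem_closedFace_iff', mem_closedFace_iff']
  simp [faceIdx]
  tauto

theorem closedFace_subset_bdry (f : Face) : closedFace d s f ⊆ bdry d s := by
  intro p hp
  rw [mem_closedFace_iff'] at hp
  rw [mem_bdry_iff]
  cases f <;> simp [faceIdx] at hp <;> tauto

theorem isClosed_bdry : IsClosed (bdry d s) := by
  rw [bdry_eq_union]
  exact (isClosed_closedFace _).union (isClosed_closedFace _)

theorem mem_cball2_iff_bdf (hd : 0 < d) (hs : 0 < s) {p : Euc d × Euc s} :
    p ∈ cball2 d s ↔ ∀ i, 0 ≤ bdf κd κs i p := by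
  rw [mem_cball2_iff, Fin.forall_fin_two, bdf_zero, bdf_one, κd.lift_snd_nonneg_iff hd,
    κs.lift_snd_nonneg_iff hs]

theorem mem_closedFace_iff (hd : 0 < d) (hs : 0 < s) {f : Face} {p : Euc d × Euc s} :
    p ∈ closedFace d s f ↔
      (∀ i ∈ faceIdx f, bdf κd κs i p = 0) ∧ ∀ i, 0 ≤ bdf κd κs i p := by
  rw [mem_closedFace_iff', ← mem_cball2_iff_bdf κd κs hd hs, Fin.forall_fin_two, bdf_zero, bdf_one,
    κd.lift_snd_eq_zero_iff hd, κs.lift_snd_eq_zero_iff hs]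
  tauto

theorem mem_openFace_iff (hd : 0 < d) (hs : 0 < s) {f : Face} {p : Euc d × Euc s} :
    p ∈ openFace d s f ↔
      (∀ i, i ∈ faceIdx f ↔ bdf κd κs i p = 0) ∧ ∀ i, 0 ≤ bdf κd κs i p := by
  rw [mem_openFace_iff', ← mem_cball2_iff_bdf κd κs hd hs, Fin.forall_fin_two, bdf_zero, bdf_one,
    κd.lift_snd_eq_zero_iff hd, κs.lift_snd_eq_zero_iff hs]
  tauto

theorem lift₂_mem_closedCoord (hd : 0 < d) (hs : 0 < s) {p : Euc d × Euc s}
    (hp : p ∈ cball2 d s) : lift₂ κd κs p ∈ closedCoord d s := by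
  rw [mem_cball2_iff] at hp
  exact ⟨κd.lift_mem_halfSpace hd hp.1, κs.lift_mem_halfSpace hs hp.2⟩

theorem lift₂_mem_interiorCoord (hd : 0 < d) (hs : 0 < s) {p : Euc d × Euc s}
    (hp : p ∈ oball2 d s) : lift₂ κd κs p ∈ interiorCoord d s := by
  rw [mem_oball2_iff] at hp
  exact ⟨κd.lift_snd_pos hd hp.1, κs.lift_snd_pos hs hp.2⟩

theorem dehomog_lift₂ (hd : 0 < d) (hs : 0 < s) {p : Euc d × Euc s} (hp : p ∈ oball2 d s) :
    dehomog (lift₂ κd κs p) = (κd.invFun p.1, κs.invFun p.2) := by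
  have hP := lift₂_mem_interiorCoord κd κs hd hs hp
  rw [mem_oball2_iff] at hp
  have h1 := hP.1.ne'
  have h2 := hP.2.ne'
  rw [lift₂, κd.lift_of_lt hp.1, κs.lift_of_lt hp.2] at h1 h2 ⊢
  simp only [dehomog, smul_smul]
  rw [inv_mul_cancel₀ h1, inv_mul_cancel₀ h2, one_smul, one_smul]

theorem tendsto_lift₂ (hd : 0 < d) (hs : 0 < s) (p : Euc d × Euc s) :
    Tendsto (lift₂ κd κs) (𝓝[oball2 d s] p) (𝓝[interiorCoord d s] (lift₂ κd κs p)) := by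
  refine tendsto_nhdsWithin_iff.2 ⟨?_, ?_⟩
  · exact ((contDiff_lift₂ κd κs).continuous.tendsto p).mono_left nhdsWithin_le_nhds
  · filter_upwards [self_mem_nhdsWithin] with q hq
    exact lift₂_mem_interiorCoord κd κs hd hs hq

/-- The homogeneous coordinates `(r ∇ₓφ, r)` of `∇ₓφ(x, θ)`, up to the boundary. -/
def fiberCoord (φ : Euc d × Euc s → ℝ) (P : HomCoord d s) : Euc d × ℝ :=
  ((InnerProductSpace.toDual ℝ (Euc d)).symm
    ((extCovec φ P).comp (ContinuousLinearMap.inl ℝ _ _)), P.2.2)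

variable {κd κs} {φ : Euc d × Euc s → ℝ}

theorem thetaDeriv_eq (hd : 0 < d) (hs : 0 < s) (hφ : IsClassical 1 1 φ) (j : Fin s)
    {p : Euc d × Euc s} (hp : p ∈ cball2 d s) :
    thetaDeriv κd κs φ j p = extCovec φ (lift₂ κd κs p) (0, EuclideanSpace.single j 1) := by
  refine extendFrom_eq (cball2_subset_closure hp) ?_
  have h1 := (hφ.tendsto_covec (lift₂_mem_closedCoord κd κs hd hs hp)).comp
    (tendsto_lift₂ κd κs hd hs p)
  have h2 := ((ContinuousLinearMap.apply ℝ ℝ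
    ((0, EuclideanSpace.single j 1) : Euc d × Euc s)).continuous.tendsto _).comp h1
  refine h2.congr' ?_
  filter_upwards [self_mem_nhdsWithin] with q hq
  have hdh := dehomog_lift₂ κd κs hd hs hq
  have hg := smul_gradTheta_eq hφ.symbol.smooth (lift₂ κd κs q)
  have hρ : (lift₂ κd κs q).1.2 = 1 - κd.h q.1 := by
    rw [lift₂, κd.lift_of_lt (mem_oball2_iff.1 hq).1]
  rw [hρ, hdh] at hg
  rw [Real.rpow_one, Real.rpow_zero, mul_one]
  have h3 : (1 - κd.h q.1) * (gradTheta φ (κd.invFun q.1, κs.invFun q.2)) j =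
      inner ℝ ((1 - κd.h q.1) • gradTheta φ (κd.invFun q.1, κs.invFun q.2))
        (EuclideanSpace.single j (1 : ℝ)) := by
    rw [EuclideanSpace.inner_single_right]
    simp
  rw [h3, hg, InnerProductSpace.toDual_symm_apply]
  rfl

theorem continuousAt_fiberCoord_within (hφ : IsClassical 1 1 φ) {P : HomCoord d s}
    (hP : P ∈ closedCoord d s) : ContinuousWithinAt (fiberCoord φ) (closedCoord d s) P := by
  refine ContinuousWithinAt.prodMk ?_ continuous_snd.snd.continuousWithinAt
  refine
    (InnerProductSpace.toDual ℝ (Euc d)).symm.continuous.continuousAt.comp_continuousWithinAt ?_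
  exact (hφ.continuousOn_extCovec P hP).clm_comp continuousWithinAt_const

theorem tendsto_lambda (hd : 0 < d) (hs : 0 < s) (hφ : IsClassical 1 1 φ)
    {p : Euc d × Euc s} (hp : p ∈ cball2 d s) (hG : fiberCoord φ (lift₂ κd κs p) ∈ halfSpace d) :
    Tendsto (fun q : Euc d × Euc s => (κd.toFun (κd.invFun q.1),
      κd.toFun (gradX φ (κd.invFun q.1, κs.invFun q.2)))) (𝓝[oball2 d s] p)
      (𝓝 (p.1, κd.proj (fiberCoord φ (lift₂ κd κs p)))) := by
  have hP := lift₂_mem_closedCoord κd κs hd hs hp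
  have h1 : Tendsto (fun q => fiberCoord φ (lift₂ κd κs q)) (𝓝[oball2 d s] p)
      (𝓝 (fiberCoord φ (lift₂ κd κs p))) :=
    ((continuousAt_fiberCoord_within hφ hP).mono interiorCoord_subset_closedCoord).tendsto.comp
      (tendsto_lift₂ κd κs hd hs p)
  have h2 := ((κd.smoothNear_proj hG).continuousAt.tendsto).comp h1
  have h3 : Tendsto (fun q : Euc d × Euc s => q.1) (𝓝[oball2 d s] p) (𝓝 p.1) :=
    (continuous_fst.tendsto p).mono_left nhdsWithin_le_nhds
  refine (h3.prodMk_nhds h2).congr' ?_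
  filter_upwards [self_mem_nhdsWithin] with q hq
  have hQ := lift₂_mem_interiorCoord κd κs hd hs hq
  have hdh := dehomog_lift₂ κd κs hd hs hq
  refine Prod.ext ?_ ?_
  · exact (κd.right_inv q.1 (by simpa using (mem_oball2_iff.1 hq).1)).symm
  · change κd.proj (fiberCoord φ (lift₂ κd κs q)) = _
    have hr : 0 < (fiberCoord φ (lift₂ κd κs q)).2 := hQ.2
    rw [κd.proj_of_pos hr, fiberCoord, hφ.extCovec_eq hQ, ← smul_gradX_eq hφ.symbol.smooth, hdh,
      smul_smul, inv_mul_cancel₀ hQ.2.ne', one_smul]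

theorem lambdaTilde_eq (hd : 0 < d) (hs : 0 < s) (hφ : IsClassical 1 1 φ)
    {p : Euc d × Euc s} (hp : p ∈ cball2 d s) (hG : fiberCoord φ (lift₂ κd κs p) ∈ halfSpace d) :
    lambdaTilde κd κs φ p = (p.1, κd.proj (fiberCoord φ (lift₂ κd κs p))) :=
  extendFrom_eq (cball2_subset_closure hp) (tendsto_lambda hd hs hφ hp hG)

/-- `C̃_φ` is the set of boundary points at which the `θ`-part of the rescaled differential
vanishes: its square is, up to a positive factor, the function attached to `⟨θ⟩² |∇_θ φ|²`. -/
theorem mem_critSet_iff (hd : 0 < d) (hs : 0 < s) (hφ : IsClassical 1 1 φ)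
    {p : Euc d × Euc s} : p ∈ critSet κd κs φ ↔ p ∈ bdry d s ∧
      (extCovec φ (lift₂ κd κs p)).comp (ContinuousLinearMap.inr ℝ _ _) = 0 := by
  refine and_congr_right fun hb => ?_
  have hp : p ∈ cball2 d s := (mem_bdry_iff.1 hb).1
  have hP := lift₂_mem_closedCoord κd κs hd hs hp
  rw [EllipticAt, not_not]
  have key : iotaSG κd κs 2 2 (fun q => ‖jap q.2 • gradTheta φ q‖ ^ 2) p =
      ((lift₂ κd κs p).2.2 ^ 2 + ‖(lift₂ κd κs p).2.1‖ ^ 2) *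
      ‖(extCovec φ (lift₂ κd κs p)).comp (ContinuousLinearMap.inr ℝ _ _)‖ ^ 2 := by
    refine extendFrom_eq (cball2_subset_closure hp) ?_
    have h1 := (hφ.tendsto_covec hP).comp (tendsto_lift₂ κd κs hd hs p)
    have h2 := (((continuous_id.clm_comp (continuous_const
      (y := ContinuousLinearMap.inr ℝ (Euc d) (Euc s)))).norm.pow 2).tendsto
        (extCovec φ (lift₂ κd κs p))).comp h1
    have h3 : Tendsto (fun q => (lift₂ κd κs q).2.2 ^ 2 + ‖(lift₂ κd κs q).2.1‖ ^ 2)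
        (𝓝[oball2 d s] p) (𝓝 ((lift₂ κd κs p).2.2 ^ 2 + ‖(lift₂ κd κs p).2.1‖ ^ 2)) := by
      have hc : Continuous fun P : HomCoord d s => P.2.2 ^ 2 + ‖P.2.1‖ ^ 2 := by fun_prop
      exact ((hc.comp (contDiff_lift₂ κd κs).continuous).tendsto p).mono_left nhdsWithin_le_nhds
    refine (h3.mul h2).congr' ?_
    filter_upwards [self_mem_nhdsWithin] with q hq
    have hQ := lift₂_mem_interiorCoord κd κs hd hs hq
    have hdh := dehomog_lift₂ κd κs hd hs hq
    have hg := smul_gradTheta_eq hφ.symbol.smooth (lift₂ κd κs q)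
    have hρ : (lift₂ κd κs q).1.2 = 1 - κd.h q.1 := by
      rw [lift₂, κd.lift_of_lt (mem_oball2_iff.1 hq).1]
    have hr : (lift₂ κd κs q).2.2 = 1 - κs.h q.2 := by
      rw [lift₂, κs.lift_of_lt (mem_oball2_iff.1 hq).2]
    have hj := sq_mul_jap_sq hQ.2 (lift₂ κd κs q).2.1
    have hdh2 : (lift₂ κd κs q).2.2⁻¹ • (lift₂ κd κs q).2.1 = κs.invFun q.2 :=
      congrArg Prod.snd hdh
    have hn : ‖(covec φ (lift₂ κd κs q)).comp (ContinuousLinearMap.inr ℝ _ _)‖ =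
        ‖(lift₂ κd κs q).1.2 • gradTheta φ (dehomog (lift₂ κd κs q))‖ := by
      rw [hg, LinearIsometryEquiv.norm_map]
    change ((lift₂ κd κs q).2.2 ^ 2 + ‖(lift₂ κd κs q).2.1‖ ^ 2) *
      ‖(covec φ (lift₂ κd κs q)).comp (ContinuousLinearMap.inr ℝ _ _)‖ ^ 2 = _
    rw [hn, ← hj, hdh2, hdh, hρ, hr, norm_smul, norm_smul, Real.norm_of_nonneg (jap_pos _).le,
      Real.rpow_two, Real.rpow_two, mul_pow, mul_pow, Real.norm_eq_abs, sq_abs]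
    ring
  have hpos := norm_sq_add_sq_pos hP.2
  rw [key, mul_eq_zero, or_iff_right hpos.ne', sq_eq_zero_iff, norm_eq_zero]

/-- By the phase condition `(r ∇ₓφ, r)` are homogeneous coordinates of a point of `𝔹ᵈ`, also
where `r = 0`. -/
theorem fiberCoord_mem_halfSpace (hd : 0 < d) (hs : 0 < s) (hφ : IsClassicalPhase φ)
    {p : Euc d × Euc s} (hp : p ∈ critSet κd κs φ) :
    fiberCoord φ (lift₂ κd κs p) ∈ halfSpace d := by
  obtain ⟨hb, hz⟩ := (mem_critSet_iff hd hs hφ.classical).1 hp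
  obtain ⟨hp, hb'⟩ := mem_bdry_iff.1 hb
  have hP := lift₂_mem_closedCoord κd κs hd hs hp
  have hb2 : (lift₂ κd κs p).1.2 = 0 ∨ (lift₂ κd κs p).2.2 = 0 :=
    hb'.imp (κd.lift_snd_eq_zero_iff hd).2 (κs.lift_snd_eq_zero_iff hs).2
  have hne := hφ.extCovec_inl_ne_zero hP hb2 hz
  rcases (halfSpace_snd_nonneg hP.2).lt_or_eq with h | h
  · exact Or.inl h
  · refine Or.inr ⟨h.symm, ?_⟩
    rwa [fiberCoord, Ne, LinearIsometryEquiv.map_eq_zero_iff]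

theorem isClosed_critSet (hd : 0 < d) (hs : 0 < s) (hφ : IsClassical 1 1 φ) :
    IsClosed (critSet κd κs φ) := by
  have h1 : critSet κd κs φ = bdry d s ∩ (fun p =>
      (extCovec φ (lift₂ κd κs p)).comp (ContinuousLinearMap.inr ℝ (Euc d) (Euc s))) ⁻¹' {0} := by
    ext p
    exact mem_critSet_iff hd hs hφ
  rw [h1]
  refine ContinuousOn.preimage_isClosed_of_isClosed ?_ isClosed_bdry isClosed_singleton
  intro p hp
  have hp' : p ∈ cball2 d s := (mem_bdry_iff.1 hp).1
  refine ContinuousWithinAt.clm_comp ?_ continuousWithinAt_const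
  refine ContinuousWithinAt.comp (t := closedCoord d s)
    (hφ.continuousOn_extCovec _ (lift₂_mem_closedCoord κd κs hd hs hp'))
    (contDiff_lift₂ κd κs).continuous.continuousWithinAt ?_
  intro q hq
  exact lift₂_mem_closedCoord κd κs hd hs (mem_bdry_iff.1 hq).1

theorem isCompact_critSet (hd : 0 < d) (hs : 0 < s) (hφ : IsClassical 1 1 φ) :
    IsCompact (critSet κd κs φ) :=
  isCompact_cball2.of_isClosed_subset (isClosed_critSet hd hs hφ)
    fun _ hp => (mem_bdry_iff.1 hp.1).1

theorem continuousOn_lambdaTilde (hd : 0 < d) (hs : 0 < s) (hφ : IsClassicalPhase φ) :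
    ContinuousOn (lambdaTilde κd κs φ) (critSet κd κs φ) := by
  intro p hp
  have hsub : critSet κd κs φ ⊆ cball2 d s := fun q hq => (mem_bdry_iff.1 hq.1).1
  have hP := lift₂_mem_closedCoord κd κs hd hs (hsub hp)
  have h1 : ContinuousWithinAt (fun p => (p.1, κd.proj (fiberCoord φ (lift₂ κd κs p))))
      (critSet κd κs φ) p := by
    refine continuous_fst.continuousWithinAt.prodMk ?_
    refine ContinuousAt.comp_continuousWithinAt (g := κd.proj)
      (κd.smoothNear_proj (fiberCoord_mem_halfSpace hd hs hφ hp)).continuousAt ?_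
    refine ContinuousWithinAt.comp (t := closedCoord d s)
      (continuousAt_fiberCoord_within hφ.classical hP)
      (contDiff_lift₂ κd κs).continuous.continuousWithinAt ?_
    exact fun q hq => lift₂_mem_closedCoord κd κs hd hs (hsub hq)
  refine h1.congr (fun q hq => ?_) ?_
  · exact lambdaTilde_eq hd hs hφ.classical (hsub hq) (fiberCoord_mem_halfSpace hd hs hφ hq)
  · exact lambdaTilde_eq hd hs hφ.classical (hsub hp) (fiberCoord_mem_halfSpace hd hs hφ hp)

end BallCoordinates

/-! ### The immersion property -/

theorem eventually_mem_halfSpace {n : ℕ} {P : Euc n × ℝ} (hP : P ∈ halfSpace n) :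
    ∀ᶠ Q in 𝓝 P, 0 ≤ Q.2 → Q ∈ halfSpace n := by
  rcases hP with h | ⟨-, h⟩
  · filter_upwards [continuous_snd.continuousAt.eventually (lt_mem_nhds h)] with Q hQ _
    exact Or.inl hQ
  · filter_upwards [continuous_fst.continuousAt.eventually (isOpen_ne.mem_nhds h)] with Q hQ hQ'
    rcases hQ'.lt_or_eq with h | h
    · exact Or.inl h
    · exact Or.inr ⟨h.symm, hQ⟩

/-- `proj` is homogeneous of degree `0`. -/
theorem Compactification.fderiv_proj_self {n : ℕ} (κ : Compactification n) {P : Euc n × ℝ}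
    (hP : P ∈ halfSpace n) : fderiv ℝ κ.proj P P = 0 := by
  have h1 : HasFDerivAt κ.proj (fderiv ℝ κ.proj P) ((1 : ℝ) • P) := by
    rw [one_smul]; exact (κ.smoothNear_proj hP).hasFDerivAt
  have hc : HasDerivAt (fun t : ℝ => t • P) P 1 := by
    simpa using (hasDerivAt_id (1 : ℝ)).smul_const P
  refine (h1.comp_hasDerivAt (1 : ℝ) hc).unique
    ((hasDerivAt_const (1 : ℝ) (κ.proj P)).congr_of_eventuallyEq ?_)
  filter_upwards [lt_mem_nhds (one_pos : (0 : ℝ) < 1)] with t ht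
  rw [Function.comp]
  rcases hP with h | ⟨h, h'⟩
  · rw [κ.proj_of_pos h, κ.proj_of_pos (show 0 < (t • P).2 from mul_pos ht h)]
    congr 1
    simp only [Prod.smul_fst, Prod.smul_snd, smul_eq_mul, smul_smul, mul_inv]
    congr 1
    field_simp
  · have h0 : (t • P).2 = 0 := by simp [h]
    have h0' : (t • P).1 ≠ 0 := smul_ne_zero ht.ne' h'
    rw [κ.proj_of_lt h' (by rw [h]; simpa using h'), κ.proj_of_lt h0' (by rw [h0]; simpa using h0'),
      h0, h]
    simp only [zero_mul, sub_zero, Prod.smul_fst, norm_smul, Real.norm_of_nonneg ht.le, smul_smul,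
      mul_inv]
    congr 1
    field_simp

section Covectors

variable {d s : ℕ}

/-- The vector representing the first component of a covector. -/
def horizVec (d s : ℕ) : (Euc d × Euc s →L[ℝ] ℝ) →L[ℝ] Euc d :=
  LinearMap.mkContinuous
    { toFun := fun L => (InnerProductSpace.toDual ℝ (Euc d)).symm
        (L.comp (ContinuousLinearMap.inl ℝ _ _))
      map_add' := fun L M => by rw [ContinuousLinearMap.add_comp, map_add]
      map_smul' := fun c L => by rw [ContinuousLinearMap.smul_comp, map_smulₛₗ]; rfl } 1
    fun L => by
      change ‖(InnerProductSpace.toDual ℝ (Euc d)).symm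
        (L.comp (ContinuousLinearMap.inl ℝ _ _))‖ ≤ _
      rw [LinearIsometryEquiv.norm_map, mul_comm]
      exact (ContinuousLinearMap.opNorm_comp_le _ _).trans
        (mul_le_mul_of_nonneg_left (ContinuousLinearMap.norm_inl_le_one _ _ _) (norm_nonneg _))

theorem horizVec_apply (L : Euc d × Euc s →L[ℝ] ℝ) :
    horizVec d s L = (InnerProductSpace.toDual ℝ (Euc d)).symm
      (L.comp (ContinuousLinearMap.inl ℝ _ _)) := rfl

theorem inner_horizVec (L : Euc d × Euc s →L[ℝ] ℝ) (u : Euc d) :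
    inner ℝ (horizVec d s L) u = L (u, 0) := by
  rw [horizVec_apply, InnerProductSpace.toDual_symm_apply]
  rfl

/-- The coordinates of the second component of a covector. -/
def thetaVec (d s : ℕ) : (Euc d × Euc s →L[ℝ] ℝ) →L[ℝ] (Fin s → ℝ) :=
  ContinuousLinearMap.pi fun j =>
    ContinuousLinearMap.apply ℝ ℝ ((0, EuclideanSpace.single j 1) : Euc d × Euc s)

theorem apply_zero_prod_eq_sum (L : Euc d × Euc s →L[ℝ] ℝ) (w : Euc s) :
    L (0, w) = ∑ j, w j * thetaVec d s L j := by
  have hw : w = ∑ j, w j • EuclideanSpace.single j (1 : ℝ) := by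
    ext i
    simp [Finset.sum_apply, Pi.single_apply]
  have : L (0, w) = L.comp (ContinuousLinearMap.inr ℝ _ _) w := rfl
  rw [this]
  conv_lhs => rw [hw]
  rw [map_sum]
  refine Finset.sum_congr rfl fun j _ => ?_
  rw [map_smul, smul_eq_mul]
  rfl

theorem thetaVec_eq_zero_iff {L : Euc d × Euc s →L[ℝ] ℝ} :
    thetaVec d s L = 0 ↔ L.comp (ContinuousLinearMap.inr ℝ _ _) = 0 := by
  constructor
  · intro h
    refine ContinuousLinearMap.ext fun w => ?_
    change L (0, w) = 0
    rw [apply_zero_prod_eq_sum, h]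
    simp
  · intro h
    funext j
    exact DFunLike.congr_fun h (EuclideanSpace.single j 1)

variable (κd : Compactification d) (κs : Compactification s)

/-- Homogeneous coordinates of a point of the fibre `𝔹ᵈ`, for a field `c` of covectors. -/
def fiberOf (c : Euc d × Euc s → (Euc d × Euc s →L[ℝ] ℝ)) (p : Euc d × Euc s) : Euc d × ℝ :=
  (horizVec d s (c p), (κs.lift p.2).2)

/-- The map `(y, γ) ↦ (y, η)` determined by a field `c` of covectors; for the rescaled differential
of `φ` this is `λ̃_φ`. -/
def covecMap (c : Euc d × Euc s → (Euc d × Euc s →L[ℝ] ℝ)) (p : Euc d × Euc s) : Euc d × Euc d :=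
  (p.1, κd.proj (fiberOf κs c p))

/-- The leading term of an expansion of the rescaled differential. -/
def leadingCovec (Φ : HomCoord d s → ℝ) (p : Euc d × Euc s) : Euc d × Euc s →L[ℝ] ℝ :=
  (fderiv ℝ Φ (lift₂ κd κs p)).comp (horizontal d s)

variable {κd κs}

theorem smoothNear_leadingCovec {Φ : HomCoord d s → ℝ} {p : Euc d × Euc s}
    (hΦ : SmoothNear Φ (lift₂ κd κs p)) : SmoothNear (leadingCovec κd κs Φ) p := by
  have h1 : SmoothNear (fun v => fderiv ℝ Φ (lift₂ κd κs v)) p :=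
    SmoothNear.comp (g := fderiv ℝ Φ) (f := lift₂ κd κs) hΦ.smoothNear_fderiv
      ((contDiff_lift₂ κd κs).smoothNear p)
  filter_upwards [h1] with v hv
  exact hv.clm_comp contDiffAt_const

theorem fderiv_leadingCovec {Φ : HomCoord d s → ℝ} {p : Euc d × Euc s}
    (hΦ : SmoothNear Φ (lift₂ κd κs p)) (v w : Euc d × Euc s) :
    fderiv ℝ (leadingCovec κd κs Φ) p v w =
      fderiv ℝ (fderiv ℝ Φ) (lift₂ κd κs p) (fderiv ℝ (lift₂ κd κs) p v) (horizontal d s w) := by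
  have h1 : HasFDerivAt (fun v => fderiv ℝ Φ (lift₂ κd κs v))
      ((fderiv ℝ (fderiv ℝ Φ) (lift₂ κd κs p)).comp (fderiv ℝ (lift₂ κd κs) p)) p :=
    HasFDerivAt.comp p hΦ.smoothNear_fderiv.hasFDerivAt
      ((contDiff_lift₂ κd κs).smoothNear p).hasFDerivAt
  have h2 := h1.clm_comp (hasFDerivAt_const (horizontal d s) p)
  have h3 : fderiv ℝ (leadingCovec κd κs Φ) p = _ := h2.fderiv
  rw [h3]
  simp

theorem smoothNear_bdf (i : Fin 2) (p : Euc d × Euc s) : SmoothNear (bdf κd κs i) p :=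
  (contDiff_bdf κd κs i).smoothNear p

theorem smoothNear_fiberOf {c : Euc d × Euc s → (Euc d × Euc s →L[ℝ] ℝ)} {p : Euc d × Euc s}
    (hc : SmoothNear c p) : SmoothNear (fiberOf κs c) p := by
  refine SmoothNear.prodMk ?_ ((κs.contDiff_lift.comp contDiff_snd).snd.smoothNear p)
  exact SmoothNear.comp (g := fun L => horizVec d s L) (SmoothNear.clm _ _) hc

theorem smoothNear_covecMap {c : Euc d × Euc s → (Euc d × Euc s →L[ℝ] ℝ)} {p : Euc d × Euc s}
    (hc : SmoothNear c p) (hG : fiberOf κs c p ∈ halfSpace d) :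
    SmoothNear (covecMap κd κs c) p := by
  refine SmoothNear.prodMk (contDiff_fst.smoothNear p) ?_
  exact SmoothNear.comp (g := κd.proj) (κd.smoothNear_proj hG) (smoothNear_fiberOf hc)

theorem fderiv_covecMap {c : Euc d × Euc s → (Euc d × Euc s →L[ℝ] ℝ)} {p : Euc d × Euc s}
    (hc : SmoothNear c p) (hG : fiberOf κs c p ∈ halfSpace d) (v : Euc d × Euc s) :
    fderiv ℝ (covecMap κd κs c) p v = (v.1, fderiv ℝ κd.proj (fiberOf κs c p)
      (horizVec d s (fderiv ℝ c p v), (fderiv ℝ κs.lift p.2 v.2).2)) := by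
  have h1 : HasFDerivAt (fun p => horizVec d s (c p)) ((horizVec d s).comp (fderiv ℝ c p)) p :=
    (horizVec d s).hasFDerivAt.comp p hc.hasFDerivAt
  have h2 : HasFDerivAt (fun p : Euc d × Euc s => κs.lift p.2)
      ((fderiv ℝ κs.lift p.2).comp (ContinuousLinearMap.snd ℝ _ _)) p :=
    (κs.smoothNear_lift p.2).hasFDerivAt.comp p hasFDerivAt_snd
  have h3 : HasFDerivAt (fiberOf κs c) _ p := h1.prodMk h2.snd
  have h4 : HasFDerivAt (covecMap κd κs c) _ p :=
    hasFDerivAt_fst.prodMk ((κd.smoothNear_proj hG).hasFDerivAt.comp p h3)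
  rw [h4.fderiv]
  rfl

theorem fderiv_lift₂ (p v : Euc d × Euc s) :
    fderiv ℝ (lift₂ κd κs) p v = (fderiv ℝ κd.lift p.1 v.1, fderiv ℝ κs.lift p.2 v.2) := by
  have h : HasFDerivAt (lift₂ κd κs) _ p :=
    ((κd.smoothNear_lift p.1).hasFDerivAt.comp p hasFDerivAt_fst).prodMk
      ((κs.smoothNear_lift p.2).hasFDerivAt.comp p hasFDerivAt_snd)
  rw [h.fderiv]
  rfl

theorem fderiv_bdf_zero (p v : Euc d × Euc s) :
    fderiv ℝ (bdf κd κs 0) p v = (fderiv ℝ κd.lift p.1 v.1).2 := by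
  have h : HasFDerivAt (bdf κd κs 0) _ p :=
    ((κd.smoothNear_lift p.1).hasFDerivAt.comp p hasFDerivAt_fst).snd
  rw [h.fderiv]
  rfl

theorem fderiv_bdf_one (p v : Euc d × Euc s) :
    fderiv ℝ (bdf κd κs 1) p v = (fderiv ℝ κs.lift p.2 v.2).2 := by
  have h : HasFDerivAt (bdf κd κs 1) _ p :=
    ((κs.smoothNear_lift p.2).hasFDerivAt.comp p hasFDerivAt_snd).snd
  rw [h.fderiv]
  rfl

/-- The boundary defining functions have independent differentials where they vanish. -/
theorem exists_fderiv_bdf_eq (hd : 0 < d) (hs : 0 < s) (p : Euc d × Euc s) (a : Fin 2 → ℝ) :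
    ∃ v, ∀ i, bdf κd κs i p = 0 → fderiv ℝ (bdf κd κs i) p v = a i := by
  have key : ∀ {n : ℕ} (κ : Compactification n) (y : Euc n) (b : ℝ), ‖y‖ = 1 →
      (fderiv ℝ κ.lift y (-b • y)).2 = b := by
    intro n κ y b hy
    have h1 := κ.fderiv_lift_snd_self hy
    have h2 : HasFDerivAt (fun z => (κ.lift z).2) _ y := (κ.smoothNear_lift y).hasFDerivAt.snd
    rw [h2.fderiv] at h1
    rw [map_smul, Prod.smul_snd]
    have h3 : (fderiv ℝ κ.lift y y).2 = -1 := h1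
    rw [h3]
    simp
  refine ⟨(-a 0 • p.1, -a 1 • p.2), Fin.forall_fin_two.2 ⟨fun h => ?_, fun h => ?_⟩⟩
  · rw [fderiv_bdf_zero]
    exact key κd p.1 (a 0) ((κd.lift_snd_eq_zero_iff hd).1 h)
  · rw [fderiv_bdf_one]
    exact key κs p.2 (a 1) ((κs.lift_snd_eq_zero_iff hs).1 h)

/-- If two differentiable maps agree on `S` then their differentials agree on the tangent space. -/
theorem fderiv_eq_on_tangentSpan {V W : Type*} [NormedAddCommGroup V] [NormedSpace ℝ V]
    [NormedAddCommGroup W] [NormedSpace ℝ W] {f g : V → W} {f' g' : V →L[ℝ] W} {S : Set V} {p : V}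
    (hf : HasFDerivWithinAt f f' S p) (hg : HasFDerivWithinAt g g' S p)
    (hfg : ∀ᶠ v in 𝓝 p, v ∈ S → f v = g v) (hp : f p = g p) {v : V} (hv : v ∈ tangentSpan S p) :
    f' v = g' v := by
  have h1 : HasFDerivWithinAt g f' S p := by
    refine hf.congr_of_eventuallyEq ?_ hp.symm
    filter_upwards [hfg.filter_mono nhdsWithin_le_nhds, self_mem_nhdsWithin] with v hv hvS
    exact (hv hvS).symm
  have h2 : tangentSpan S p ≤ LinearMap.eqLocus f'.toLinearMap g'.toLinearMap :=
    Submodule.span_le.2 fun w hw => h1.unique_on hg hw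
  exact h2 hv

variable {φ : Euc d × Euc s → ℝ}

/-- The immersion property. A vector in the kernel of the differentials of `λ̃_φ` and of the
equations of `C̃_φ` gives, by Euler's identities and by the symmetry of the second derivative, a
vector that is annihilated by the differentials of all the equations along the face; by
non-degeneracy this vector vanishes. -/
theorem IsExpansionAt.eq_zero_of_fderiv_eq_zero {f : Face} {p : Euc d × Euc s}
    {Φ₀ Φ₁ : HomCoord d s → ℝ} (hd : 0 < d) (hs : 0 < s)
    (h : IsExpansionAt φ (faceFn f) (lift₂ κd κs p) Φ₀ Φ₁) (hφ : IsClassical 1 1 φ)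
    (hp : p ∈ cball2 d s) (hpf : faceFn f (lift₂ κd κs p) = 0)
    (hcrit : (extCovec φ (lift₂ κd κs p)).comp (ContinuousLinearMap.inr ℝ _ _) = 0)
    (hG : fiberOf κs (leadingCovec κd κs Φ₀) p ∈ halfSpace d)
    (hsurj : ∀ b : Fin s → ℝ, ∃ v, thetaVec d s (fderiv ℝ (leadingCovec κd κs Φ₀) p v) = b ∧
      ∀ i, bdf κd κs i p = 0 → fderiv ℝ (bdf κd κs i) p v = 0)
    {v : Euc d × Euc s} (hv1 : thetaVec d s (fderiv ℝ (leadingCovec κd κs Φ₀) p v) = 0)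
    (hv2 : fderiv ℝ (covecMap κd κs (leadingCovec κd κs Φ₀)) p v = 0) : v = 0 := by
  have hP := lift₂_mem_closedCoord κd κs hd hs hp
  set P := lift₂ κd κs p with hPdef
  set c' := fderiv ℝ (leadingCovec κd κs Φ₀) p with hc'
  have hcP : leadingCovec κd κs Φ₀ p = extCovec φ P := by
    rw [(h.extCovec_eq hφ).self_of_nhds hP hpf]
    rfl
  rw [fderiv_covecMap (smoothNear_leadingCovec h.1) hG] at hv2
  have hv21 : v.1 = 0 := congrArg Prod.fst hv2
  obtain ⟨a, ha⟩ := κd.eq_smul_of_fderiv_proj_eq_zero hd hG (congrArg Prod.snd hv2)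
  have ha1 : horizVec d s (c' v) = a • horizVec d s (extCovec φ P) := by
    rw [← hcP]; exact congrArg Prod.fst ha
  have ha2 : (fderiv ℝ κs.lift p.2 v.2).2 = a * P.2.2 := congrArg Prod.snd ha
  set Q := fderiv ℝ κs.lift p.2 v.2 with hQ
  -- subtract the multiple of the radial vector that removes the `r`-component
  set w := Q.1 - a • P.2.1 with hw
  have hlift : fderiv ℝ (lift₂ κd κs) p v = ((0, Q) : HomCoord d s) := by
    rw [fderiv_lift₂, hv21, map_zero]
  have hQw : ((0, Q) : HomCoord d s) = horizontal d s (0, w) + a • ((0, P.2) : HomCoord d s) := by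
    refine Prod.ext ?_ (Prod.ext ?_ ?_)
    · simp
      rfl
    · simp [hw]
    · simp [ha2]
  set B := fderiv ℝ (fderiv ℝ Φ₀) P with hB
  have hsymm : ∀ x y, B x y = B y x :=
    (h.1.contDiffAt.isSymmSndFDerivAt (by
      rw [minSmoothness_of_isRCLikeNormedField]
      exact WithTop.coe_le_coe.2 (le_top : (2 : ℕ∞) ≤ ⊤))).eq
  -- the horizontal vector `(0, w)` is in the kernel of the Hessian, along the face
  have hk1 : ∀ x, B (horizontal d s (0, w)) (horizontal d s x) = 0 := by
    intro x
    have h1 : B (0, Q) (horizontal d s x) = c' v x := by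
      rw [hc', fderiv_leadingCovec h.1, hlift]
    have h2 := (h.euler hφ hP hpf x).2
    have h3 : c' v x = c' v (x.1, 0) + c' v (0, x.2) := by rw [← map_add]; simp
    have h4 : c' v (x.1, 0) = a * extCovec φ P (x.1, 0) := by
      rw [← inner_horizVec, ha1, inner_smul_left, inner_horizVec]
      rfl
    have h5 : c' v (0, x.2) = 0 := by
      rw [apply_zero_prod_eq_sum, hv1]; simp
    have h6 : B (0, Q) (horizontal d s x) = B (horizontal d s (0, w)) (horizontal d s x) +
        a * B (0, P.2) (horizontal d s x) := by
      rw [hQw, map_add, map_smul]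
      rfl
    rw [h1, h3, h4, h5, h2] at h6
    linarith
  have hk2 : B (P.1, 0) (horizontal d s (0, w)) = 0 := by
    rw [(h.euler hφ hP hpf (0, w)).1]
    exact DFunLike.congr_fun hcrit w
  have hk3 : B (0, P.2) (horizontal d s (0, w)) = 0 := by
    rw [(h.euler hφ hP hpf (0, w)).2]
    exact map_zero (extCovec φ P)
  -- tangent vectors of the stratum of `p` are horizontal up to radial vectors
  have hk4 : ∀ v', (∀ i, bdf κd κs i p = 0 → fderiv ℝ (bdf κd κs i) p v' = 0) →
      c' v' (0, w) = 0 := by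
    intro v' hv'
    obtain ⟨h0, h1⟩ := Fin.forall_fin_two.1 hv'
    rw [fderiv_bdf_zero] at h0
    rw [fderiv_bdf_one] at h1
    set S₁ := fderiv ℝ κd.lift p.1 v'.1
    set S₂ := fderiv ℝ κs.lift p.2 v'.2
    obtain ⟨b₁, hb₁⟩ : ∃ b, S₁.2 = b * P.1.2 := by
      by_cases hz : P.1.2 = 0
      · exact ⟨0, by rw [h0 hz, zero_mul]⟩
      · exact ⟨S₁.2 / P.1.2, (div_mul_cancel₀ _ hz).symm⟩
    obtain ⟨b₂, hb₂⟩ : ∃ b, S₂.2 = b * P.2.2 := by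
      by_cases hz : P.2.2 = 0
      · exact ⟨0, by rw [h1 hz, zero_mul]⟩
      · exact ⟨S₂.2 / P.2.2, (div_mul_cancel₀ _ hz).symm⟩
    have hS : ((S₁, S₂) : HomCoord d s) = b₁ • ((P.1, 0) : HomCoord d s) +
        b₂ • ((0, P.2) : HomCoord d s) +
          horizontal d s (S₁.1 - b₁ • P.1.1, S₂.1 - b₂ • P.2.1) := by
      refine Prod.ext (Prod.ext ?_ ?_) (Prod.ext ?_ ?_)
      · simp
      · simp [hb₁]
      · simp
      · simp [hb₂]
    rw [hc', fderiv_leadingCovec h.1, fderiv_lift₂]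
    change B (S₁, S₂) (horizontal d s (0, w)) = 0
    rw [hS, map_add, map_add, map_smul, map_smul]
    change b₁ * B (P.1, 0) (horizontal d s (0, w)) + b₂ * B (0, P.2) (horizontal d s (0, w)) +
      B (horizontal d s _) (horizontal d s (0, w)) = 0
    rw [hk2, hk3, hsymm, hk1]
    simp
  have hw0 : w = 0 := by
    obtain ⟨v', hv', hv''⟩ := hsurj fun j => w j
    have h1 := hk4 v' hv''
    rw [apply_zero_prod_eq_sum, hv'] at h1
    rw [Finset.sum_eq_zero_iff_of_nonneg fun j _ => mul_self_nonneg _] at h1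
    ext j
    exact mul_self_eq_zero.1 (h1 j (Finset.mem_univ j))
  have hQP : Q = a • κs.lift p.2 := by
    refine Prod.ext ?_ ha2
    exact sub_eq_zero.1 hw0
  have hv22 : v.2 = 0 := by
    have h1 : HasFDerivAt (κs.proj ∘ κs.lift)
        ((fderiv ℝ κs.proj (κs.lift p.2)).comp (fderiv ℝ κs.lift p.2)) p.2 :=
      (κs.smoothNear_proj hP.2).hasFDerivAt.comp p.2 (κs.smoothNear_lift p.2).hasFDerivAt
    have h2 : κs.proj ∘ κs.lift = id := funext fun z => κs.proj_lift hs z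
    rw [h2] at h1
    have h3 := DFunLike.congr_fun (h1.unique (hasFDerivAt_id p.2)) v.2
    rw [ContinuousLinearMap.comp_apply, ← hQ, hQP, map_smul,
      κs.fderiv_proj_self (P := κs.lift p.2) hP.2, smul_zero] at h3
    exact h3.symm
  exact Prod.ext hv21 hv22

end Covectors

/-! ### Local structure of the critical set and of its image -/

section Local

variable {d s : ℕ} {κd : Compactification d} {κs : Compactification s} {φ : Euc d × Euc s → ℝ}
  {f : Face} {p : Euc d × Euc s} {Φ₀ Φ₁ : HomCoord d s → ℝ}

theorem contDiff_faceFn (f : Face) : ContDiff ℝ ∞ (faceFn (d := d) (s := s) f) := by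
  cases f <;> unfold faceFn <;> fun_prop

theorem faceFn_lift₂_eq_zero (hd : 0 < d) (hs : 0 < s) (hp : p ∈ closedFace d s f) :
    faceFn f (lift₂ κd κs p) = 0 := by
  have h := ((mem_closedFace_iff κd κs hd hs).1 hp).1
  cases f
  · exact h 0 (by simp [faceIdx])
  · exact h 1 (by simp [faceIdx])
  · exact h 1 (by simp [faceIdx])

theorem expansionSum_eq (v : Euc d × Euc s) :
    expansionSum (faceFn f) Φ₀ Φ₁ (lift₂ κd κs v) =
      leadingCovec κd κs Φ₀ v + faceFn f (lift₂ κd κs v) • leadingCovec κd κs Φ₁ v := by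
  rw [expansionSum, ContinuousLinearMap.add_comp, ContinuousLinearMap.smul_comp]
  rfl

theorem expansionSum_eq_of_mem (hd : 0 < d) (hs : 0 < s) (hp : p ∈ closedFace d s f) :
    expansionSum (faceFn f) Φ₀ Φ₁ (lift₂ κd κs p) = leadingCovec κd κs Φ₀ p := by
  rw [expansionSum_eq, faceFn_lift₂_eq_zero hd hs hp, zero_smul, add_zero]

theorem IsExpansionAt.smoothNear_expansionSum
    (h : IsExpansionAt φ (faceFn f) (lift₂ κd κs p) Φ₀ Φ₁) :
    SmoothNear (fun v => expansionSum (faceFn f) Φ₀ Φ₁ (lift₂ κd κs v)) p := by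
  have h1 : SmoothNear (fun v => faceFn f (lift₂ κd κs v)) p :=
    ((contDiff_faceFn f).comp (contDiff_lift₂ κd κs)).smoothNear p
  refine ((smoothNear_leadingCovec h.1).add
    (h1.smul (smoothNear_leadingCovec h.2.1))).congr ?_
  exact Eventually.of_forall fun v => expansionSum_eq v

theorem IsExpansionAt.leadingCovec_eq (hd : 0 < d) (hs : 0 < s)
    (h : IsExpansionAt φ (faceFn f) (lift₂ κd κs p) Φ₀ Φ₁) (hφ : IsClassical 1 1 φ) :
    ∀ᶠ v in 𝓝 p, v ∈ closedFace d s f →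
      extCovec φ (lift₂ κd κs v) = leadingCovec κd κs Φ₀ v := by
  filter_upwards [((contDiff_lift₂ κd κs).continuous.tendsto p).eventually (h.extCovec_eq hφ)]
    with v hv hvf
  exact hv (lift₂_mem_closedCoord κd κs hd hs (closedFace_subset_cball2 f hvf))
    (faceFn_lift₂_eq_zero hd hs hvf)

/-- `λ̃_φ` is differentiable up to the boundary at the points of `C̃_φ`: it differs from a smooth
map by a term of second order at the face. -/
theorem IsExpansionAt.hasFDerivWithinAt_lambdaTilde (hd : 0 < d) (hs : 0 < s)
    (h : IsExpansionAt φ (faceFn f) (lift₂ κd κs p) Φ₀ Φ₁) (hφ : IsClassicalPhase φ)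
    (hp : p ∈ critSet κd κs φ) (hpf : p ∈ closedFace d s f) :
    HasFDerivWithinAt (lambdaTilde κd κs φ) (fderiv ℝ (covecMap κd κs
      fun v => expansionSum (faceFn f) Φ₀ Φ₁ (lift₂ κd κs v)) p) (cball2 d s) p := by
  set c₁ := fun v => expansionSum (faceFn f) Φ₀ Φ₁ (lift₂ κd κs v) with hc₁
  set cE := fun v => extCovec φ (lift₂ κd κs v) with hcE
  have hpc := closedFace_subset_cball2 f hpf
  have hG : fiberOf κs cE p ∈ halfSpace d := fiberCoord_mem_halfSpace hd hs hφ hp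
  have hc1p : c₁ p = cE p := by
    rw [hc₁, hcE]
    simp only
    rw [expansionSum_eq_of_mem hd hs hpf, (h.leadingCovec_eq hd hs hφ.classical).self_of_nhds hpf]
  have hfp : fiberOf κs c₁ p = fiberOf κs cE p := by rw [fiberOf, fiberOf, hc1p]
  have hsm₁ := h.smoothNear_expansionSum
  have hct1 : ContinuousAt (fiberOf κs c₁) p := (smoothNear_fiberOf hsm₁).continuousAt
  have hctE : ContinuousWithinAt (fiberOf κs cE) (cball2 d s) p := by
    refine ContinuousWithinAt.comp (g := fiberCoord φ) (t := closedCoord d s)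
      (continuousAt_fiberCoord_within hφ.classical (lift₂_mem_closedCoord κd κs hd hs hpc))
      (contDiff_lift₂ κd κs).continuous.continuousWithinAt
      fun q hq => lift₂_mem_closedCoord κd κs hd hs hq
  have he1 : ∀ᶠ v in 𝓝[cball2 d s] p, fiberOf κs cE v ∈ halfSpace d := by
    filter_upwards [hctE.eventually (eventually_mem_halfSpace hG), self_mem_nhdsWithin]
      with v hv hvc
    have h2 : 0 ≤ (κs.lift v.2).2 :=
      halfSpace_snd_nonneg (lift₂_mem_closedCoord κd κs hd hs hvc).2
    exact hv h2
  obtain ⟨C, hC⟩ := h.norm_extCovec_sub_le hφ.classical (continuous_faceFn f)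
  have he3 : ∀ᶠ v in 𝓝[cball2 d s] p, ‖cE v - c₁ v‖ ≤ C * faceFn f (lift₂ κd κs v) ^ 2 := by
    filter_upwards [(((contDiff_lift₂ κd κs).continuous.tendsto p).eventually hC).filter_mono
      nhdsWithin_le_nhds, self_mem_nhdsWithin] with v hv hvc
    exact hv (lift₂_mem_closedCoord κd κs hd hs hvc)
  obtain ⟨K, t, ht, hK⟩ := ((κd.smoothNear_proj hG).contDiffAt.of_le
    (by simp : (1 : ℕ∞ω) ≤ ∞)).exists_lipschitzOnWith
  have hdiff : (fun v => lambdaTilde κd κs φ v - covecMap κd κs c₁ v) =O[𝓝[cball2 d s] p]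
      fun v => faceFn f (lift₂ κd κs v) ^ 2 := by
    refine Asymptotics.IsBigO.of_bound (K * (‖horizVec d s‖ * C)) ?_
    filter_upwards [he1, he3, hctE.eventually_mem ht,
      (hct1.continuousWithinAt (s := cball2 d s)).eventually_mem (hfp ▸ ht), self_mem_nhdsWithin]
      with v hv1 hv3 hvt hvt' hvc
    rw [lambdaTilde_eq hd hs hφ.classical hvc hv1]
    have h1 : ((v.1, κd.proj (fiberCoord φ (lift₂ κd κs v))) : Euc d × Euc d) -
        covecMap κd κs c₁ v = (0, κd.proj (fiberOf κs cE v) - κd.proj (fiberOf κs c₁ v)) :=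
      Prod.ext (sub_self _) rfl
    have h2 : fiberOf κs cE v - fiberOf κs c₁ v = (horizVec d s (cE v - c₁ v), 0) := by
      rw [map_sub]
      exact Prod.ext rfl (sub_self _)
    have h3 := hK.norm_sub_le hvt hvt'
    rw [h1, Prod.norm_mk, norm_zero, max_eq_right (norm_nonneg _)]
    rw [h2, Prod.norm_mk, norm_zero, max_eq_left (norm_nonneg _)] at h3
    refine h3.trans ?_
    rw [Real.norm_of_nonneg (sq_nonneg (faceFn f (lift₂ κd κs v))), mul_assoc, mul_assoc]
    gcongr
    exact ((horizVec d s).le_opNorm _).trans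
      (mul_le_mul_of_nonneg_left hv3 (norm_nonneg _))
  have hε : (fun v => faceFn f (lift₂ κd κs v)) =O[𝓝[cball2 d s] p] fun v => v - p := by
    have h1 : DifferentiableAt ℝ (fun v => faceFn f (lift₂ κd κs v)) p :=
      ((contDiff_faceFn f).comp (contDiff_lift₂ κd κs)).differentiable (by simp) p
    have h2 := h1.isBigO_sub
    simp only [faceFn_lift₂_eq_zero hd hs hpf, sub_zero] at h2
    exact h2.mono nhdsWithin_le_nhds
  have h0 : HasFDerivWithinAt (fun v => lambdaTilde κd κs φ v - covecMap κd κs c₁ v)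
      (0 : Euc d × Euc s →L[ℝ] Euc d × Euc d) (cball2 d s) p :=
    (hdiff.trans (hε.norm_right.pow 2)).hasFDerivWithinAt hpc one_lt_two
  have hG1 : fiberOf κs c₁ p ∈ halfSpace d := by rw [hfp]; exact hG
  have h1 : HasFDerivWithinAt (covecMap κd κs c₁) (fderiv ℝ (covecMap κd κs c₁) p)
      (cball2 d s) p :=
    (smoothNear_covecMap hsm₁ hG1).hasFDerivAt.hasFDerivWithinAt
  have h2 := h0.fun_add h1
  simpa only [sub_add_cancel, zero_add] using h2

theorem IsExpansionAt.dLambdaTilde_eq (hd : 0 < d) (hs : 0 < s)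
    (h : IsExpansionAt φ (faceFn f) (lift₂ κd κs p) Φ₀ Φ₁) (hφ : IsClassicalPhase φ)
    (hp : p ∈ critSet κd κs φ) (hpf : p ∈ closedFace d s f) :
    dLambdaTilde κd κs φ p = fderiv ℝ (covecMap κd κs
      fun v => expansionSum (faceFn f) Φ₀ Φ₁ (lift₂ κd κs v)) p :=
  (h.hasFDerivWithinAt_lambdaTilde hd hs hφ hp hpf).fderivWithin
    (uniqueDiffOn_cball2 p (closedFace_subset_cball2 f hpf))

theorem IsExpansionAt.fiberOf_mem_halfSpace (hd : 0 < d) (hs : 0 < s)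
    (h : IsExpansionAt φ (faceFn f) (lift₂ κd κs p) Φ₀ Φ₁) (hφ : IsClassicalPhase φ)
    (hp : p ∈ critSet κd κs φ) (hpf : p ∈ closedFace d s f) :
    fiberOf κs (leadingCovec κd κs Φ₀) p ∈ halfSpace d := by
  have h1 := fiberCoord_mem_halfSpace hd hs hφ hp
  rwa [fiberOf, ← (h.leadingCovec_eq hd hs hφ.classical).self_of_nhds hpf]

theorem IsExpansionAt.dLambdaTilde_apply_fst (hd : 0 < d) (hs : 0 < s)
    (h : IsExpansionAt φ (faceFn f) (lift₂ κd κs p) Φ₀ Φ₁) (hφ : IsClassicalPhase φ)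
    (hp : p ∈ critSet κd κs φ) (hpf : p ∈ closedFace d s f) (v : Euc d × Euc s) :
    (dLambdaTilde κd κs φ p v).1 = v.1 := by
  rw [h.dLambdaTilde_eq hd hs hφ hp hpf, fderiv_covecMap h.smoothNear_expansionSum]
  rw [fiberOf, expansionSum_eq_of_mem hd hs hpf]
  exact h.fiberOf_mem_halfSpace hd hs hφ hp hpf

theorem IsExpansionAt.dLambdaTilde_apply_eq (hd : 0 < d) (hs : 0 < s)
    (h : IsExpansionAt φ (faceFn f) (lift₂ κd κs p) Φ₀ Φ₁) (hφ : IsClassicalPhase φ)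
    (hp : p ∈ critSet κd κs φ) (hpf : p ∈ closedFace d s f) {S : Set (Euc d × Euc s)}
    (hS : S ⊆ closedFace d s f) {v : Euc d × Euc s} (hv : v ∈ tangentSpan S p) :
    dLambdaTilde κd κs φ p v = fderiv ℝ (covecMap κd κs (leadingCovec κd κs Φ₀)) p v := by
  have hG := h.fiberOf_mem_halfSpace hd hs hφ hp hpf
  have hG' : fiberOf κs (fun v => expansionSum (faceFn f) Φ₀ Φ₁ (lift₂ κd κs v)) p ∈
      halfSpace d := by
    rwa [fiberOf, expansionSum_eq_of_mem hd hs hpf]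
  rw [h.dLambdaTilde_eq hd hs hφ hp hpf]
  have he : ∀ w ∈ closedFace d s f, covecMap κd κs
      (fun v => expansionSum (faceFn f) Φ₀ Φ₁ (lift₂ κd κs v)) w =
      covecMap κd κs (leadingCovec κd κs Φ₀) w := by
    intro w hw
    simp only [covecMap, fiberOf]
    rw [expansionSum_eq_of_mem hd hs hw]
  exact fderiv_eq_on_tangentSpan
    (smoothNear_covecMap h.smoothNear_expansionSum hG').hasFDerivAt.hasFDerivWithinAt
    (smoothNear_covecMap (smoothNear_leadingCovec h.1) hG).hasFDerivAt.hasFDerivWithinAt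
    (Eventually.of_forall fun w hw => he w (hS hw)) (he p hpf) hv

/-- Linearly independent forms on a space are jointly surjective. -/
theorem exists_apply_eq_of_linearIndependent {T : Type*} [AddCommGroup T] [Module ℝ T] {n : ℕ}
    {l : Fin n → T →ₗ[ℝ] ℝ} (hl : LinearIndependent ℝ l) (b : Fin n → ℝ) :
    ∃ v, ∀ j, l j v = b j := by
  suffices h : LinearMap.range (LinearMap.pi l) = ⊤ by
    obtain ⟨v, hv⟩ := LinearMap.range_eq_top.1 h b
    exact ⟨v, fun j => congrFun hv j⟩
  by_contra hne
  obtain ⟨g, hg, hle⟩ := Submodule.exists_le_ker_of_lt_top _ (lt_top_iff_ne_top.2 hne)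
  refine hg ?_
  have h1 : ∑ i, (g fun j => if i = j then 1 else 0) • l i = 0 := by
    ext v
    have h2 : g (LinearMap.pi l v) = 0 := hle ⟨v, rfl⟩
    rw [LinearMap.pi_apply_eq_sum_univ g] at h2
    simp only [LinearMap.pi_apply, smul_eq_mul] at h2
    simp only [LinearMap.sum_apply, LinearMap.smul_apply, smul_eq_mul, LinearMap.zero_apply]
    refine Eq.trans ?_ h2
    exact Finset.sum_congr rfl fun i _ => mul_comm _ _
  have h3 := Fintype.linearIndependent_iff.1 hl _ h1
  refine LinearMap.ext fun x => ?_
  rw [LinearMap.pi_apply_eq_sum_univ g]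
  simp [h3]

theorem fderiv_thetaVec {c : Euc d × Euc s → (Euc d × Euc s →L[ℝ] ℝ)} (hc : SmoothNear c p)
    (v : Euc d × Euc s) :
    fderiv ℝ (fun v => thetaVec d s (c v)) p v = thetaVec d s (fderiv ℝ c p v) := by
  have h : HasFDerivAt (fun v => thetaVec d s (c v)) _ p :=
    (thetaVec d s).hasFDerivAt.comp p hc.hasFDerivAt
  rw [h.fderiv]
  rfl

/-- Non-degeneracy says that the equations of `C̃_φ`, restricted to the open face of the point, have
independent differentials. -/
theorem IsExpansionAt.exists_fderiv_eq (hd : 0 < d) (hs : 0 < s)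
    (h : IsExpansionAt φ (faceFn f) (lift₂ κd κs p) Φ₀ Φ₁) (hφ : IsClassicalPhase φ)
    (hnd : NonDegenerate κd κs φ)
    (hp : p ∈ critSet κd κs φ) (hpf : p ∈ closedFace d s f) (b : Fin s → ℝ) (a : Fin 2 → ℝ) :
    ∃ v, thetaVec d s (fderiv ℝ (leadingCovec κd κs Φ₀) p v) = b ∧
      ∀ i, bdf κd κs i p = 0 → fderiv ℝ (bdf κd κs i) p v = a i := by
  obtain ⟨g, hg⟩ := hp.1
  have hpc := closedFace_subset_cball2 f hpf
  have hfg : faceIdx f ⊆ faceIdx g := fun i hi =>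
    (((mem_openFace_iff κd κs hd hs).1 hg).1 i).2 (((mem_closedFace_iff κd κs hd hs).1 hpf).1 i hi)
  have hgf := openFace_subset_closedFace (d := d) (s := s) hfg
  have hgc : openFace d s g ⊆ cball2 d s := hgf.trans (closedFace_subset_cball2 f)
  have hli := hnd g p ⟨hp, hg⟩
  have hD : ∀ j, HasFDerivWithinAt (thetaDeriv κd κs φ j)
      (fderivWithin ℝ (thetaDeriv κd κs φ j) (cball2 d s) p) (openFace d s g) p := by
    intro j
    refine HasFDerivWithinAt.mono (DifferentiableWithinAt.hasFDerivWithinAt ?_) hgc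
    by_contra hcon
    refine hli.ne_zero j ?_
    rw [fderivWithin_zero_of_not_differentiableWithinAt hcon]
    ext
    rfl
  have hsm := smoothNear_leadingCovec h.1
  have hF : ∀ j, HasFDerivWithinAt (fun v => thetaVec d s (leadingCovec κd κs Φ₀ v) j)
      ((ContinuousLinearMap.proj j).comp ((thetaVec d s).comp
        (fderiv ℝ (leadingCovec κd κs Φ₀) p))) (openFace d s g) p := fun j =>
    ((ContinuousLinearMap.proj (R := ℝ) (φ := fun _ : Fin s => ℝ) j).hasFDerivAt.comp p
      ((thetaVec d s).hasFDerivAt.comp p hsm.hasFDerivAt)).hasFDerivWithinAt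
  have heq : ∀ j, ∀ᶠ v in 𝓝 p, v ∈ openFace d s g →
      thetaDeriv κd κs φ j v = thetaVec d s (leadingCovec κd κs Φ₀ v) j := by
    intro j
    filter_upwards [h.leadingCovec_eq hd hs hφ.classical] with v hv hvg
    rw [thetaDeriv_eq hd hs hφ.classical j (hgc hvg), hv (hgf hvg)]
    rfl
  have hT : ∀ j, ∀ v ∈ tangentSpan (openFace d s g) p,
      fderivWithin ℝ (thetaDeriv κd κs φ j) (cball2 d s) p v =
        thetaVec d s (fderiv ℝ (leadingCovec κd κs Φ₀) p v) j := fun j v hv =>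
    fderiv_eq_on_tangentSpan (hD j) (hF j) (heq j) ((heq j).self_of_nhds hg) hv
  have hT0 : ∀ i, bdf κd κs i p = 0 → ∀ v ∈ tangentSpan (openFace d s g) p,
      fderiv ℝ (bdf κd κs i) p v = 0 := by
    intro i hi v hv
    have hig : i ∈ faceIdx g := (((mem_openFace_iff κd κs hd hs).1 hg).1 i).2 hi
    have := fderiv_eq_on_tangentSpan (g := fun _ => (0 : ℝ))
      (smoothNear_bdf (κd := κd) (κs := κs) i p).hasFDerivAt.hasFDerivWithinAt
      (hasFDerivWithinAt_const (0 : ℝ) p (openFace d s g))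
      (Eventually.of_forall fun w hw => (((mem_openFace_iff κd κs hd hs).1 hw).1 i).1 hig) hi hv
    simpa using this
  obtain ⟨v₁, hv₁⟩ := exists_fderiv_bdf_eq (κd := κd) (κs := κs) hd hs p a
  obtain ⟨v₂, hv₂⟩ := exists_apply_eq_of_linearIndependent hli
    (b - thetaVec d s (fderiv ℝ (leadingCovec κd κs Φ₀) p v₁))
  refine ⟨v₁ + v₂, ?_, fun i hi => ?_⟩
  · funext j
    have h1 := hv₂ j
    have h2 := hT j v₂ v₂.2
    have h3 : fderivWithin ℝ (thetaDeriv κd κs φ j) (cball2 d s) p v₂ =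
      b j - thetaVec d s (fderiv ℝ (leadingCovec κd κs Φ₀) p v₁) j := h1
    rw [map_add, map_add, Pi.add_apply, ← h2, h3]
    ring
  · rw [map_add, hv₁ i hi, hT0 i hi v₂ v₂.2, add_zero]

/-- The local structure of `C̃_φ^f` and of its image under `λ̃_φ`. -/
theorem IsExpansionAt.local_structure_critPart (hd : 0 < d) (hs : 0 < s)
    (h : IsExpansionAt φ (faceFn f) (lift₂ κd κs p) Φ₀ Φ₁) (hφ : IsClassicalPhase φ)
    (hnd : NonDegenerate κd κs φ)
    (hp : p ∈ critSet κd κs φ) (hpf : p ∈ closedFace d s f) :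
    (∀ v, v ∈ tangentSpan (critPart κd κs φ f) p ↔
      thetaVec d s (fderiv ℝ (leadingCovec κd κs Φ₀) p v) = 0 ∧
        ∀ i ∈ faceIdx f, fderiv ℝ (bdf κd κs i) p v = 0) ∧
    (∀ v ∈ tangentSpan (critPart κd κs φ f) p, dLambdaTilde κd κs φ p v = 0 → v = 0) ∧
    (∃ N ∈ 𝓝 p, InjOn (lambdaTilde κd κs φ) (critPart κd κs φ f ∩ N)) ∧
    ∀ L ⊆ closedFace d d f,
      (∀ N ∈ 𝓝 p, ∀ᶠ v in 𝓝 (lambdaTilde κd κs φ p),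
        v ∈ L → v ∈ lambdaTilde κd κs φ '' (critPart κd κs φ f ∩ N)) →
      (∃ N ∈ 𝓝 p, lambdaTilde κd κs φ '' (critPart κd κs φ f ∩ N) ⊆ L) →
      tangentSpan L (lambdaTilde κd κs φ p) =
        (tangentSpan (critPart κd κs φ f) p).map (dLambdaTilde κd κs φ p).toLinearMap ∧
      ∃ (n k : ℕ) (ν : CornerChart (closedFace d d f) n k) (F : Submodule ℝ (Euc n))
        (Λ' : Fin k → (F →L[ℝ] ℝ)),
        lambdaTilde κd κs φ p ∈ ν.dom ∧ ν.toFun (lambdaTilde κd κs φ p) = 0 ∧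
        LinearIndependent ℝ Λ' ∧
        ν.toFun '' (ν.dom ∩ L) = ν.toFun '' (ν.dom ∩ closedFace d d f) ∩ quadrant F Λ' ∧
        (∃ O : Set (Euc n), IsOpen O ∧
          ν.toFun '' (ν.dom ∩ closedFace d d f) ∩ quadrant F Λ' = O ∩ quadrant F Λ') ∧
        Module.finrank ℝ F + (faceIdx f).card + s = d + s ∧ n + (faceIdx f).card = d + d := by
  classical
  have hpc := closedFace_subset_cball2 f hpf
  have hG := h.fiberOf_mem_halfSpace hd hs hφ hp hpf
  have hcE := h.leadingCovec_eq hd hs hφ.classical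
  have hsm := smoothNear_leadingCovec h.1
  have hlam : ∀ᶠ v in 𝓝 p, v ∈ critPart κd κs φ f →
      lambdaTilde κd κs φ v = covecMap κd κs (leadingCovec κd κs Φ₀) v := by
    filter_upwards [hcE] with v hv hvC
    rw [lambdaTilde_eq hd hs hφ.classical (closedFace_subset_cball2 f hvC.2)
      (fiberCoord_mem_halfSpace hd hs hφ hvC.1), covecMap, fiberOf, ← hv hvC.2]
    rfl
  have hpC : p ∈ critPart κd κs φ f := ⟨hp, hpf⟩
  have hq : covecMap κd κs (leadingCovec κd κs Φ₀) p = lambdaTilde κd κs φ p :=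
    (hlam.self_of_nhds hpC).symm
  have hm : ∀ i, ∃ m : Euc d × Euc s → ℝ, ContinuousAt m p ∧ 0 < m p ∧
      ∀ᶠ v in 𝓝 p, bdf κd κd i (covecMap κd κs (leadingCovec κd κs Φ₀) v) =
        m v * bdf κd κs i v := by
    refine Fin.forall_fin_two.2 ⟨⟨fun _ => 1, continuousAt_const, one_pos,
      Eventually.of_forall fun v => (one_mul _).symm⟩, ?_⟩
    obtain ⟨m, hm1, hm2, hm3⟩ := κd.exists_lift_proj_eq hd hG
    have hct := (smoothNear_fiberOf (κs := κs) hsm).continuousAt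
    refine ⟨fun v => m (fiberOf κs (leadingCovec κd κs Φ₀) v), hm1.comp hct, hm2, ?_⟩
    filter_upwards [hct.eventually hm3] with v hv
    rw [bdf_one, covecMap, hv]
    rfl
  have hmz : ∀ i, (bdf κd κs i p = 0 → bdf κd κd i (lambdaTilde κd κs φ p) = 0) ∧
      (0 < bdf κd κs i p → 0 < bdf κd κd i (lambdaTilde κd κs φ p)) := by
    intro i
    obtain ⟨m, -, hm2, hm3⟩ := hm i
    have := hm3.self_of_nhds
    rw [hq] at this
    rw [this]
    exact ⟨fun h0 => by rw [h0, mul_zero], fun h0 => mul_pos hm2 h0⟩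
  have hnn := (mem_cball2_iff_bdf κd κs hd hs).1 hpc
  have hcrit := ((mem_critSet_iff hd hs hφ.classical).1 hp).2
  have hF0 : thetaVec d s (leadingCovec κd κs Φ₀ p) = 0 := by
    rw [thetaVec_eq_zero_iff, ← hcE.self_of_nhds hpf]
    exact hcrit
  have hker : ∀ v, thetaVec d s (fderiv ℝ (leadingCovec κd κs Φ₀) p v) = 0 →
      fderiv ℝ (covecMap κd κs (leadingCovec κd κs Φ₀)) p v = 0 → v = 0 := fun v hv1 hv2 =>
    h.eq_zero_of_fderiv_eq_zero hd hs hφ.classical hpc (faceFn_lift₂_eq_zero hd hs hpf) hcrit hG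
      (fun b => h.exists_fderiv_eq hd hs hφ hnd hp hpf b 0) hv1 hv2
  have hC : ∀ᶠ v in 𝓝 p, v ∈ critPart κd κs φ f ↔
      thetaVec d s (leadingCovec κd κs Φ₀ v) = 0 ∧ (∀ i ∈ faceIdx f, bdf κd κs i v = 0) ∧
        ∀ i, 0 ≤ bdf κd κs i v := by
    filter_upwards [hcE] with v hv
    rw [← mem_closedFace_iff κd κs hd hs, critPart, mem_inter_iff]
    refine and_congr_left fun hvf => ?_
    rw [mem_critSet_iff hd hs hφ.classical, hv hvf, thetaVec_eq_zero_iff]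
    exact and_iff_right (closedFace_subset_bdry f hvf)
  have key := local_structure (I := Fin 2) (E := faceIdx f)
    (A := Finset.univ.filter fun i => bdf κd κs i p = 0)
    (p := p) (q := lambdaTilde κd κs φ p)
    (F := fun v => thetaVec d s (leadingCovec κd κs Φ₀ v))
    (H := covecMap κd κs (leadingCovec κd κs Φ₀)) (ρ := bdf κd κs) (ρ' := bdf κd κd)
    (fun i hi => Finset.mem_filter.2 ⟨Finset.mem_univ i,
      ((mem_closedFace_iff κd κs hd hs).1 hpf).1 i hi⟩)
    (SmoothNear.comp (g := fun L => thetaVec d s L) (SmoothNear.clm _ _) hsm)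
    (smoothNear_covecMap hsm hG) (fun i => smoothNear_bdf i p) (fun i => smoothNear_bdf i _) hq hF0
    (fun i hi => (Finset.mem_filter.1 hi).2)
    (fun i hi => lt_of_le_of_ne (hnn i) fun h0 =>
      hi (Finset.mem_filter.2 ⟨Finset.mem_univ i, h0.symm⟩))
    (fun i hi => (hmz i).1 (Finset.mem_filter.1 hi).2)
    (fun i hi => (hmz i).2 (lt_of_le_of_ne (hnn i) fun h0 =>
      hi (Finset.mem_filter.2 ⟨Finset.mem_univ i, h0.symm⟩)))
    (fun b a => by
      obtain ⟨v, hv1, hv2⟩ := h.exists_fderiv_eq hd hs hφ hnd hp hpf b a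
      exact ⟨v, (fderiv_thetaVec hsm v).trans hv1, fun i hi => hv2 i (Finset.mem_filter.1 hi).2⟩)
    (fun a => by
      obtain ⟨v, hv⟩ := exists_fderiv_bdf_eq (κd := κd) (κs := κd) hd hd (lambdaTilde κd κs φ p) a
      exact ⟨v, fun i hi => hv i ((hmz i).1 (Finset.mem_filter.1 hi).2)⟩)
    (fun i _ => hm i)
    (fun v hv1 hv2 => hker v ((fderiv_thetaVec hsm v).symm.trans hv1) hv2) hC hlam
  obtain ⟨k1, k2, k3⟩ := key
  have k1' : ∀ v, v ∈ tangentSpan (critPart κd κs φ f) p ↔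
      thetaVec d s (fderiv ℝ (leadingCovec κd κs Φ₀) p v) = 0 ∧
        ∀ i ∈ faceIdx f, fderiv ℝ (bdf κd κs i) p v = 0 := by
    intro v
    rw [k1 v, fderiv_thetaVec hsm]
  have hdl : ∀ v ∈ tangentSpan (critPart κd κs φ f) p, dLambdaTilde κd κs φ p v =
      fderiv ℝ (covecMap κd κs (leadingCovec κd κs Φ₀)) p v := fun v hv =>
    h.dLambdaTilde_apply_eq hd hs hφ hp hpf inter_subset_right hv
  refine ⟨k1', fun v hv hv0 => hker v ((k1' v).1 hv).1 ((hdl v hv).symm.trans hv0), k2,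
    fun L hLX hL1 hL2 => ?_⟩
  obtain ⟨t1, n, k, ν, F, Λ', t2, t3, t4, t5, t6, t7, t8⟩ := k3 (closedFace d d f) L
    (Eventually.of_forall fun v => mem_closedFace_iff κd κd hd hd) hLX hL1 hL2
  refine ⟨?_, n, k, ν, F, Λ', t2, t3, t4, t5, t6, ?_, ?_⟩
  · rw [t1]
    ext w
    simp only [Submodule.mem_map]
    constructor
    · rintro ⟨v, hv, rfl⟩
      exact ⟨v, hv, hdl v hv⟩
    · rintro ⟨v, hv, rfl⟩
      exact ⟨v, hv, (hdl v hv).symm⟩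
  · simpa using t7
  · simpa using t8

end Local

/-! ### Stationary points -/

/-- Points of `𝔹ⁿ` with different homogeneous coordinates: a lower bound that stays uniform when
both points go to infinity. -/
theorem exists_lower_bound_of_proj_ne {n : ℕ} (κ : Compactification n) (hn : 0 < n)
    {P Q : Euc n × ℝ} (hP : P ∈ halfSpace n) (hQ : Q ∈ halfSpace n) (hne : κ.proj P ≠ κ.proj Q) :
    ∃ c : ℝ, 0 < c ∧ ∀ᶠ z : (Euc n × ℝ) × (Euc n × ℝ) in 𝓝 (P, Q), 0 ≤ z.1.2 → 0 ≤ z.2.2 →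
      c * (z.2.2 + z.1.2) ≤ ‖z.2.2 • z.1.1 - z.1.2 • z.2.1‖ := by
  -- proportional coordinates give the same point
  have hprop : ∀ a b : ℝ, 0 < a → 0 < b → b • P = a • Q → False := by
    intro a b ha hb hab
    obtain ⟨m, -, hm, hmP⟩ := κ.exists_lift_proj_eq hn hP
    obtain ⟨m', -, hm', hmQ⟩ := κ.exists_lift_proj_eq hn hQ
    refine hne ?_
    have hPQ : P = (b⁻¹ * a) • Q := by
      rw [mul_smul, ← hab, smul_smul, inv_mul_cancel₀ hb.ne', one_smul]
    have hc : 0 < b⁻¹ * a := by positivity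
    set t := b⁻¹ * a with ht
    rcases hQ with h | ⟨h, h'⟩
    · have h2 : 0 < P.2 := by rw [hPQ]; exact mul_pos hc h
      rw [κ.proj_of_pos h2, κ.proj_of_pos h, hPQ]
      congr 1
      simp only [Prod.smul_fst, Prod.smul_snd, smul_eq_mul, smul_smul, mul_inv]
      congr 1
      field_simp
    · have h2 : P.2 = 0 := by rw [hPQ]; simp [h]
      have h3 : P.1 ≠ 0 := halfSpace_fst_ne_zero hP h2
      rw [κ.proj_of_lt h3 (by rw [h2]; simpa using h3), κ.proj_of_lt h' (by rw [h]; simpa using h'),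
        h2, h, hPQ]
      simp only [zero_mul, sub_zero, Prod.smul_fst, norm_smul, Real.norm_of_nonneg hc.le, smul_smul,
        mul_inv]
      congr 1
      field_simp
  by_cases h0 : P.2 = 0 ∧ Q.2 = 0
  · have hP1 := halfSpace_fst_ne_zero hP h0.1
    have hQ1 := halfSpace_fst_ne_zero hQ h0.2
    -- both points at infinity: the segment between the two directions avoids the origin
    have hpos : ∀ a ∈ Icc (0 : ℝ) 1, 0 < ‖a • P.1 - (1 - a) • Q.1‖ := by
      intro a ha
      rw [norm_pos_iff]
      intro hz
      rw [sub_eq_zero] at hz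
      rcases ha.1.eq_or_lt with h | h
      · rw [← h, zero_smul, sub_zero, one_smul] at hz
        exact hQ1 hz.symm
      · rcases ha.2.eq_or_lt with h' | h'
        · rw [h', one_smul, sub_self, zero_smul] at hz
          exact hP1 hz
        · refine hprop (1 - a) a (by linarith) h (Prod.ext hz ?_)
          simp [h0.1, h0.2]
    obtain ⟨a₀, ha₀, hmin⟩ := isCompact_Icc.exists_isMinOn (nonempty_Icc.2 zero_le_one)
      (f := fun a : ℝ => ‖a • P.1 - (1 - a) • Q.1‖) (by fun_prop)
    set c := ‖a₀ • P.1 - (1 - a₀) • Q.1‖ / 2 with hc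
    have hc0 : 0 < c := half_pos (hpos a₀ ha₀)
    refine ⟨c, hc0, ?_⟩
    have hnear : ∀ᶠ z : (Euc n × ℝ) × (Euc n × ℝ) in 𝓝 (P, Q),
        ‖z.1.1 - P.1‖ + ‖z.2.1 - Q.1‖ < c := by
      have : Continuous fun z : (Euc n × ℝ) × (Euc n × ℝ) =>
        ‖z.1.1 - P.1‖ + ‖z.2.1 - Q.1‖ := by fun_prop
      exact this.continuousAt.eventually (gt_mem_nhds (by simpa using hc0))
    filter_upwards [hnear] with z hz hz1 hz2
    rcases (add_nonneg hz2 hz1).eq_or_lt with h | h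
    · rw [← h, mul_zero]; exact norm_nonneg _
    · set S := z.2.2 + z.1.2
      set a := z.2.2 / S with ha
      have ha0 : 0 ≤ a := by positivity
      have ha' : 1 - a = z.1.2 / S := by rw [ha]; field_simp; simp [S]
      have ha1 : 0 ≤ 1 - a := by rw [ha']; positivity
      have h1 : c * 2 ≤ ‖a • P.1 - (1 - a) • Q.1‖ := by
        rw [hc, div_mul_cancel₀ _ two_ne_zero]
        exact hmin ⟨ha0, by linarith⟩
      have h2 : ‖a • P.1 - (1 - a) • Q.1‖ ≤ ‖a • z.1.1 - (1 - a) • z.2.1‖ + c := by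
        have h3 : a • P.1 - (1 - a) • Q.1 = (a • z.1.1 - (1 - a) • z.2.1) -
            (a • (z.1.1 - P.1) - (1 - a) • (z.2.1 - Q.1)) := by
          simp only [smul_sub]; abel
        rw [h3]
        refine (norm_sub_le _ _).trans (add_le_add le_rfl ?_)
        refine (norm_sub_le _ _).trans (le_trans ?_ hz.le)
        rw [norm_smul, norm_smul, Real.norm_of_nonneg ha0, Real.norm_of_nonneg ha1]
        gcongr
        · exact mul_le_of_le_one_left (norm_nonneg _) (by linarith)
        · exact mul_le_of_le_one_left (norm_nonneg _) (by linarith)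
      have h4 : z.2.2 • z.1.1 - z.1.2 • z.2.1 = S • (a • z.1.1 - (1 - a) • z.2.1) := by
        rw [ha', smul_sub, smul_smul, smul_smul, ha, mul_div_cancel₀ _ h.ne',
          mul_div_cancel₀ _ h.ne']
      rw [h4, norm_smul, Real.norm_of_nonneg h.le, mul_comm]
      gcongr
      linarith
  · -- otherwise the two sides are comparable by continuity
    have hne0 : Q.2 • P.1 - P.2 • Q.1 ≠ 0 := by
      intro hz
      rw [sub_eq_zero] at hz
      rcases (halfSpace_snd_nonneg hP).eq_or_lt with h | h
      · rw [← h, zero_smul, smul_eq_zero] at hz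
        rcases hz with h' | h'
        · exact h0 ⟨h.symm, h'⟩
        · exact halfSpace_fst_ne_zero hP h.symm h'
      · rcases (halfSpace_snd_nonneg hQ).eq_or_lt with h' | h'
        · rw [← h', zero_smul] at hz
          rcases smul_eq_zero.1 hz.symm with h'' | h''
          · exact h.ne' h''
          · exact halfSpace_fst_ne_zero hQ h'.symm h''
        · refine hprop P.2 Q.2 h h' (Prod.ext hz ?_)
          simp [mul_comm]
    set e := ‖Q.2 • P.1 - P.2 • Q.1‖ / 2 with he
    have he0 : 0 < e := half_pos (norm_pos_iff.2 hne0)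
    set M := Q.2 + P.2 + 1 with hM
    have hM0 : 0 < M := by
      have := halfSpace_snd_nonneg hP
      have := halfSpace_snd_nonneg hQ
      positivity
    refine ⟨e / M, by positivity, ?_⟩
    have h1 : ∀ᶠ z : (Euc n × ℝ) × (Euc n × ℝ) in 𝓝 (P, Q),
        e < ‖z.2.2 • z.1.1 - z.1.2 • z.2.1‖ := by
      have : Continuous fun z : (Euc n × ℝ) × (Euc n × ℝ) =>
        ‖z.2.2 • z.1.1 - z.1.2 • z.2.1‖ := by fun_prop
      exact this.continuousAt.eventually (lt_mem_nhds (by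
        change e < ‖Q.2 • P.1 - P.2 • Q.1‖
        rw [he]
        exact half_lt_self (norm_pos_iff.2 hne0)))
    have h2 : ∀ᶠ z : (Euc n × ℝ) × (Euc n × ℝ) in 𝓝 (P, Q), z.2.2 + z.1.2 < M := by
      have : Continuous fun z : (Euc n × ℝ) × (Euc n × ℝ) => z.2.2 + z.1.2 := by fun_prop
      exact this.continuousAt.eventually (gt_mem_nhds (lt_add_one _))
    filter_upwards [h1, h2] with z hz1 hz2 _ _
    calc e / M * (z.2.2 + z.1.2) ≤ e / M * M := by gcongr
      _ = e := div_mul_cancel₀ _ hM0.ne'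
      _ ≤ _ := hz1.le

section Stationary

variable {d s : ℕ} {κd : Compactification d} {κs : Compactification s} {φ : Euc d × Euc s → ℝ}

theorem lambdaTilde_eq_of_mem (hd : 0 < d) (hs : 0 < s) (hφ : IsClassicalPhase φ)
    {p : Euc d × Euc s} (hp : p ∈ critSet κd κs φ) :
    lambdaTilde κd κs φ p = (p.1, κd.proj (fiberCoord φ (lift₂ κd κs p))) :=
  lambdaTilde_eq hd hs hφ.classical (mem_bdry_iff.1 hp.1).1 (fiberCoord_mem_halfSpace hd hs hφ hp)

/-- `λ̃_φ` respects the faces. -/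
theorem lambdaTilde_mem_closedFace_iff (hd : 0 < d) (hs : 0 < s) (hφ : IsClassicalPhase φ)
    {p : Euc d × Euc s} (hp : p ∈ critSet κd κs φ) (f : Face) :
    lambdaTilde κd κs φ p ∈ closedFace d d f ↔ p ∈ closedFace d s f := by
  have hG := fiberCoord_mem_halfSpace hd hs hφ hp
  have hpc := (mem_bdry_iff.1 hp.1).1
  have hP := lift₂_mem_closedCoord κd κs hd hs hpc
  rw [lambdaTilde_eq_of_mem hd hs hφ hp, mem_closedFace_iff', mem_closedFace_iff']
  have h2 : ‖κd.proj (fiberCoord φ (lift₂ κd κs p))‖ = 1 ↔ ‖p.2‖ = 1 := by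
    rcases (halfSpace_snd_nonneg hP.2).lt_or_eq with h | h
    · exact iff_of_false (κd.norm_proj_lt h).ne ((κs.lift_snd_pos_iff hs).1 h).ne
    · exact iff_of_true (κd.norm_proj_eq_one h.symm (halfSpace_fst_ne_zero hG h.symm))
        ((κs.lift_snd_eq_zero_iff hs).1 h.symm)
  have h3 : ((p.1, κd.proj (fiberCoord φ (lift₂ κd κs p))) : Euc d × Euc d) ∈ cball2 d d :=
    mem_cball2_iff.2 ⟨(mem_cball2_iff.1 hpc).1, κd.norm_proj_le hG⟩
  simp only [h2]
  exact and_congr_left fun _ => iff_of_true h3 hpc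

theorem lambdaTilde_mem_statSet (hd : 0 < d) (hs : 0 < s) (hφ : IsClassicalPhase φ)
    {p : Euc d × Euc s} (hp : p ∈ critSet κd κs φ) :
    lambdaTilde κd κs φ p ∈ statSet κd κs φ := by
  have hG := fiberCoord_mem_halfSpace hd hs hφ hp
  have hpc := (mem_bdry_iff.1 hp.1).1
  have hb : lambdaTilde κd κs φ p ∈ bdry d d := by
    obtain ⟨f, hf⟩ := hp.1
    exact closedFace_subset_bdry f ((lambdaTilde_mem_closedFace_iff hd hs hφ hp f).2
      (openFace_subset_closedFace subset_rfl hf))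
  refine ⟨hb, ?_⟩
  rintro ⟨U, -, hqU, V, hV, hUV, c, hc, hcV⟩
  have ht := tendsto_lambda hd hs hφ.classical hpc hG
  rw [lambdaTilde_eq_of_mem hd hs hφ hp] at hqU
  have hmem : (p.1, p.2, κd.proj (fiberCoord φ (lift₂ κd κs p))) ∈ V :=
    hUV _ _ _ hp (by simpa using κd.norm_proj_le hG) hqU
  have ht1 : Tendsto (fun q : Euc d × Euc s => q.1) (𝓝[oball2 d s] p) (𝓝 p.1) :=
    (continuous_fst.tendsto p).mono_left nhdsWithin_le_nhds
  have ht2 : Tendsto (fun q : Euc d × Euc s => q.2) (𝓝[oball2 d s] p) (𝓝 p.2) :=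
    (continuous_snd.tendsto p).mono_left nhdsWithin_le_nhds
  have ht3 := ht1.prodMk_nhds (ht2.prodMk_nhds ((continuous_snd.tendsto _).comp ht))
  have hne : (𝓝[oball2 d s] p).NeBot :=
    mem_closure_iff_nhdsWithin_neBot.1 (cball2_subset_closure hpc)
  obtain ⟨q, hqV, hq⟩ := ((ht3.eventually (hV.mem_nhds hmem)).and self_mem_nhdsWithin).exists
  have hq' := mem_oball2_iff.1 hq
  have h1 := hcV (κd.invFun q.1) (κs.invFun q.2) (gradX φ (κd.invFun q.1, κs.invFun q.2)) (by
    rw [κd.right_inv _ (by simpa using hq'.1), κs.right_inv _ (by simpa using hq'.2)]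
    exact hqV)
  rw [sub_self, norm_zero] at h1
  have h2 : 0 < jap (κs.invFun q.2) + ‖gradX φ (κd.invFun q.1, κs.invFun q.2)‖ :=
    add_pos_of_pos_of_nonneg (jap_pos _) (norm_nonneg _)
  nlinarith

/-- Away from the graph of `λ̃_φ` over `C̃_φ`, the difference `∇ₓφ - ξ` is elliptic. -/
theorem eventually_le_norm_gradX_sub (hd : 0 < d) (hs : 0 < s) (hφ : IsClassicalPhase φ)
    {p : Euc d × Euc s} (hp : p ∈ critSet κd κs φ) {η : Euc d} (hη : ‖η‖ ≤ 1)
    (hne : (p.1, η) ≠ lambdaTilde κd κs φ p) :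
    ∃ c : ℝ, 0 < c ∧ ∀ᶠ z in 𝓝 (p.1, p.2, η), ∀ (x : Euc d) (θ : Euc s) (ξ : Euc d),
      (κd.toFun x, κs.toFun θ, κd.toFun ξ) = z →
        c * (jap θ + ‖ξ‖) ≤ ‖gradX φ (x, θ) - ξ‖ := by
  have hG := fiberCoord_mem_halfSpace hd hs hφ hp
  have hpc := (mem_bdry_iff.1 hp.1).1
  have hP := lift₂_mem_closedCoord κd κs hd hs hpc
  have hX := κd.lift_mem_halfSpace hd hη
  have hne' : κd.proj (fiberCoord φ (lift₂ κd κs p)) ≠ κd.proj (κd.lift η) := by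
    rw [κd.proj_lift hd]
    intro h
    exact hne (by rw [lambdaTilde_eq_of_mem hd hs hφ hp, h])
  obtain ⟨c, hc, hcz⟩ := exists_lower_bound_of_proj_ne κd hd hG hX hne'
  set M := (κs.lift p.2).2 + ‖(κs.lift p.2).1‖ + ‖(κd.lift η).1‖ + 1 with hM
  have hM0 : 0 < M := by
    have h1 : 0 ≤ (κs.lift p.2).2 := halfSpace_snd_nonneg hP.2
    positivity
  -- the coordinates of the gradient are continuous up to the boundary
  have ht : Tendsto (fun q => fiberCoord φ (lift₂ κd κs q)) (𝓝[oball2 d s] p)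
      (𝓝 (fiberCoord φ (lift₂ κd κs p))) :=
    ((continuousAt_fiberCoord_within hφ.classical hP).mono
      interiorCoord_subset_closedCoord).tendsto.comp (tendsto_lift₂ κd κs hd hs p)
  have ht' : Tendsto (fun z : Euc d × Euc s × Euc d =>
      (fiberCoord φ (lift₂ κd κs (z.1, z.2.1)), κd.lift z.2.2))
      (𝓝 (p.1, p.2, η) ⊓ 𝓟 {z | (z.1, z.2.1) ∈ oball2 d s})
      (𝓝 (fiberCoord φ (lift₂ κd κs p), κd.lift η)) := by
    refine Tendsto.prodMk_nhds (ht.comp (tendsto_nhdsWithin_iff.2 ⟨?_, ?_⟩)) ?_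
    · have : Continuous fun z : Euc d × Euc s × Euc d => (z.1, z.2.1) := by fun_prop
      exact (this.tendsto (p.1, p.2, η)).mono_left inf_le_left
    · exact Filter.mem_inf_of_right (mem_principal_self _)
    · exact ((κd.contDiff_lift.continuous.comp continuous_snd.snd).tendsto
        (p.1, p.2, η)).mono_left inf_le_left
  have hev := eventually_inf_principal.1 (ht'.eventually hcz)
  have hevM : ∀ᶠ z : Euc d × Euc s × Euc d in 𝓝 (p.1, p.2, η),
      (κs.lift z.2.1).2 + ‖(κs.lift z.2.1).1‖ + ‖(κd.lift z.2.2).1‖ < M := by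
    have h1 : Continuous fun z : Euc d × Euc s × Euc d => κs.lift z.2.1 :=
      κs.contDiff_lift.continuous.comp continuous_snd.fst
    have h2 : Continuous fun z : Euc d × Euc s × Euc d => κd.lift z.2.2 :=
      κd.contDiff_lift.continuous.comp continuous_snd.snd
    have h3 : Continuous fun z : Euc d × Euc s × Euc d =>
        (κs.lift z.2.1).2 + ‖(κs.lift z.2.1).1‖ + ‖(κd.lift z.2.2).1‖ :=
      (h1.snd.add h1.fst.norm).add h2.fst.norm
    have h4 : (κs.lift p.2).2 + ‖(κs.lift p.2).1‖ + ‖(κd.lift η).1‖ < M := lt_add_one _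
    exact (h3.tendsto (p.1, p.2, η)).eventually_lt_const h4
  refine ⟨c / M, by positivity, ?_⟩
  filter_upwards [hev, hevM] with z hz hzM x θ ξ hzx
  subst hzx
  have hx : ‖κd.toFun x‖ < 1 := by simpa using κd.toFun_mem x
  have hθ : ‖κs.toFun θ‖ < 1 := by simpa using κs.toFun_mem θ
  have hξ : ‖κd.toFun ξ‖ < 1 := by simpa using κd.toFun_mem ξ
  have hpo : (κd.toFun x, κs.toFun θ) ∈ oball2 d s := mem_oball2_iff.2 ⟨hx, hθ⟩
  have hQ := lift₂_mem_interiorCoord κd κs hd hs hpo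
  have hdh := dehomog_lift₂ κd κs hd hs hpo
  simp only [κd.left_inv, κs.left_inv] at hdh
  have hLθ : κs.lift (κs.toFun θ) = ((κs.lift (κs.toFun θ)).2 • θ, (κs.lift (κs.toFun θ)).2) := by
    rw [κs.lift_of_lt hθ, κs.left_inv]
  have hLξ : κd.lift (κd.toFun ξ) = ((κd.lift (κd.toFun ξ)).2 • ξ, (κd.lift (κd.toFun ξ)).2) := by
    rw [κd.lift_of_lt hξ, κd.left_inv]
  have hr : 0 < (κs.lift (κs.toFun θ)).2 := κs.lift_snd_pos hs hθ
  have hτ : 0 < (κd.lift (κd.toFun ξ)).2 := κd.lift_snd_pos hd hξ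
  have hfib : fiberCoord φ (lift₂ κd κs (κd.toFun x, κs.toFun θ)) =
      ((κs.lift (κs.toFun θ)).2 • gradX φ (x, θ), (κs.lift (κs.toFun θ)).2) := by
    rw [fiberCoord, hφ.classical.extCovec_eq hQ, ← smul_gradX_eq hφ.classical.symbol.smooth, hdh]
    rfl
  have h1 := hz hpo
  simp only at h1 hzM
  rw [hfib] at h1
  have h1 := h1 hr.le hτ.le
  set r := (κs.lift (κs.toFun θ)).2 with hr_def
  set τ := (κd.lift (κd.toFun ξ)).2 with hτ_def
  rw [hLθ, hLξ] at hzM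
  rw [hLξ] at h1
  simp only at h1 hzM
  have h2 : τ • r • gradX φ (x, θ) - r • τ • ξ = (τ * r) • (gradX φ (x, θ) - ξ) := by
    rw [smul_sub, smul_smul, smul_smul, mul_comm r τ]
  rw [h2, norm_smul, Real.norm_of_nonneg (by positivity)] at h1
  rw [norm_smul, norm_smul, Real.norm_of_nonneg hr.le, Real.norm_of_nonneg hτ.le] at hzM
  have h3 : jap θ ≤ 1 + ‖θ‖ := by
    refine Real.sqrt_le_iff.2 ⟨by positivity, ?_⟩
    nlinarith [norm_nonneg θ]
  -- `⟨θ⟩ ≤ M / r` and `|ξ| ≤ M / τ`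
  have h4 : (τ * r) * (jap θ + ‖ξ‖) ≤ M * (τ + r) := by
    have h5 : r * jap θ ≤ M := by
      have : 0 ≤ τ * ‖ξ‖ := by positivity
      nlinarith
    have h6 : τ * ‖ξ‖ ≤ M := by
      have : 0 ≤ r * ‖θ‖ := by positivity
      linarith
    calc (τ * r) * (jap θ + ‖ξ‖) = τ * (r * jap θ) + r * (τ * ‖ξ‖) := by ring
      _ ≤ τ * M + r * M := by gcongr
      _ = _ := by ring
  have h7 : 0 < τ * r := mul_pos hτ hr
  refine le_of_mul_le_mul_left ?_ h7
  calc τ * r * (c / M * (jap θ + ‖ξ‖)) = c / M * (τ * r * (jap θ + ‖ξ‖)) := by ring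
    _ ≤ c / M * (M * (τ + r)) := by gcongr
    _ = c * (τ + r) := by field_simp
    _ ≤ _ := h1

theorem statSet_eq_image (hd : 0 < d) (hs : 0 < s) (hφ : IsClassicalPhase φ) :
    statSet κd κs φ = lambdaTilde κd κs φ '' critSet κd κs φ := by
  refine Subset.antisymm ?_ (by rintro _ ⟨p, hp, rfl⟩; exact lambdaTilde_mem_statSet hd hs hφ hp)
  rintro q ⟨hqb, hq⟩
  by_contra hcon
  refine hq ?_
  have hK := isCompact_critSet (κd := κd) (κs := κs) hd hs hφ.classical
  have hcl : IsClosed (lambdaTilde κd κs φ '' critSet κd κs φ) :=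
    (hK.image_of_continuousOn (continuousOn_lambdaTilde hd hs hφ)).isClosed
  obtain ⟨δ, hδ, hδq⟩ := nhds_basis_closedBall.mem_iff.1 (hcl.isOpen_compl.mem_nhds hcon)
  -- the compact set over which the estimate has to be established
  let T : Set (Euc d × Euc s × Euc d) :=
    (fun z : (Euc d × Euc s) × Euc d => (z.1.1, z.1.2, z.2)) ''
      ((critSet κd κs φ ×ˢ closedBall 0 1) ∩ {z | (z.1.1, z.2) ∈ closedBall q δ})
  have hT : IsCompact T := by
    refine IsCompact.image ?_ (by fun_prop)
    refine (hK.prod (isCompact_closedBall _ _)).inter_right ?_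
    have : Continuous fun z : (Euc d × Euc s) × Euc d => (z.1.1, z.2) := by fun_prop
    exact isClosed_closedBall.preimage this
  obtain ⟨V, hV, hTV, c, hc, hcV⟩ : ∃ V : Set (Euc d × Euc s × Euc d), IsOpen V ∧ T ⊆ V ∧
      ∃ c : ℝ, 0 < c ∧ ∀ (x : Euc d) (θ : Euc s) (ξ : Euc d),
        (κd.toFun x, κs.toFun θ, κd.toFun ξ) ∈ V →
          c * (jap θ + ‖ξ‖) ≤ ‖gradX φ (x, θ) - ξ‖ := by
    refine hT.induction_on (p := fun T => ∃ V : Set (Euc d × Euc s × Euc d), IsOpen V ∧ T ⊆ V ∧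
      ∃ c : ℝ, 0 < c ∧ ∀ (x : Euc d) (θ : Euc s) (ξ : Euc d),
        (κd.toFun x, κs.toFun θ, κd.toFun ξ) ∈ V →
          c * (jap θ + ‖ξ‖) ≤ ‖gradX φ (x, θ) - ξ‖) ?_ ?_ ?_ ?_
    · exact ⟨∅, isOpen_empty, subset_rfl, 1, one_pos, fun _ _ _ h => h.elim⟩
    · rintro S S' hSS ⟨V, hV, hSV, h⟩
      exact ⟨V, hV, hSS.trans hSV, h⟩
    · rintro S S' ⟨V, hV, hSV, c, hc, h⟩ ⟨V', hV', hSV', c', hc', h'⟩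
      refine ⟨V ∪ V', hV.union hV', union_subset_union hSV hSV', min c c', lt_min hc hc',
        fun x θ ξ hx => ?_⟩
      have h0 : 0 ≤ jap θ + ‖ξ‖ := add_nonneg (jap_pos _).le (norm_nonneg _)
      rcases hx with hx | hx
      · exact (mul_le_mul_of_nonneg_right (min_le_left _ _) h0).trans (h x θ ξ hx)
      · exact (mul_le_mul_of_nonneg_right (min_le_right _ _) h0).trans (h' x θ ξ hx)
    · rintro _ ⟨⟨p, η⟩, ⟨⟨hp, hη⟩, hpη⟩, rfl⟩
      have hne : (p.1, η) ≠ lambdaTilde κd κs φ p := fun h =>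
        hδq hpη ⟨p, hp, h.symm⟩
      obtain ⟨c, hc, hcz⟩ := eventually_le_norm_gradX_sub hd hs hφ hp (by simpa using hη) hne
      obtain ⟨W, hW, hWo, hpW⟩ := _root_.eventually_nhds_iff.1 hcz
      exact ⟨W, mem_nhdsWithin_of_mem_nhds (hWo.mem_nhds hpW), W, hWo, subset_rfl, c, hc,
        fun x θ ξ hx => hW _ hx x θ ξ rfl⟩
  refine ⟨ball q δ, isOpen_ball, mem_ball_self hδ, V, hV, fun y γ η hyγ hη hyη => ?_, c, hc, hcV⟩
  exact hTV ⟨((y, γ), η), ⟨⟨hyγ, hη⟩, ball_subset_closedBall hyη⟩, rfl⟩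

theorem image_critPart (hd : 0 < d) (hs : 0 < s) (hφ : IsClassicalPhase φ) (f : Face) :
    lambdaTilde κd κs φ '' critPart κd κs φ f = statPart κd κs φ f := by
  rw [statPart, statSet_eq_image hd hs hφ]
  ext q
  constructor
  · rintro ⟨p, hp, rfl⟩
    exact ⟨⟨p, hp.1, rfl⟩, (lambdaTilde_mem_closedFace_iff hd hs hφ hp.1 f).2 hp.2⟩
  · rintro ⟨⟨p, hp, rfl⟩, hq⟩
    exact ⟨p, ⟨hp, (lambdaTilde_mem_closedFace_iff hd hs hφ hp f).1 hq⟩, rfl⟩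

end Stationary

/-! ### The stationary points as an immersed submanifold -/

section Assembly

variable {d s : ℕ} {κd : Compactification d} {κs : Compactification s} {φ : Euc d × Euc s → ℝ}

theorem exists_isExpansionAt_lift₂ (hd : 0 < d) (hs : 0 < s) (hφ : IsClassicalPhase φ) {f : Face}
    {p : Euc d × Euc s} (hp : p ∈ closedFace d s f) :
    ∃ Φ₀ Φ₁, IsExpansionAt φ (faceFn f) (lift₂ κd κs p) Φ₀ Φ₁ :=
  hφ.classical.exists_isExpansionAt f
    (lift₂_mem_closedCoord κd κs hd hs (closedFace_subset_cball2 f hp))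
    (faceFn_lift₂_eq_zero hd hs hp)

theorem critSet_eq_union : critSet κd κs φ = critPart κd κs φ .e ∪ critPart κd κs φ .ψ := by
  rw [critPart, critPart, ← inter_union_distrib_left, ← bdry_eq_union]
  exact (inter_eq_left.2 fun _ hp => hp.1).symm

theorem critPart_inter : critPart κd κs φ .e ∩ critPart κd κs φ .ψ = critPart κd κs φ .ψe := by
  rw [critPart, critPart, ← inter_inter_distrib_left, closedFace_inter, critPart]

theorem statSet_eq_union : statSet κd κs φ = statPart κd κs φ .e ∪ statPart κd κs φ .ψ := by
  rw [statPart, statPart, ← inter_union_distrib_left, ← bdry_eq_union]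
  exact (inter_eq_left.2 fun _ hp => hp.1).symm

theorem statPart_inter : statPart κd κs φ .e ∩ statPart κd κs φ .ψ = statPart κd κs φ .ψe := by
  rw [statPart, statPart, ← inter_inter_distrib_left, closedFace_inter, statPart]

theorem injOn_dLambdaTilde (hd : 0 < d) (hs : 0 < s) (hφ : IsClassicalPhase φ)
    (hnd : NonDegenerate κd κs φ) {f : Face} {p : Euc d × Euc s} (hp : p ∈ critPart κd κs φ f) :
    InjOn (dLambdaTilde κd κs φ p) (tangentSpan (critPart κd κs φ f) p : Set (Euc d × Euc s)) := by
  obtain ⟨Φ₀, Φ₁, h⟩ := exists_isExpansionAt_lift₂ (κd := κd) (κs := κs) hd hs hφ hp.2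
  intro v hv w hw hvw
  refine sub_eq_zero.1 ((h.local_structure_critPart hd hs hφ hnd hp.1 hp.2).2.1 (v - w)
    (Submodule.sub_mem _ hv hw) ?_)
  rw [map_sub, hvw, sub_self]

/-- Since `λ̃_φ` respects the faces, it is enough to have local injectivity on each face. -/
theorem exists_isOpen_injOn_lambdaTilde (hd : 0 < d) (hs : 0 < s) (hφ : IsClassicalPhase φ)
    (hnd : NonDegenerate κd κs φ) {p : Euc d × Euc s} (hp : p ∈ critSet κd κs φ) :
    ∃ O : Set (Euc d × Euc s), IsOpen O ∧ p ∈ O ∧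
      InjOn (lambdaTilde κd κs φ) (critSet κd κs φ ∩ closure O) := by
  have hface : ∀ f : Face, ∃ N ∈ 𝓝 p, InjOn (lambdaTilde κd κs φ) (critPart κd κs φ f ∩ N) := by
    intro f
    by_cases hf : p ∈ closedFace d s f
    · obtain ⟨Φ₀, Φ₁, h⟩ := exists_isExpansionAt_lift₂ (κd := κd) (κs := κs) hd hs hφ hf
      exact (h.local_structure_critPart hd hs hφ hnd hp hf).2.2.1
    · exact ⟨_, (isClosed_closedFace f).isOpen_compl.mem_nhds hf,
        fun a ha => (ha.2 ha.1.2).elim⟩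
  obtain ⟨N, hN, hNi⟩ := hface .e
  obtain ⟨N', hN', hNi'⟩ := hface .ψ
  obtain ⟨K, hK, hKc, hKN⟩ := exists_mem_nhds_isClosed_subset (inter_mem hN hN')
  refine ⟨interior K, isOpen_interior, mem_interior_iff_mem_nhds.2 hK, ?_⟩
  rintro a ⟨ha, haK⟩ b ⟨hb, hbK⟩ hab
  have hsub := (closure_minimal interior_subset hKc).trans hKN
  have hmem : ∀ f, a ∈ critPart κd κs φ f → b ∈ critPart κd κs φ f := fun f haf =>
    ⟨hb, (lambdaTilde_mem_closedFace_iff hd hs hφ hb f).1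
      (hab ▸ (lambdaTilde_mem_closedFace_iff hd hs hφ ha f).2 haf.2)⟩
  have ha' := ha
  rw [critSet_eq_union] at ha'
  rcases ha' with h | h
  · exact hNi ⟨h, (hsub haK).1⟩ ⟨hmem _ h, (hsub hbK).1⟩ hab
  · exact hNi' ⟨h, (hsub haK).2⟩ ⟨hmem _ h, (hsub hbK).2⟩ hab

/-- Where `λ̃_φ` is injective it is an embedding: by compactness of `C̃_φ`, points of the image near
`λ̃_φ(p)` have preimages near `p`. -/
theorem eventually_mem_image_lambdaTilde (hd : 0 < d) (hs : 0 < s) (hφ : IsClassicalPhase φ)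
    {O : Set (Euc d × Euc s)}
    (hinj : InjOn (lambdaTilde κd κs φ) (critSet κd κs φ ∩ closure O)) (f : Face)
    {p : Euc d × Euc s} (hp : p ∈ critSet κd κs φ ∩ O) {N : Set (Euc d × Euc s)} (hN : N ∈ 𝓝 p) :
    ∀ᶠ q in 𝓝 (lambdaTilde κd κs φ p), q ∈ lambdaTilde κd κs φ '' (critPart κd κs φ f ∩ O) →
      q ∈ lambdaTilde κd κs φ '' (critPart κd κs φ f ∩ N) := by
  have hK : IsCompact ((critSet κd κs φ ∩ closure O) \ interior N) :=
    ((isCompact_critSet hd hs hφ.classical).inter_right isClosed_closure).diff isOpen_interior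
  have hcl := (hK.image_of_continuousOn ((continuousOn_lambdaTilde hd hs hφ).mono
    fun _ h => h.1.1)).isClosed
  have hp' : lambdaTilde κd κs φ p ∉
      lambdaTilde κd κs φ '' ((critSet κd κs φ ∩ closure O) \ interior N) := by
    rintro ⟨b, hb, hbp⟩
    rw [hinj hb.1 ⟨hp.1, subset_closure hp.2⟩ hbp] at hb
    exact hb.2 (mem_interior_iff_mem_nhds.2 hN)
  filter_upwards [hcl.isOpen_compl.mem_nhds hp']
  rintro _ hq ⟨b, hb, rfl⟩
  refine ⟨b, ⟨hb.1, ?_⟩, rfl⟩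
  by_contra hbN
  exact hq ⟨b, ⟨⟨hb.1.1, subset_closure hb.2⟩, fun h => hbN (interior_subset h)⟩, rfl⟩

theorem image_critPart_subset (hd : 0 < d) (hs : 0 < s) (hφ : IsClassicalPhase φ) (f : Face)
    (O : Set (Euc d × Euc s)) :
    lambdaTilde κd κs φ '' (critPart κd κs φ f ∩ O) ⊆ closedFace d d f := by
  rintro _ ⟨b, hb, rfl⟩
  exact (lambdaTilde_mem_closedFace_iff hd hs hφ hb.1.1 f).2 hb.1.2

theorem tangentSpan_image_critPart (hd : 0 < d) (hs : 0 < s) (hφ : IsClassicalPhase φ)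
    (hnd : NonDegenerate κd κs φ) {O : Set (Euc d × Euc s)} (hO : IsOpen O)
    (hinj : InjOn (lambdaTilde κd κs φ) (critSet κd κs φ ∩ closure O)) {f : Face}
    {p : Euc d × Euc s} (hp : p ∈ critPart κd κs φ f ∩ O) :
    tangentSpan (lambdaTilde κd κs φ '' (critPart κd κs φ f ∩ O)) (lambdaTilde κd κs φ p) =
      (tangentSpan (critPart κd κs φ f) p).map (dLambdaTilde κd κs φ p).toLinearMap := by
  obtain ⟨Φ₀, Φ₁, h⟩ := exists_isExpansionAt_lift₂ (κd := κd) (κs := κs) hd hs hφ hp.1.2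
  exact ((h.local_structure_critPart hd hs hφ hnd hp.1.1 hp.1.2).2.2.2 _
    (image_critPart_subset hd hs hφ f O)
    (fun N hN => eventually_mem_image_lambdaTilde hd hs hφ hinj f ⟨hp.1.1, hp.2⟩ hN)
    ⟨O, hO.mem_nhds hp.2, subset_rfl⟩).1

theorem lagDim_eq (d : ℕ) (f : Face) : lagDim d f = (d : ℤ) - (faceIdx f).card := by
  cases f <;> simp [lagDim, faceIdx]

theorem isTotallyNeat_image_critPart (hd : 0 < d) (hs : 0 < s) (hφ : IsClassicalPhase φ)
    (hnd : NonDegenerate κd κs φ) {O : Set (Euc d × Euc s)} (hO : IsOpen O)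
    (hinj : InjOn (lambdaTilde κd κs φ) (critSet κd κs φ ∩ closure O)) (f : Face) :
    IsTotallyNeat (closedFace d d f) (lambdaTilde κd κs φ '' (critPart κd κs φ f ∩ O))
      (lagDim d f) (d : ℤ) := by
  refine ⟨image_critPart_subset hd hs hφ f O, ?_⟩
  rintro _ ⟨p, hp, rfl⟩
  obtain ⟨Φ₀, Φ₁, h⟩ := exists_isExpansionAt_lift₂ (κd := κd) (κs := κs) hd hs hφ hp.1.2
  obtain ⟨-, n, k, ν, F, Λ', h1, h2, h3, h4, h5, h6, h7⟩ :=
    (h.local_structure_critPart hd hs hφ hnd hp.1.1 hp.1.2).2.2.2 _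
      (image_critPart_subset hd hs hφ f O)
      (fun N hN => eventually_mem_image_lambdaTilde hd hs hφ hinj f ⟨hp.1.1, hp.2⟩ hN)
      ⟨O, hO.mem_nhds hp.2, subset_rfl⟩
  refine ⟨n, k, ν, F, Λ', h1, h2, h3, h4, h5, ?_, ?_⟩
  · rw [lagDim_eq]; omega
  · omega

theorem image_critPart_inter
    {O : Set (Euc d × Euc s)}
    (hinj : InjOn (lambdaTilde κd κs φ) (critSet κd κs φ ∩ closure O)) :
    lambdaTilde κd κs φ '' (critPart κd κs φ .e ∩ O) ∩
        lambdaTilde κd κs φ '' (critPart κd κs φ .ψ ∩ O) =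
      lambdaTilde κd κs φ '' (critPart κd κs φ .ψe ∩ O) := by
  rw [← hinj.image_inter (fun a ha => ⟨ha.1.1, subset_closure ha.2⟩)
    (fun a ha => ⟨ha.1.1, subset_closure ha.2⟩), ← inter_inter_distrib_right, critPart_inter]

/-- The intersection in the corner is clean. Two tangent vectors of `C̃_φ^e` and `C̃_φ^ψ` with the
same image under `dλ̃_φ` have the same `y`-component, since `λ̃_φ` preserves `y`; hence the one
tangent to the face `ψ` is also tangent to the face `e`. -/
theorem tangentSpan_image_corner (hd : 0 < d) (hs : 0 < s) (hφ : IsClassicalPhase φ)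
    (hnd : NonDegenerate κd κs φ) {O : Set (Euc d × Euc s)} (hO : IsOpen O)
    (hinj : InjOn (lambdaTilde κd κs φ) (critSet κd κs φ ∩ closure O))
    {p : Euc d × Euc s} (hp : p ∈ critPart κd κs φ .ψe ∩ O) :
    tangentSpan (lambdaTilde κd κs φ '' (critPart κd κs φ .ψe ∩ O)) (lambdaTilde κd κs φ p) =
      tangentSpan (lambdaTilde κd κs φ '' (critPart κd κs φ .e ∩ O)) (lambdaTilde κd κs φ p) ⊓
      tangentSpan (lambdaTilde κd κs φ '' (critPart κd κs φ .ψ ∩ O)) (lambdaTilde κd κs φ p) := by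
  have hpi := hp.1
  rw [← critPart_inter] at hpi
  obtain ⟨hpe, hpψ⟩ := hpi
  refine le_antisymm (le_inf ?_ ?_) ?_
  · rw [← image_critPart_inter hinj]
    exact Submodule.span_mono (tangentConeAt_mono inter_subset_left)
  · rw [← image_critPart_inter hinj]
    exact Submodule.span_mono (tangentConeAt_mono inter_subset_right)
  · rw [tangentSpan_image_critPart hd hs hφ hnd hO hinj hp,
      tangentSpan_image_critPart hd hs hφ hnd hO hinj ⟨hpe, hp.2⟩,
      tangentSpan_image_critPart hd hs hφ hnd hO hinj ⟨hpψ, hp.2⟩]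
    rintro _ ⟨⟨v, hv, rfl⟩, ⟨w, hw, hwv⟩⟩
    refine ⟨w, ?_, hwv⟩
    obtain ⟨Φ₀, Φ₁, h⟩ := exists_isExpansionAt_lift₂ (κd := κd) (κs := κs) hd hs hφ hpψ.2
    obtain ⟨Ψ₀, Ψ₁, h'⟩ := exists_isExpansionAt_lift₂ (κd := κd) (κs := κs) hd hs hφ hpe.2
    -- the expansions used at the face `ψ` and at the corner are the same
    have hc : IsExpansionAt φ (faceFn .ψe) (lift₂ κd κs p) Φ₀ Φ₁ := h
    have hfst : w.1 = v.1 := by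
      rw [← h.dLambdaTilde_apply_fst hd hs hφ hpψ.1 hpψ.2 w,
        ← h.dLambdaTilde_apply_fst hd hs hφ hpψ.1 hpψ.2 v]
      exact congrArg Prod.fst hwv
    have hv' := ((h'.local_structure_critPart hd hs hφ hnd hpe.1 hpe.2).1 v).1 hv
    have hw' := ((h.local_structure_critPart hd hs hφ hnd hpψ.1 hpψ.2).1 w).1 hw
    refine ((hc.local_structure_critPart hd hs hφ hnd hp.1.1 hp.1.2).1 w).2 ⟨hw'.1, fun i hi => ?_⟩
    rcases Finset.mem_insert.1 hi with rfl | hi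
    · have := hv'.2 0 (Finset.mem_singleton_self 0)
      rw [fderiv_bdf_zero] at this ⊢
      rw [hfst, this]
    · exact hw'.2 i hi

end Assembly

end SG

end

theorem mainTheorem4 (d s : ℕ) (hd : 0 < d) (hs : 0 < s)
    (κd : SG.Compactification d) (κs : SG.Compactification s)
    (φ : SG.Euc d × SG.Euc s → ℝ) (hφ : SG.IsClassicalPhase φ)
    (hnd : SG.NonDegenerate κd κs φ) :
    -- the components of the set of stationary points, and their parametrization
    SG.statSet κd κs φ = SG.statPart κd κs φ .e ∪ SG.statPart κd κs φ .ψ ∧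
    SG.statPart κd κs φ .e ∩ SG.statPart κd κs φ .ψ = SG.statPart κd κs φ .ψe ∧
    (∀ f : SG.Face, SG.lambdaTilde κd κs φ '' SG.critPart κd κs φ f = SG.statPart κd κs φ f) ∧
    -- the parametrization is an immersion, and it is locally injective
    (∀ f : SG.Face, ∀ p ∈ SG.critPart κd κs φ f,
      Set.InjOn (SG.dLambdaTilde κd κs φ p)
        (SG.tangentSpan (SG.critPart κd κs φ f) p : Set (SG.Euc d × SG.Euc s))) ∧
    (∀ p ∈ SG.critSet κd κs φ, ∃ O : Set (SG.Euc d × SG.Euc s), IsOpen O ∧ p ∈ O ∧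
      Set.InjOn (SG.lambdaTilde κd κs φ) (SG.critSet κd κs φ ∩ closure O)) ∧
    -- wherever it is injective (on small open sets; everywhere if it is globally injective), the
    -- images of the three parts are totally neat submanifolds of the faces, with the stated
    -- dimensions and tangent spaces, and they intersect cleanly in the corner
    (∀ O : Set (SG.Euc d × SG.Euc s), IsOpen O →
      Set.InjOn (SG.lambdaTilde κd κs φ) (SG.critSet κd κs φ ∩ closure O) →
      ∀ L : SG.Face → Set (SG.Euc d × SG.Euc d),
      (∀ f, L f = SG.lambdaTilde κd κs φ '' (SG.critPart κd κs φ f ∩ O)) →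
        (∀ f, SG.IsTotallyNeat (SG.closedFace d d f) (L f) (SG.lagDim d f) (d : ℤ)) ∧
        (∀ f, ∀ p ∈ SG.critPart κd κs φ f ∩ O,
          SG.tangentSpan (L f) (SG.lambdaTilde κd κs φ p) =
            (SG.tangentSpan (SG.critPart κd κs φ f) p).map
              (SG.dLambdaTilde κd κs φ p).toLinearMap) ∧
        L .e ∩ L .ψ = L .ψe ∧
        ∀ q ∈ L .ψe,
          SG.tangentSpan (L .ψe) q = SG.tangentSpan (L .e) q ⊓ SG.tangentSpan (L .ψ) q) := by

  refine ⟨SG.statSet_eq_union, SG.statPart_inter, SG.image_critPart hd hs hφ,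
    fun f p hp => SG.injOn_dLambdaTilde hd hs hφ hnd hp,
    fun p hp => SG.exists_isOpen_injOn_lambdaTilde hd hs hφ hnd hp, fun O hO hinj L hL => ?_⟩
  obtain rfl : L = fun f => SG.lambdaTilde κd κs φ '' (SG.critPart κd κs φ f ∩ O) := funext hL
  refine ⟨SG.isTotallyNeat_image_critPart hd hs hφ hnd hO hinj,
    fun f p hp => SG.tangentSpan_image_critPart hd hs hφ hnd hO hinj hp,
    SG.image_critPart_inter hinj, ?_⟩
  rintro _ ⟨p, hp, rfl⟩
  exact SG.tangentSpan_image_corner hd hs hφ hnd hO hinj hp
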